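/- **Setting.** Let $n\ge 1$, $s>0$, $T>0$, and let $\Omega\subset\mathbb R^n$ be a bounded Lipschitz domain (open, nonempty, connected, bounded, locally the set above the graph of a Lipschitz function near each boundary point). Write $\Omega_T=\Omega\times(0,T)$ and $\Omega_e=\mathbb R^n\setminus\overline\Omega$. All functions are real valued. For $\sigma\in\mathbb R$, $H^\sigma(\mathbb R^n)$ is the space of tempered distributions $u$ with $\|u\|_{H^\sigma(\mathbb R^n)}=\|\langle D\rangle^\sigma u\|_{L^2(\mathbb R^n)}<\infty$, where $\langle D\rangle^\sigma$ has Fourier symbol $(1+|\xi|^2)^{\sigma/2}$. The operator $(-\Delta)^{s/2}$ has Fourier symbol $|\xi|^{s}$. $\widetilde H^s(\Omega)$ is the closure of $C_c^\infty(\Omega)$ in $H^s(\mathbb R^n)$, with the norm of $H^s(\mathbb R^n)$. $H^{-s}(\Omega)$ is the space of restrictions to $\Omega$ of elements of $H^{-s}(\mathbb R^n)$, with the quotient norm, and $\langle\cdot,\cdot\rangle$ is the duality pairing between $H^{-s}(\Omega)$ and $\widetilde H^s(\Omega)$. With $V=\widetilde H^s(\Omega)\hookrightarrow L^2(\Omega)\hookrightarrow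 V^*$, let $\widetilde W(0,T;V)$ be the space of $u\in L^2(0,T;V)$ with $\partial_tu\in L^2(0,T;V)$ and $\partial_t^2u\in L^2(0,T;V^*)$, where the derivatives are taken in the sense of vector-valued distributions on $(0,T)$. Given $u_0\in\widetilde H^s(\Omega)$, $u_1\in L^2(\Omega)$ and $h\in L^2(0,T;H^{-s}(\Omega))$, a solution $u\in\widetilde W(0,T;\widetilde H^s(\Omega))$ of $$\begin{cases}\big(\partial_t^2+(-\Delta)^s\partial_t+(-\Delta)^s+q\big)u=h&\text{in }\Omega_T,\\ u=0&\text{in }(\Omega_e)_T=\Omega_e\times(0,T),\\ u(0)=u_0,\ \partial_tu(0)=u_1&\text{in }\Omega\end{cases}\qquad(*)$$ is a function $u\in\widetilde W(0,T;\widetilde H^s(\Omega))$ such that $u=0$ a.e. in $(\Omega_e)_T$, such that for every $v\in\widetilde H^s(\Omega)$ $$\frac{d}{dt}\langle\partial_tu,v\rangle_{L^2(\Omega)}+\langle(-\Delta)^{s/2}\partial_tu,(-\Delta)^{s/2}v\rangle_{L^2(\mathbb R^n)}+\langle(-\Delta)^{s/2}u,(-\Delta)^{s/2}v\rangle_{L^2(\mathbb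 R^n)}+\int_\Omega q\,u\,v\,dx=\langle h,v\rangle$$ in the sense of distributions on $(0,T)$, and such that $u$ and $\partial_tu$ have representatives in $C([0,T];\widetilde H^s(\Omega))$ and $C([0,T];L^2(\Omega))$ whose values at $t=0$ are $u_0$ and $u_1$. **Theorem.** Let $q\in L^1_{loc}(\Omega_T)$ be real valued and such that 1. $q\in L^\infty(0,T;L^p(\Omega))$ for some $p$ with $n/s\le p\le\infty$ if $2s<n$; $2<p\le\infty$ if $2s=n$; $2\le p\le\infty$ if $2s>n$; 2. for every $\varphi\in C_c^\infty(\Omega)$ the function $t\mapsto\int_\Omega q(x,t)\varphi(x)\,dx$ belongs to $C([0,T])$ (that is, it agrees a.e. on $(0,T)$ with a continuous function on $[0,T]$). Then for all $(u_0,u_1)\in\widetilde H^s(\Omega)\times L^2(\Omega)$ and $h\in L^2(0,T;H^{-s}(\Omega))$ there is a unique solution $u\in\widetilde W(0,T;\widetilde H^s(\Omega))$ of $(*)$. Its continuous representatives satisfy, for all $t\in[0,T]$, the energy identity $$\|\partial_tu(t)\|_{L^2(\Omega)}^2+\|(-\Delta)^{s/2}u(t)\|_{L^2(\mathbb R^n)}^2+2\int_0^t\|(-\Delta)^{s/2}\partial_tu(\tau)\|_{L^2(\mathbb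 R^n)}^2\,d\tau$$ $$=\|u_1\|_{L^2(\Omega)}^2+\|(-\Delta)^{s/2}u_0\|_{L^2(\mathbb R^n)}^2+2\int_0^t\langle h(\tau),\partial_tu(\tau)\rangle\,d\tau-2\int_0^t\int_\Omega q\,u\,\partial_tu\,dx\,d\tau,$$ where all integrals converge absolutely. Moreover, there is a constant $C>0$, which may depend on $n,\Omega,s,T,q$ but not on the data, such that if $u_j$ is the solution of $(*)$ with data $(u_{0,j},u_{1,j})\in\widetilde H^s(\Omega)\times L^2(\Omega)$ and $h_j\in L^2(0,T;H^{-s}(\Omega))$, $j=1,2$, then $$\|u_1-u_2\|_{L^\infty(0,T;\widetilde H^s(\Omega))}+\|\partial_tu_1-\partial_tu_2\|_{L^\infty(0,T;L^2(\Omega))}+\|\partial_tu_1-\partial_tu_2\|_{L^2(0,T;\widetilde H^s(\Omega))}$$ $$\le C\big(\|u_{0,1}-u_{0,2}\|_{\widetilde H^s(\Omega)}+\|u_{1,1}-u_{1,2}\|_{L^2(\Omega)}+\|h_1-h_2\|_{L^2(0,T;H^{-s}(\Omega))}\big).$$ -/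

import Mathlib

open MeasureTheory Set Filter Topology FourierTransform TemperedDistribution
open scoped SchwartzMap ENNReal NNReal ContDiff Real

namespace ViscousWave
noncomputable section

/-- The Euclidean space of dimension `n`. -/
abbrev E (n : ℕ) : Type := EuclideanSpace ℝ (Fin n)

/-- The symbol `(1 + |ξ|²)^(σ/2)` of the Bessel potential operator of order `σ`. The Fourier transform of
Mathlib has the kernel `exp(-2πi x·ξ)`, so that its frequency `ξ` stands for `2πξ` in the convention
with kernel `exp(-i x·ξ)`. -/
def besselSymbol (n : ℕ) (σ : ℝ) (ξ : E n) : ℝ := (1 + (2 * π * ‖ξ‖) ^ 2) ^ (σ / 2)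

theorem besselSymbol_pos (n : ℕ) (σ : ℝ) (ξ : E n) : 0 < besselSymbol n σ ξ := by
  unfold besselSymbol; positivity

theorem besselSymbol_mul (n : ℕ) (σ τ : ℝ) (ξ : E n) :
    besselSymbol n σ ξ * besselSymbol n τ ξ = besselSymbol n (σ + τ) ξ := by
  unfold besselSymbol
  rw [← Real.rpow_add (by positivity)]; congr 1; ring

theorem besselSymbol_temperate (n : ℕ) (σ : ℝ) :
    (fun ξ : E n ↦ (besselSymbol n σ ξ : ℂ)).HasTemperateGrowth := by
  have h1 := Function.hasTemperateGrowth_one_add_norm_sq_rpow (E n) (σ / 2)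
  have h2 : (fun ξ : E n ↦ besselSymbol n σ ξ).HasTemperateGrowth := by
    have h3 := h1.comp ((2 * π) • ContinuousLinearMap.id ℝ (E n)).hasTemperateGrowth
    have h4 : (fun ξ : E n ↦ besselSymbol n σ ξ) = (fun x : E n ↦ (1 + ‖x‖ ^ 2) ^ (σ / 2)) ∘
        ((2 * π) • ContinuousLinearMap.id ℝ (E n)) := by
      ext ξ
      simp [besselSymbol, norm_smul, abs_of_pos Real.pi_pos]
    rw [h4]; exact h3
  fun_prop

/-- The Bessel potential operator of order `σ` on tempered distributions. -/
def bessel (n : ℕ) (σ : ℝ) : 𝓢'(E n, ℂ) →L[ℂ] 𝓢'(E n, ℂ) :=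
  fourierMultiplierCLM ℂ (fun ξ ↦ (besselSymbol n σ ξ : ℂ))

theorem bessel_bessel (n : ℕ) (σ τ : ℝ) (u : 𝓢'(E n, ℂ)) :
    bessel n τ (bessel n σ u) = bessel n (σ + τ) u := by
  unfold bessel
  rw [fourierMultiplierCLM_fourierMultiplierCLM_apply (besselSymbol_temperate n σ)
    (besselSymbol_temperate n τ)]
  congr 2
  ext ξ
  rw [← besselSymbol_mul]; simp

theorem bessel_zero (n : ℕ) (u : 𝓢'(E n, ℂ)) : bessel n 0 u = u := by
  have : (fun ξ : E n ↦ (besselSymbol n 0 ξ : ℂ)) = fun _ ↦ 1 := by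
    ext ξ; simp [besselSymbol]
  simp [bessel, this]

/-- A tempered distribution is real valued if it takes real values on real Schwartz functions. -/
def IsRealDist {n : ℕ} (u : 𝓢'(E n, ℂ)) : Prop :=
  ∀ φ : 𝓢(E n, ℂ), (∀ x, (φ x).im = 0) → (u φ).im = 0

theorem toDist_injective (n : ℕ) (f g : Lp ℂ 2 (volume : Measure (E n)))
    (h : (f : 𝓢'(E n, ℂ)) = g) : f = g := by
  have := LinearMap.ker_eq_bot.mp
    (Lp.ker_toTemperedDistributionCLM_eq_bot (F := ℂ) (E := E n) (μ := volume) (p := 2))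
  exact this h

/-- The real valued tempered distributions `u` with `⟨D⟩^σ u ∈ L²(ℝⁿ)`. -/
def sobolevSubmodule (n : ℕ) (σ : ℝ) : Submodule ℝ 𝓢'(E n, ℂ) where
  carrier := {u | IsRealDist u ∧
    ∃ f : Lp ℂ 2 (volume : Measure (E n)), bessel n σ u = (f : 𝓢'(E n, ℂ))}
  add_mem' := by
    rintro u v ⟨hu, f, hf⟩ ⟨hv, g, hg⟩
    refine ⟨fun φ hφ ↦ by simp [hu φ hφ, hv φ hφ], f + g, ?_⟩
    rw [map_add, hf, hg]
    exact (map_add (Lp.toTemperedDistributionCLM ℂ volume 2) f g).symm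
  zero_mem' := ⟨fun φ _ ↦ by simp, 0, by
    rw [map_zero]; exact (map_zero (Lp.toTemperedDistributionCLM ℂ volume 2)).symm⟩
  smul_mem' := by
    rintro c u ⟨hu, f, hf⟩
    refine ⟨fun φ hφ ↦ by simp [hu φ hφ], c • f, ?_⟩
    rw [ContinuousLinearMap.map_smul_of_tower, hf]
    exact ((Lp.toTemperedDistributionCLM ℂ volume 2).map_smul_of_tower c f).symm

/-- The fractional Sobolev space `H^σ(ℝⁿ)` of real valued tempered distributions, for any real `σ`.
It is normed below by `‖u‖ = ‖⟨D⟩^σ u‖_{L²}`. -/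
def SobolevSpace (n : ℕ) (σ : ℝ) : Type := sobolevSubmodule n σ

instance (n : ℕ) (σ : ℝ) : AddCommGroup (SobolevSpace n σ) :=
  inferInstanceAs (AddCommGroup (sobolevSubmodule n σ))

instance (n : ℕ) (σ : ℝ) : Module ℝ (SobolevSpace n σ) :=
  inferInstanceAs (Module ℝ (sobolevSubmodule n σ))

/-- The tempered distribution that an element of `H^σ(ℝⁿ)` is. -/
def SobolevSpace.toDist (n : ℕ) (σ : ℝ) : SobolevSpace n σ →ₗ[ℝ] 𝓢'(E n, ℂ) :=
  (sobolevSubmodule n σ).subtype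

theorem SobolevSpace.toDist_injective (n : ℕ) (σ : ℝ) :
    Function.Injective (SobolevSpace.toDist n σ) := Subtype.val_injective

theorem SobolevSpace.exists_besselL2 {n : ℕ} {σ : ℝ} (u : SobolevSpace n σ) :
    ∃ f : Lp ℂ 2 (volume : Measure (E n)),
      bessel n σ (SobolevSpace.toDist n σ u) = (f : 𝓢'(E n, ℂ)) := u.2.2

/-- The `L²` function `⟨D⟩^σ u` for `u ∈ H^σ(ℝⁿ)`. -/
def SobolevSpace.besselL2 (n : ℕ) (σ : ℝ) :
    SobolevSpace n σ →ₗ[ℝ] Lp ℂ 2 (volume : Measure (E n)) where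
  toFun u := u.exists_besselL2.choose
  map_add' u v := by
    apply ViscousWave.toDist_injective
    refine (u + v).exists_besselL2.choose_spec.symm.trans ?_
    refine Eq.trans ?_ (map_add (Lp.toTemperedDistributionCLM ℂ volume 2) _ _).symm
    rw [map_add, map_add]
    exact congrArg₂ _ u.exists_besselL2.choose_spec v.exists_besselL2.choose_spec
  map_smul' c u := by
    apply ViscousWave.toDist_injective
    refine (c • u).exists_besselL2.choose_spec.symm.trans ?_
    refine Eq.trans ?_ ((Lp.toTemperedDistributionCLM ℂ volume 2).map_smul_of_tower c _).symm
    rw [map_smul, ContinuousLinearMap.map_smul_of_tower]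
    exact congrArg _ u.exists_besselL2.choose_spec

theorem SobolevSpace.besselL2_spec {n : ℕ} {σ : ℝ} (u : SobolevSpace n σ) :
    bessel n σ (SobolevSpace.toDist n σ u) = (SobolevSpace.besselL2 n σ u : 𝓢'(E n, ℂ)) :=
  u.exists_besselL2.choose_spec

theorem SobolevSpace.besselL2_injective (n : ℕ) (σ : ℝ) :
    Function.Injective (SobolevSpace.besselL2 n σ) := by
  intro u v h
  apply SobolevSpace.toDist_injective
  have h1 : bessel n σ (SobolevSpace.toDist n σ u) = bessel n σ (SobolevSpace.toDist n σ v) := by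
    rw [u.besselL2_spec, v.besselL2_spec, h]
  have h2 := congrArg (bessel n (-σ)) h1
  simpa [bessel_bessel, bessel_zero] using h2

instance (n : ℕ) (σ : ℝ) : NormedAddCommGroup (SobolevSpace n σ) :=
  NormedAddCommGroup.induced _ _ (SobolevSpace.besselL2 n σ)
    (SobolevSpace.besselL2_injective n σ)

theorem SobolevSpace.norm_eq {n : ℕ} {σ : ℝ} (u : SobolevSpace n σ) :
    ‖u‖ = ‖SobolevSpace.besselL2 n σ u‖ := rfl

instance (n : ℕ) (σ : ℝ) : InnerProductSpace ℝ (SobolevSpace n σ) where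
  norm_smul_le c u := by
    rw [SobolevSpace.norm_eq, SobolevSpace.norm_eq, map_smul]; exact norm_smul_le _ _
  inner u v := inner ℝ (SobolevSpace.besselL2 n σ u) (SobolevSpace.besselL2 n σ v)
  norm_sq_eq_re_inner u := by
    rw [SobolevSpace.norm_eq]; exact norm_sq_eq_re_inner (𝕜 := ℝ) _
  conj_inner_symm u v := inner_conj_symm _ _
  add_left u v w := by rw [map_add, inner_add_left]
  smul_left u v c := by rw [map_smul, inner_smul_left]

/-- `⟨D⟩^σ` as a linear isometry from `H^σ(ℝⁿ)` to `L²(ℝⁿ)`. -/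
def SobolevSpace.besselIso (n : ℕ) (σ : ℝ) :
    SobolevSpace n σ →ₗᵢ[ℝ] Lp ℂ 2 (volume : Measure (E n)) :=
  ⟨SobolevSpace.besselL2 n σ, fun _ ↦ rfl⟩

theorem SobolevSpace.isClosed_range (n : ℕ) (σ : ℝ) :
    IsClosed (Set.range (SobolevSpace.besselIso n σ)) := by
  have h : Set.range (SobolevSpace.besselIso n σ) =
      ⋂ φ : {φ : 𝓢(E n, ℂ) // ∀ x, (φ x).im = 0},
        {f : Lp ℂ 2 (volume : Measure (E n)) |
          (bessel n (-σ) (Lp.toTemperedDistributionCLM ℂ volume 2 f) φ.1).im = 0} := by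
    ext f
    simp only [Set.mem_range, Set.mem_iInter, Set.mem_ofPred_eq]
    constructor
    · rintro ⟨u, rfl⟩ φ
      have : bessel n (-σ) (Lp.toTemperedDistributionCLM ℂ volume 2
          (SobolevSpace.besselIso n σ u)) = SobolevSpace.toDist n σ u := by
        have h2 := congrArg (bessel n (-σ)) u.besselL2_spec
        rw [bessel_bessel, add_neg_cancel, bessel_zero] at h2
        exact h2.symm
      rw [this]
      exact u.2.1 φ.1 φ.2
    · intro hf
      have hb : bessel n σ (bessel n (-σ) (f : 𝓢'(E n, ℂ))) = f := by
        rw [bessel_bessel, neg_add_cancel, bessel_zero]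
      let u : SobolevSpace n σ := ⟨bessel n (-σ) f, fun φ hφ ↦ hf ⟨φ, hφ⟩, f, hb⟩
      refine ⟨u, ViscousWave.toDist_injective n _ _ ?_⟩
      exact u.besselL2_spec.symm.trans hb
  rw [h]
  refine isClosed_iInter fun φ ↦ isClosed_eq ?_ continuous_const
  have h3 : Continuous fun v : 𝓢'(E n, ℂ) ↦ v φ.1 :=
    (PointwiseConvergenceCLM.evalCLM (RingHom.id ℂ) ℂ φ.1).continuous
  exact Complex.continuous_im.comp (h3.comp ((bessel n (-σ)).continuous.comp
    (Lp.toTemperedDistributionCLM ℂ volume 2).continuous))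

instance (n : ℕ) (σ : ℝ) : CompleteSpace (SobolevSpace n σ) := by
  have h := (SobolevSpace.isClosed_range n σ).isComplete
  rw [← Set.image_univ, (SobolevSpace.besselIso n σ).isometry.isUniformInducing.isComplete_iff] at h
  exact completeSpace_iff_isComplete_univ.mpr h

theorem besselSymbol_memLp_top (n : ℕ) {s : ℝ} (hs : 0 ≤ s) :
    MemLp (fun ξ : E n ↦ (besselSymbol n (-s) ξ : ℂ)) ∞ volume := by
  refine memLp_top_of_bound (besselSymbol_temperate n (-s)).1.continuous.aestronglyMeasurable 1
    (Eventually.of_forall fun ξ ↦ ?_)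
  rw [Complex.norm_real, Real.norm_of_nonneg (besselSymbol_pos n _ ξ).le]
  refine Real.rpow_le_one_of_one_le_of_nonpos ?_ (by linarith)
  have := sq_nonneg (2 * π * ‖ξ‖); linarith

/-- The embedding of `H^s(ℝⁿ)` into `L²(ℝⁿ)` for `s ≥ 0`; see `toL2_spec`. -/
def SobolevSpace.toL2 (n : ℕ) {s : ℝ} (hs : 0 ≤ s) :
    SobolevSpace n s →L[ℝ] Lp ℂ 2 (volume : Measure (E n)) :=
  ((fourierInvCLM ℂ (Lp ℂ 2 (volume : Measure (E n))) ∘L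
    (ContinuousLinearMap.lsmul ℂ ℂ).holderL volume ∞ 2 2 (besselSymbol_memLp_top n hs).toLp ∘L
    fourierCLM ℂ (Lp ℂ 2 (volume : Measure (E n)))).restrictScalars ℝ) ∘L
  (SobolevSpace.besselIso n s).toContinuousLinearMap

theorem SobolevSpace.fourier_toL2 {n : ℕ} {s : ℝ} (hs : 0 ≤ s) (u : SobolevSpace n s) :
    𝓕 (SobolevSpace.toL2 n hs u) =
      ((besselSymbol_memLp_top n hs).toLp • 𝓕 (SobolevSpace.besselL2 n s u) :
        Lp ℂ 2 (volume : Measure (E n))) :=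
  fourier_fourierInv_eq _

/-- The function `toL2 u` represents the tempered distribution `u`. -/
theorem SobolevSpace.toL2_spec {n : ℕ} {s : ℝ} (hs : 0 ≤ s) (u : SobolevSpace n s) :
    (SobolevSpace.toL2 n hs u : 𝓢'(E n, ℂ)) = SobolevSpace.toDist n s u := by
  have h1 : SobolevSpace.toDist n s u = bessel n (-s) (SobolevSpace.besselL2 n s u) := by
    rw [← u.besselL2_spec, bessel_bessel, add_neg_cancel, bessel_zero]
  rw [h1, bessel, fourierMultiplierCLM_apply, Lp.fourier_toTemperedDistribution_eq,
    ← Lp.toTemperedDistribution_smul_eq (r := 2) (besselSymbol_temperate n (-s))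
      (besselSymbol_memLp_top n hs), Lp.fourierInv_toTemperedDistribution_eq]
  rfl

theorem SobolevSpace.memLp_halfLap {n : ℕ} {s : ℝ} (hs : 0 ≤ s) (u : SobolevSpace n s) :
    MemLp (fun ξ : E n ↦ (((2 * π * ‖ξ‖) ^ s : ℝ) : ℂ) * 𝓕 (SobolevSpace.toL2 n hs u) ξ) 2
      volume := by
  refine (Lp.memLp (𝓕 (SobolevSpace.besselL2 n s u))).of_le ?_ ?_
  · refine AEStronglyMeasurable.mul ?_ (Lp.aestronglyMeasurable _)
    have : Continuous fun ξ : E n ↦ (2 * π * ‖ξ‖) ^ s :=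
      (continuous_const.mul continuous_norm).rpow_const fun _ ↦ Or.inr hs
    exact (Complex.continuous_ofReal.comp this).aestronglyMeasurable
  · rw [SobolevSpace.fourier_toL2 hs u]
    filter_upwards [Lp.coeFn_lpSMul (r := 2) (besselSymbol_memLp_top n hs).toLp
      (𝓕 (SobolevSpace.besselL2 n s u)), (besselSymbol_memLp_top n hs).coeFn_toLp] with ξ h1 h2
    rw [h1, Pi.smul_apply', h2, smul_eq_mul, ← mul_assoc, norm_mul, ← Complex.ofReal_mul,
      Complex.norm_real]
    refine mul_le_of_le_one_left (norm_nonneg _) ?_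
    have hx : 0 ≤ 2 * π * ‖ξ‖ := by positivity
    rw [Real.norm_of_nonneg (mul_nonneg (by positivity) (besselSymbol_pos n _ ξ).le), besselSymbol,
      neg_div, Real.rpow_neg (by positivity), ← div_eq_mul_inv, div_le_one (by positivity)]
    calc (2 * π * ‖ξ‖) ^ s = ((2 * π * ‖ξ‖) ^ 2) ^ (s / 2) := by
          rw [← Real.rpow_natCast, ← Real.rpow_mul hx]; congr 1; push_cast; ring
      _ ≤ _ := Real.rpow_le_rpow (by positivity) (by linarith) (by positivity)

/-- The fractional Laplacian `(-Δ)^(s/2) u ∈ L²(ℝⁿ)` of `u ∈ H^s(ℝⁿ)`: the Fourier multiplier with symbol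
`|ξ|^s`, which is `(2π|ξ|)^s` in the convention of Mathlib. -/
def SobolevSpace.halfLap {n : ℕ} {s : ℝ} (hs : 0 ≤ s) (u : SobolevSpace n s) :
    Lp ℂ 2 (volume : Measure (E n)) :=
  𝓕⁻ (SobolevSpace.memLp_halfLap hs u).toLp

/-- The real valued function `u|_Ω ∈ L²(Ω)` for `u ∈ H^s(ℝⁿ)`, `s ≥ 0`. -/
def SobolevSpace.restrictL2 {n : ℕ} {s : ℝ} (hs : 0 ≤ s) (Ω : Set (E n)) :
    SobolevSpace n s →L[ℝ] Lp ℝ 2 (volume.restrict Ω) :=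
  LpToLpRestrictCLM (E n) ℝ ℝ volume 2 Ω ∘L
    (Complex.reCLM.compLpL 2 volume ∘L SobolevSpace.toL2 n hs)

/-- The space `C_c^∞(Ω)` of real valued test functions on `Ω`, as a set of Schwartz functions. -/
def testFunctions {n : ℕ} (Ω : Set (E n)) : Set 𝓢(E n, ℂ) :=
  {φ | (∀ x, (φ x).im = 0) ∧ HasCompactSupport φ ∧ tsupport φ ⊆ Ω}

/-- The space `H̃^s(Ω)`: the closure of `C_c^∞(Ω)` in `H^s(ℝⁿ)`, with the norm of `H^s(ℝⁿ)`. -/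
def tildeSobolev {n : ℕ} (s : ℝ) (Ω : Set (E n)) : Submodule ℝ (SobolevSpace n s) :=
  (Submodule.span ℝ {u : SobolevSpace n s | ∃ φ ∈ testFunctions Ω,
    SobolevSpace.toDist n s u = (φ : 𝓢'(E n, ℂ))}).topologicalClosure

instance {n : ℕ} (s : ℝ) (Ω : Set (E n)) : CompleteSpace (tildeSobolev s Ω) :=
  Submodule.topologicalClosure.completeSpace _

/-- The elements of `H^σ(ℝⁿ)` whose restriction to `Ω`, as a distribution on `Ω`, is zero. -/
def vanishingOn {n : ℕ} (σ : ℝ) (Ω : Set (E n)) : Submodule ℝ (SobolevSpace n σ) where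
  carrier := {u | ∀ φ ∈ testFunctions Ω, SobolevSpace.toDist n σ u φ = 0}
  add_mem' hu hv φ hφ := by simp [hu φ hφ, hv φ hφ]
  zero_mem' φ _ := by simp
  smul_mem' c u hu φ hφ := by simp [hu φ hφ]

theorem SobolevSpace.toDist_continuous (n : ℕ) (σ : ℝ) :
    Continuous (SobolevSpace.toDist n σ) := by
  have h : (SobolevSpace.toDist n σ : SobolevSpace n σ → 𝓢'(E n, ℂ)) = fun u ↦
      bessel n (-σ) (Lp.toTemperedDistributionCLM ℂ volume 2 (SobolevSpace.besselIso n σ u)) := by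
    ext1 u
    have h2 := congrArg (bessel n (-σ)) u.besselL2_spec
    rw [bessel_bessel, add_neg_cancel, bessel_zero] at h2
    exact h2
  rw [h]
  exact (bessel n (-σ)).continuous.comp ((Lp.toTemperedDistributionCLM ℂ volume 2).continuous.comp
    (SobolevSpace.besselIso n σ).continuous)

instance {n : ℕ} (σ : ℝ) (Ω : Set (E n)) : IsClosed (vanishingOn σ Ω : Set (SobolevSpace n σ)) := by
  have h : (vanishingOn σ Ω : Set (SobolevSpace n σ)) =
      ⋂ φ ∈ testFunctions Ω, {u | SobolevSpace.toDist n σ u φ = 0} := by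
    ext u; simp [vanishingOn]
  rw [h]
  refine isClosed_biInter fun φ _ ↦ isClosed_eq ?_ continuous_const
  exact (PointwiseConvergenceCLM.evalCLM (RingHom.id ℂ) ℂ φ).continuous.comp
    (SobolevSpace.toDist_continuous n σ)

/-- The space `H^σ(Ω)` of restrictions to `Ω` of the elements of `H^σ(ℝⁿ)`. Two elements have the same
restriction exactly if their difference vanishes on `Ω`, so this is a quotient; its norm is the quotient
norm, the infimum of the norms of all extensions. -/
abbrev SobolevOn {n : ℕ} (σ : ℝ) (Ω : Set (E n)) : Type := SobolevSpace n σ ⧸ vanishingOn σ Ω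

/-- The pairing of `H^{-s}(ℝⁿ)` with `H^s(ℝⁿ)`, which is the real number `∫ (⟨D⟩^{-s} F) (⟨D⟩^s v) dx`.
By `sobolevPairing_test` it extends the evaluation of `F` at test functions. -/
def sobolevPairing (n : ℕ) (s : ℝ) (v : SobolevSpace n s) : SobolevSpace n (-s) →L[ℝ] ℝ :=
  Complex.reCLM ∘L (((ContinuousLinearMap.mul ℂ ℂ).lpPairing volume 2 2).flip
    (SobolevSpace.besselL2 n s v)).restrictScalars ℝ ∘L
    (SobolevSpace.besselIso n (-s)).toContinuousLinearMap

theorem sobolevPairing_apply {n : ℕ} {s : ℝ} (v : SobolevSpace n s) (F : SobolevSpace n (-s)) :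
    sobolevPairing n s v F =
      (∫ x, SobolevSpace.besselL2 n (-s) F x * SobolevSpace.besselL2 n s v x).re :=
  congrArg Complex.re ((ContinuousLinearMap.mul ℂ ℂ).lpPairing_eq_integral
    (SobolevSpace.besselL2 n (-s) F) (SobolevSpace.besselL2 n s v))

theorem multiplier_even (n : ℕ) (s : ℝ) (φ : 𝓢(E n, ℂ)) :
    𝓕 (SchwartzMap.smulLeftCLM ℂ (fun ξ : E n ↦ (besselSymbol n s ξ : ℂ)) (𝓕⁻ φ)) =
      𝓕⁻ (SchwartzMap.smulLeftCLM ℂ (fun ξ : E n ↦ (besselSymbol n s ξ : ℂ)) (𝓕 φ)) := by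
  ext x
  rw [SchwartzMap.fourier_coe, SchwartzMap.fourierInv_coe, Real.fourierInv_eq_fourier_comp_neg]
  refine congrFun (congrArg 𝓕 (funext fun ξ ↦ ?_)) x
  simp only [SchwartzMap.smulLeftCLM_apply_apply (besselSymbol_temperate n s)]
  rw [SchwartzMap.fourier_coe, SchwartzMap.fourierInv_coe, Real.fourierInv_eq_fourier_neg]
  simp [besselSymbol]

theorem sobolevPairing_test {n : ℕ} {s : ℝ} (v : SobolevSpace n s) (F : SobolevSpace n (-s))
    (φ : 𝓢(E n, ℂ)) (h : SobolevSpace.toDist n s v = (φ : 𝓢'(E n, ℂ))) :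
    sobolevPairing n s v F = (SobolevSpace.toDist n (-s) F φ).re := by
  have hg : SobolevSpace.besselL2 n s v = (SchwartzMap.fourierMultiplierCLM ℂ
      (fun ξ : E n ↦ (besselSymbol n s ξ : ℂ)) φ).toLp 2 := by
    apply toDist_injective
    rw [← v.besselL2_spec, h, bessel, Lp.toTemperedDistribution_toLp_eq,
      fourierMultiplierCLM_toTemperedDistributionCLM_eq (besselSymbol_temperate n s)]
  have hF : SobolevSpace.toDist n (-s) F = bessel n s (SobolevSpace.besselL2 n (-s) F) := by
    rw [← F.besselL2_spec, bessel_bessel, neg_add_cancel, bessel_zero]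
  rw [sobolevPairing_apply, hF, bessel, fourierMultiplierCLM_apply_apply, multiplier_even,
    Lp.toTemperedDistribution_apply, hg]
  congr 1
  apply integral_congr_ae
  filter_upwards [(SchwartzMap.fourierMultiplierCLM ℂ
      (fun ξ : E n ↦ (besselSymbol n s ξ : ℂ)) φ).coeFn_toLp 2 volume] with x hx
  rw [hx, smul_eq_mul, mul_comm, SchwartzMap.fourierMultiplierCLM_apply]

theorem sobolevPairing_eq_zero {n : ℕ} {s : ℝ} {Ω : Set (E n)} (v : tildeSobolev s Ω) :
    vanishingOn (-s) Ω ≤ LinearMap.ker (sobolevPairing n s v.1).toLinearMap := by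
  intro F hF
  have hc : Continuous fun v : SobolevSpace n s ↦ sobolevPairing n s v F :=
    Complex.continuous_re.comp ((((ContinuousLinearMap.mul ℂ ℂ).lpPairing volume 2 2)
      (SobolevSpace.besselL2 n (-s) F)).continuous.comp (SobolevSpace.besselIso n s).continuous)
  refine closure_minimal (s := ((Submodule.span ℝ {u : SobolevSpace n s | ∃ φ ∈ testFunctions Ω,
    SobolevSpace.toDist n s u = (φ : 𝓢'(E n, ℂ))} : Submodule ℝ (SobolevSpace n s)) :
      Set (SobolevSpace n s)))
    (t := {v | sobolevPairing n s v F = 0}) ?_ (isClosed_eq hc continuous_const) v.2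
  intro w hw
  induction hw using Submodule.span_induction with
  | mem w hw =>
    obtain ⟨φ, hφ, h⟩ := hw
    simp only [Set.mem_ofPred_eq]
    rw [sobolevPairing_test w F φ h, hF φ hφ, Complex.zero_re]
  | zero => simp [sobolevPairing]
  | add x y _ _ hx hy =>
    simp only [Set.mem_ofPred_eq] at hx hy ⊢
    simp only [sobolevPairing, map_add] at hx hy ⊢
    simpa using by rw [← add_zero (0 : ℝ)]; exact congrArg₂ _ hx hy
  | smul c x _ hx =>
    simp only [Set.mem_ofPred_eq] at hx ⊢
    simp only [sobolevPairing, map_smul, ContinuousLinearMap.map_smul_of_tower] at hx ⊢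
    simpa using Or.inr hx

/-- The duality pairing `⟨h, v⟩` between `H^{-s}(Ω)` and `H̃^s(Ω)`: the pairing of any extension of `h`
with `v`. It is the evaluation of the distribution `h` if `v` is a test function (`duality_test`). -/
def duality {n : ℕ} {s : ℝ} {Ω : Set (E n)} (h : SobolevOn (-s) Ω) (v : tildeSobolev s Ω) : ℝ :=
  (vanishingOn (-s) Ω).liftQ (sobolevPairing n s v.1).toLinearMap (sobolevPairing_eq_zero v) h

theorem duality_test {n : ℕ} {s : ℝ} {Ω : Set (E n)} (F : SobolevSpace n (-s))
    (v : tildeSobolev s Ω) (φ : 𝓢(E n, ℂ))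
    (h : SobolevSpace.toDist n s v.1 = (φ : 𝓢'(E n, ℂ))) :
    duality (Submodule.Quotient.mk F : SobolevOn (-s) Ω) v =
      (SobolevSpace.toDist n (-s) F φ).re :=
  sobolevPairing_test v.1 F φ h

/-- `Ω` is a bounded Lipschitz domain: open, connected, nonempty and bounded, and near each boundary point
it is the set above the graph of a Lipschitz function over a hyperplane. The hyperplane is the
orthogonal complement of the unit vector `ν`, and `y - ⟪ν, y⟫ ν` is the projection of `y` to it. -/
structure IsBoundedLipschitzDomain {n : ℕ} (Ω : Set (E n)) : Prop where
  isOpen : IsOpen Ω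
  isConnected : IsConnected Ω
  isBounded : Bornology.IsBounded Ω
  lipschitz_boundary : ∀ x ∈ frontier Ω, ∃ r > 0, ∃ ν : E n, ‖ν‖ = 1 ∧
    ∃ (K : ℝ≥0) (γ : E n → ℝ), LipschitzWith K γ ∧
      ∀ y ∈ Metric.ball x r, y ∈ Ω ↔ γ (y - inner ℝ ν y • ν) < inner ℝ ν y

/-- The admissible integrability exponents of the potential. -/
structure AdmissibleExponent (n : ℕ) (s : ℝ) (p : ℝ≥0∞) : Prop where
  subcritical : 2 * s < n → ENNReal.ofReal (n / s) ≤ p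
  critical : 2 * s = n → 2 < p
  supercritical : (n : ℝ) < 2 * s → 2 ≤ p

/-- Lebesgue measure on the time interval `(0, T)`. -/
abbrev timeMeasure (T : ℝ) : Measure ℝ := volume.restrict (Ioo 0 T)

/-- `q ∈ L^∞(0,T;L^p(Ω))`. -/
def MemLinftyLp {n : ℕ} (T : ℝ) (Ω : Set (E n)) (p : ℝ≥0∞) (q : E n → ℝ → ℝ) : Prop :=
  ∃ M : ℝ≥0, ∀ᵐ t ∂timeMeasure T, MemLp (fun x ↦ q x t) p (volume.restrict Ω) ∧
    eLpNorm (fun x ↦ q x t) p (volume.restrict Ω) ≤ M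

/-- For each test function `φ ∈ C_c^∞(Ω)`, the function `t ↦ ∫_Ω q(x,t) φ(x) dx` belongs to `C([0,T])`.
As `q` is only determined up to null sets, this means that it agrees almost everywhere on `(0,T)` with
a continuous function on `[0,T]`. -/
def WeaklyContinuousInTime {n : ℕ} (T : ℝ) (Ω : Set (E n)) (q : E n → ℝ → ℝ) : Prop :=
  ∀ φ : E n → ℝ, ContDiff ℝ ∞ φ → HasCompactSupport φ → tsupport φ ⊆ Ω →
    ∃ g : ℝ → ℝ, ContinuousOn g (Icc 0 T) ∧
      ∀ᵐ t ∂timeMeasure T, ∫ x in Ω, q x t * φ x = g t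

/-- `η ∈ C_c^∞((0,T))`. -/
def IsTimeTestFunction (T : ℝ) (η : ℝ → ℝ) : Prop :=
  ContDiff ℝ ∞ η ∧ HasCompactSupport η ∧ tsupport η ⊆ Ioo 0 T

/-- `w` is the derivative of `u` in the sense of `X`-valued distributions on `(0,T)`. -/
def IsWeakTimeDeriv {X : Type*} [NormedAddCommGroup X] [NormedSpace ℝ X] (T : ℝ)
    (u w : ℝ → X) : Prop :=
  ∀ η : ℝ → ℝ, IsTimeTestFunction T η →
    ∫ t in Ioo 0 T, deriv η t • u t = -∫ t in Ioo 0 T, η t • w t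

/-- `U` is continuous on `[0,T]` and represents `u` there. For `T > 0` it is unique on `[0,T]`. -/
def IsContinuousRep {X : Type*} [NormedAddCommGroup X] (T : ℝ) (u U : ℝ → X) : Prop :=
  ContinuousOn U (Icc 0 T) ∧ u =ᵐ[timeMeasure T] U

section Equation

variable {n : ℕ} {s : ℝ} {Ω : Set (E n)} {T : ℝ}

/-- The inclusion of `V = H̃^s(Ω)` into `H = L²(Ω)`. -/
def incl (hs : 0 ≤ s) (Ω : Set (E n)) : tildeSobolev s Ω →L[ℝ] Lp ℝ 2 (volume.restrict Ω) :=
  SobolevSpace.restrictL2 hs Ω ∘L (tildeSobolev s Ω).subtypeL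

/-- The inclusion of `V` into its dual through `V ⊆ H = H* ⊆ V*`. -/
def inclDual (hs : 0 ≤ s) (v : tildeSobolev s Ω) : StrongDual ℝ (tildeSobolev s Ω) :=
  innerSL ℝ (incl hs Ω v) ∘L incl hs Ω

/-- `v ∈ W(0,T;V)`, that is, `v ∈ L²(0,T;V)` has a distributional time derivative in `L²(0,T;V*)`. -/
def MemW (hs : 0 ≤ s) (v : Lp (tildeSobolev s Ω) 2 (timeMeasure T)) : Prop :=
  ∃ w : Lp (StrongDual ℝ (tildeSobolev s Ω)) 2 (timeMeasure T),
    IsWeakTimeDeriv T (fun t ↦ inclDual hs (v t)) w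

/-- The form `∫_Ω q(x,t) u(x) v(x) dx`. -/
def potentialForm (hs : 0 ≤ s) (q : E n → ℝ → ℝ) (t : ℝ) (u v : tildeSobolev s Ω) : ℝ :=
  ∫ x in Ω, q x t * incl hs Ω u x * incl hs Ω v x

/-- The form `⟨(-Δ)^(s/2) u, (-Δ)^(s/2) v⟩` of `L²(ℝⁿ)`. -/
def energyForm (hs : 0 ≤ s) (u v : tildeSobolev s Ω) : ℝ :=
  inner ℝ (SobolevSpace.halfLap hs u.1) (SobolevSpace.halfLap hs v.1)

/-- `u ∈ W̃(0,T;H̃^s(Ω))`, with time derivative `u'`, is a solution of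
`(∂ₜ² + (-Δ)^s ∂ₜ + (-Δ)^s + q) u = h` in `Ω × (0,T)`, `u = 0` in the exterior, `u(0) = u₀`,
`∂ₜu(0) = u₁`. The first two fields say that `u ∈ W̃(0,T;V)`: both `u` and its derivative are in
`L²(0,T;V)`, and the latter belongs to `W(0,T;V)`. The equation holds when tested with any `v ∈ V`, in
the sense of distributions on `(0,T)`. The initial values are those of the continuous
representatives of `u` in `V` and of its derivative in `L²(Ω)`. -/
structure IsSolution (hs : 0 ≤ s) (q : E n → ℝ → ℝ)
    (u₀ : tildeSobolev s Ω) (u₁ : Lp ℝ 2 (volume.restrict Ω))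
    (h : Lp (SobolevOn (-s) Ω) 2 (timeMeasure T))
    (u u' : Lp (tildeSobolev s Ω) 2 (timeMeasure T)) : Prop where
  deriv_eq : IsWeakTimeDeriv T u u'
  deriv_mem : MemW hs u'
  equation : ∀ v : tildeSobolev s Ω, ∀ η : ℝ → ℝ, IsTimeTestFunction T η →
    -(∫ t in Ioo 0 T, deriv η t * inner ℝ (incl hs Ω (u' t)) (incl hs Ω v)) +
      ∫ t in Ioo 0 T, η t * (energyForm hs (u' t) v + energyForm hs (u t) v +
        potentialForm hs q t (u t) v) =
    ∫ t in Ioo 0 T, η t * duality (h t) v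
  exterior : ∀ᵐ t ∂timeMeasure T, ∀ᵐ x ∂volume.restrict (closure Ω)ᶜ,
    SobolevSpace.toL2 n hs (u t).1 x = 0
  initial : ∃ U, IsContinuousRep T u U ∧ U 0 = u₀
  initial_deriv : ∃ U₁, IsContinuousRep T (fun t ↦ incl hs Ω (u' t)) U₁ ∧ U₁ 0 = u₁

/-- The energy identity of the solution at all times `t ∈ [0,T]`, stated for the continuous representatives
`U` of `u` in `V` and `U₁` of the time derivative in `L²(Ω)`, together with the integrability of the
terms that are integrated in it. -/
structure EnergyIdentity (hs : 0 ≤ s) (q : E n → ℝ → ℝ)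
    (u₀ : tildeSobolev s Ω) (u₁ : Lp ℝ 2 (volume.restrict Ω))
    (h : Lp (SobolevOn (-s) Ω) 2 (timeMeasure T))
    (u u' : Lp (tildeSobolev s Ω) 2 (timeMeasure T)) : Prop where
  integrable_damping : IntegrableOn (fun τ ↦ ‖SobolevSpace.halfLap hs (u' τ).1‖ ^ 2) (Ioo 0 T)
  integrable_source : IntegrableOn (fun τ ↦ duality (h τ) (u' τ)) (Ioo 0 T)
  integrable_potential_space : ∀ᵐ τ ∂timeMeasure T,
    IntegrableOn (fun x ↦ q x τ * incl hs Ω (u τ) x * incl hs Ω (u' τ) x) Ω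
  integrable_potential : IntegrableOn (fun τ ↦ potentialForm hs q τ (u τ) (u' τ)) (Ioo 0 T)
  identity : ∀ U U₁, IsContinuousRep T u U → IsContinuousRep T (fun t ↦ incl hs Ω (u' t)) U₁ →
    ∀ t ∈ Icc 0 T,
      ‖U₁ t‖ ^ 2 + ‖SobolevSpace.halfLap hs (U t).1‖ ^ 2 +
          2 * ∫ τ in Ioo 0 t, ‖SobolevSpace.halfLap hs (u' τ).1‖ ^ 2 =
        ‖u₁‖ ^ 2 + ‖SobolevSpace.halfLap hs u₀.1‖ ^ 2 +
          2 * (∫ τ in Ioo 0 t, duality (h τ) (u' τ)) -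
          2 * ∫ τ in Ioo 0 t, potentialForm hs q τ (u τ) (u' τ)

end Equation

end
end ViscousWave

open ViscousWave

namespace ViscousWave

/-! ### Weak time derivatives and primitives of Hilbert space valued functions -/

section WeakDeriv

variable {X : Type*} [NormedAddCommGroup X] [InnerProductSpace ℝ X]

/-! Write V = H̃^s(Ω), H = L²(Ω), ι : V → H for `incl` and κ = (-Δ)^(s/2) for `halfLapCLM`. By the
Riesz theorem everything with values in V* is represented in V: the embedding V ⊆ H ⊆ V* becomes ι†ι
(`gram ι`), (-Δ)^s becomes κ†κ, the source h becomes a vector f through `dualityCLM`, and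
multiplication by q becomes an operator `QX` on L²(0,T;V). With w = ∂ₜu the equation reads ∂ₜ(ι†ι w)
= f - κ†κ w - κ†κ u - QX u in L²(0,T;V) (`isWeakTimeDeriv_weakForce_iff`), so the evolution problem
can be solved for abstract Hilbert spaces V, H and operators ι, κ.

Besides the density of ι(V) in H, two facts about the concrete setting carry the analysis. One is
the coercivity ‖v‖² ≤ 2^s (‖κ v‖² + ‖ι v‖²), a pointwise inequality of symbols combined with
Plancherel; the lower order term ‖ι v‖² is harmless in an evolution problem, so no Poincaré
inequality is needed. The other is |∫ q u v| ≤ M ‖u‖_V ‖v‖_H at almost every time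
(`exists_potentialOperator`): Hölder's inequality puts q u in L² once u ∈ L^r with 1/p₀ + 1/r = 1/2
and p₀ ≤ p, and the Sobolev embedding provides this r. The subcritical embedding is proved by
cutting the frequencies at a radius that depends on the level: the low part is bounded pointwise by
half of the level, the high part is estimated by Chebyshev and Plancherel, and integration over all
levels gives the L^r norm (`exists_sobolev_constant`).

Existence is a Lions type projection argument instead of a Galerkin scheme
(`exists_variational_solution`). The equation for w is tested with ψ(t) = ∫ₜᵀ g, and all operators
are moved to ψ, which gives a vector N g. Pairing N g with exp(λt) ψ for large λ yields ‖ψ‖ + ‖ι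
ψ(0)‖ ≤ C ‖N g‖ (`weighted_energy_le`). The data are therefore a bounded functional of N g, and the
vector that represents this functional is w.

Continuity in time is of Lions–Magenes type (`exists_continuousRep_of_isWeakTimeDeriv`): if v and
∂ₜ(ι†ι v) are in L²(0,T;V), then ι v is continuous into H and ‖ι v‖² obeys the expected balance. The
balance comes from difference quotients and Lebesgue points, with no mollification. Applied to w
with ι and to u with κ, it gives the two halves of the energy identity. Young's inequality and
Gronwall's lemma turn the identity into an a priori bound (`exists_stability_constant`), and by
linearity this bound is both the Lipschitz estimate and uniqueness. -/

theorem intervalIntegrable_of_integrableOn_Ioo {Y : Type*} [NormedAddCommGroup Y] {f : ℝ → Y}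
    {T a b : ℝ} (hf : IntegrableOn f (Ioo 0 T)) (ha : a ∈ Icc 0 T) (hb : b ∈ Icc 0 T) :
    IntervalIntegrable f volume a b := by
  rw [intervalIntegrable_iff]
  rw [← integrableOn_Icc_iff_integrableOn_Ioo] at hf
  refine hf.mono_set (uIoc_subset_uIcc.trans ?_)
  exact (convex_Icc 0 T).ordConnected.uIcc_subset ha hb

theorem integral_Ioo_eq_interval {Y : Type*} [NormedAddCommGroup Y] [NormedSpace ℝ Y] {f : ℝ → Y}
    {t : ℝ} (ht : 0 ≤ t) : ∫ τ in Ioo 0 t, f τ = ∫ τ in (0)..t, f τ := by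
  rw [intervalIntegral.integral_of_le ht, integral_Ioc_eq_integral_Ioo]

theorem continuousOn_primitive_Icc {Y : Type*} [NormedAddCommGroup Y] [NormedSpace ℝ Y] {f : ℝ → Y}
    {T : ℝ} (hf : IntegrableOn f (Ioo 0 T)) :
    ContinuousOn (fun t ↦ ∫ τ in (0)..t, f τ) (Icc 0 T) := by
  rcases le_or_gt 0 T with hT | hT
  · have := intervalIntegral.continuousOn_primitive_interval (μ := volume) (f := f) (a := 0)
      (b := T) (by rw [uIcc_of_le hT]; rwa [integrableOn_Icc_iff_integrableOn_Ioo])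
    rwa [uIcc_of_le hT] at this
  · simp [Icc_eq_empty_of_lt hT]

/-- The primitive of an integrable function is absolutely continuous and has derivative w almost
everywhere by Lebesgue differentiation, so the integration by parts for absolutely continuous
functions applies. The vector valued version is reduced to this scalar one. -/
theorem integral_deriv_mul_primitive {T : ℝ} (hT : 0 < T) {η : ℝ → ℝ} (hη : ContDiff ℝ 1 η)
    {w : ℝ → ℝ} (hw : IntegrableOn w (Ioo 0 T)) :
    ∫ t in Ioo 0 T, deriv η t * ∫ τ in (0)..t, w τ =
      η T * (∫ τ in Ioo 0 T, w τ) - ∫ t in Ioo 0 T, η t * w t := by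
  have h0 : (0 : ℝ) ∈ Icc 0 T := ⟨le_rfl, hT.le⟩
  have hw' : IntervalIntegrable w volume 0 T :=
    intervalIntegrable_of_integrableOn_Ioo hw h0 ⟨hT.le, le_rfl⟩
  have hac := hw'.absolutelyContinuousOnInterval_intervalIntegral (c := 0) (by simp)
  have hae := (ContDiffOn.absolutelyContinuousOnInterval (a := 0) (b := T) hη.contDiffOn)
  have key := AbsolutelyContinuousOnInterval.integral_deriv_mul_eq_sub hae hac
  rw [integral_Ioo_eq_interval hT.le, integral_Ioo_eq_interval hT.le, integral_Ioo_eq_interval hT.le]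
  have h1 : IntervalIntegrable (fun t ↦ deriv η t * ∫ τ in (0)..t, w τ) volume 0 T := by
    apply ContinuousOn.intervalIntegrable
    rw [uIcc_of_le hT.le]
    exact (hη.continuous_deriv le_rfl).continuousOn.mul (continuousOn_primitive_Icc hw)
  have h2 : IntervalIntegrable (fun t ↦ η t * w t) volume 0 T :=
    hw'.continuousOn_mul hη.continuous.continuousOn
  have h3 : ∫ x in (0)..T, deriv η x * (∫ τ in (0)..x, w τ) +
      η x * deriv (fun t ↦ ∫ τ in (0)..t, w τ) x =
      ∫ x in (0)..T, (deriv η x * (∫ τ in (0)..x, w τ) + η x * w x) := by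
    apply intervalIntegral.integral_congr_ae
    filter_upwards [hw'.ae_hasDerivAt_integral] with x hx hxm
    rw [(hx (uIoc_subset_uIcc hxm) 0 (by simp)).deriv]
  rw [h3, intervalIntegral.integral_add h1 h2] at key
  simp only [intervalIntegral.integral_same, mul_zero, sub_zero] at key
  linarith

variable [CompleteSpace X]

/-- Integration by parts against the primitive of an integrable function. -/
theorem integral_deriv_smul_primitive {T : ℝ} (hT : 0 < T) {η : ℝ → ℝ} (hη : ContDiff ℝ 1 η)
    {w : ℝ → X} (hw : IntegrableOn w (Ioo 0 T)) (c : X) :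
    ∫ t in Ioo 0 T, deriv η t • (c + ∫ τ in (0)..t, w τ) =
      η T • (c + ∫ τ in Ioo 0 T, w τ) - η 0 • c - ∫ t in Ioo 0 T, η t • w t := by
  have hd : Continuous (deriv η) := hη.continuous_deriv le_rfl
  have hc : ∫ t in Ioo 0 T, deriv η t = η T - η 0 := by
    rw [integral_Ioo_eq_interval hT.le]
    exact intervalIntegral.integral_deriv_eq_sub (fun x _ ↦ hη.differentiable one_ne_zero x)
      (hd.intervalIntegrable 0 T)
  have hi1 : IntegrableOn (fun t ↦ deriv η t • c) (Ioo 0 T) :=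
    ((hd.smul continuous_const).integrableOn_Icc).mono_set Ioo_subset_Icc_self
  have hi2 : IntegrableOn (fun t ↦ deriv η t • ∫ τ in (0)..t, w τ) (Ioo 0 T) :=
    ((hd.continuousOn.smul (continuousOn_primitive_Icc hw)).integrableOn_Icc).mono_set
      Ioo_subset_Icc_self
  have hi3 : IntegrableOn (fun t ↦ η t • w t) (Ioo 0 T) := by
    have h0 := hw
    rw [← integrableOn_Icc_iff_integrableOn_Ioo] at h0 ⊢
    exact h0.continuousOn_smul hη.continuous.continuousOn isCompact_Icc
  simp_rw [smul_add]
  rw [integral_add hi1 hi2, integral_smul_const, hc]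
  -- Pairing with a fixed vector x turns the identity into the scalar one for the function ⟨x, w⟩.
  refine ext_inner_left ℝ fun x ↦ ?_
  simp only [inner_add_right, inner_sub_right, real_inner_smul_right]
  rw [← integral_inner hi2, ← integral_inner hi3, ← integral_inner hw]
  simp only [real_inner_smul_right]
  have h4 := integral_deriv_mul_primitive hT hη (w := fun t ↦ inner ℝ x (w t))
    (hw.const_inner x)
  have h5 : ∫ t in Ioo 0 T, deriv η t * inner ℝ x (∫ τ in (0)..t, w τ) =
      ∫ t in Ioo 0 T, deriv η t * ∫ τ in (0)..t, inner ℝ x (w τ) := by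
    refine setIntegral_congr_fun measurableSet_Ioo fun t ht ↦ ?_
    rw [intervalIntegral.integral_of_le ht.1.le, intervalIntegral.integral_of_le ht.1.le,
      integral_inner]
    exact (intervalIntegrable_iff_integrableOn_Ioc_of_le ht.1.le).mp
      (intervalIntegrable_of_integrableOn_Ioo hw ⟨le_rfl, hT.le⟩ ⟨ht.1.le, ht.2.le⟩)
  rw [h5, h4]
  ring

theorem IsTimeTestFunction.eq_zero {T : ℝ} {η : ℝ → ℝ} (h : IsTimeTestFunction T η) {t : ℝ}
    (ht : t ∉ Ioo 0 T) : η t = 0 :=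
  image_eq_zero_of_notMem_tsupport fun h' ↦ ht (h.2.2 h')

theorem isWeakTimeDeriv_of_ae_eq_primitive {T : ℝ} (hT : 0 < T) {f w : ℝ → X}
    (hw : IntegrableOn w (Ioo 0 T)) {c : X}
    (h : ∀ᵐ t ∂timeMeasure T, f t = c + ∫ τ in (0)..t, w τ) : IsWeakTimeDeriv T f w := by
  intro η hη
  have h1 : ∫ t in Ioo 0 T, deriv η t • f t =
      ∫ t in Ioo 0 T, deriv η t • (c + ∫ τ in (0)..t, w τ) := by
    refine integral_congr_ae ?_
    filter_upwards [h] with t ht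
    rw [ht]
  rw [h1, integral_deriv_smul_primitive hT (hη.1.of_le (mod_cast le_top)) hw,
    hη.eq_zero (t := T) (by simp), hη.eq_zero (t := 0) (by simp)]
  simp

/-- If ψ is supported in [a,b], its primitive from a vanishes to the left of a, and to the right of
b because the mean of ψ is zero. So the primitive has compact support too. -/
theorem exists_timeTestFunction_primitive {T : ℝ} {ψ : ℝ → ℝ} (hψ : IsTimeTestFunction T ψ)
    (h0 : ∫ t, ψ t = 0) : ∃ η, IsTimeTestFunction T η ∧ deriv η = ψ := by
  rcases le_or_gt T 0 with hT | hT
  · refine ⟨0, ⟨contDiff_const, HasCompactSupport.zero, by simp [tsupport]⟩, ?_⟩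
    ext t
    rw [hψ.eq_zero (by simp [hT])]; simp
  obtain ⟨a, b, ha, hb, hab, hsub⟩ : ∃ a b, 0 < a ∧ b < T ∧ a ≤ b ∧ tsupport ψ ⊆ Icc a b := by
    rcases (tsupport ψ).eq_empty_or_nonempty with he | hne
    · exact ⟨T / 2, T / 2, by linarith, by linarith, le_rfl, by simp [he]⟩
    · have hc : IsCompact (tsupport ψ) := hψ.2.1
      refine ⟨sInf (tsupport ψ), sSup (tsupport ψ), (hψ.2.2 (hc.sInf_mem hne)).1,
        (hψ.2.2 (hc.sSup_mem hne)).2, csInf_le_csSup hne hc.bddBelow hc.bddAbove , fun x hx ↦ ?_⟩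
      exact ⟨csInf_le hc.bddBelow hx, le_csSup hc.bddAbove hx⟩
  have hz : ∀ t, t ∉ Icc a b → ψ t = 0 := fun t ht ↦
    image_eq_zero_of_notMem_tsupport fun h' ↦ ht (hsub h')
  have hcont : Continuous ψ := hψ.1.continuous
  have hderiv : ∀ t, HasDerivAt (fun t ↦ ∫ τ in a..t, ψ τ) (ψ t) t := fun t ↦
    intervalIntegral.integral_hasDerivAt_right (hcont.intervalIntegrable _ _)
      (hcont.stronglyMeasurableAtFilter _ _) hcont.continuousAt
  have hd : deriv (fun t ↦ ∫ τ in a..t, ψ τ) = ψ := funext fun t ↦ (hderiv t).deriv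
  have hsupp : ∀ t, t ∉ Icc a b → ∫ τ in a..t, ψ τ = 0 := by
    intro t ht
    rcases lt_or_ge t a with hta | hta
    · rw [intervalIntegral.integral_symm, intervalIntegral.integral_of_le hta.le, neg_eq_zero,
        integral_Ioc_eq_integral_Ioo]
      exact setIntegral_eq_zero_of_forall_eq_zero fun x hx ↦ hz x fun h ↦ (h.1.trans_lt hx.2).false
    · have htb : b < t := by
        by_contra hcon
        exact ht ⟨hta, not_lt.mp hcon⟩
      rw [intervalIntegral.integral_of_le hta, ← integral_Icc_eq_integral_Ioc, ← h0]
      refine setIntegral_eq_integral_of_forall_compl_eq_zero fun x hx ↦ hz x fun h ↦ hx ?_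
      exact ⟨h.1, h.2.trans htb.le⟩
  have hts : tsupport (fun t ↦ ∫ τ in a..t, ψ τ) ⊆ Icc a b :=
    closure_minimal (fun t ht ↦ by_contra fun h ↦ ht (hsupp t h)) isClosed_Icc
  refine ⟨fun t ↦ ∫ τ in a..t, ψ τ, ⟨?_, ?_, ?_⟩, hd⟩
  · rw [contDiff_infty_iff_deriv]
    exact ⟨fun t ↦ (hderiv t).differentiableAt, by rw [hd]; exact hψ.1⟩
  · exact isCompact_Icc.of_isClosed_subset (isClosed_tsupport _) hts
  · exact hts.trans (Icc_subset_Ioo ha hb)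

theorem exists_timeTestFunction_integral_one {T : ℝ} (hT : 0 < T) :
    ∃ ρ, IsTimeTestFunction T ρ ∧ ∫ t, ρ t = 1 := by
  let b : ContDiffBump (T / 2) := ⟨T / 8, T / 4, by linarith, by linarith⟩
  refine ⟨b.normed volume, ⟨b.contDiff_normed, b.hasCompactSupport_normed, ?_⟩,
    b.integral_normed⟩
  rw [b.tsupport_normed_eq, Real.closedBall_eq_Icc]
  exact Icc_subset_Ioo (by simp only [b]; linarith) (by simp only [b]; linarith)

theorem IsTimeTestFunction.sub_smul {T : ℝ} {ψ ρ : ℝ → ℝ} (hψ : IsTimeTestFunction T ψ)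
    (hρ : IsTimeTestFunction T ρ) (a : ℝ) : IsTimeTestFunction T (fun t ↦ ψ t - a * ρ t) := by
  have hsub : tsupport (fun t ↦ ψ t - a * ρ t) ⊆ tsupport ψ ∪ tsupport ρ := by
    refine closure_minimal (fun t ht ↦ ?_) ((isClosed_tsupport _).union (isClosed_tsupport _))
    by_contra h
    simp only [mem_union, not_or] at h
    simp [image_eq_zero_of_notMem_tsupport h.1, image_eq_zero_of_notMem_tsupport h.2] at ht
  exact ⟨hψ.1.sub (contDiff_const.mul hρ.1), (hψ.2.1.isCompact.union hρ.2.1).of_isClosed_subset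
    (isClosed_tsupport _) hsub, hsub.trans (union_subset hψ.2.2 hρ.2.2)⟩

theorem IsTimeTestFunction.integral_eq {T : ℝ} {ψ : ℝ → ℝ} (hψ : IsTimeTestFunction T ψ) :
    ∫ t in Ioo 0 T, ψ t = ∫ t, ψ t :=
  setIntegral_eq_integral_of_forall_compl_eq_zero fun _ ht ↦ hψ.eq_zero ht

theorem IsTimeTestFunction.integrableOn_smul {Y : Type*} [NormedAddCommGroup Y] [NormedSpace ℝ Y]
    {T : ℝ} {ψ : ℝ → ℝ} (hψ : IsTimeTestFunction T ψ)
    {w : ℝ → Y} (hw : IntegrableOn w (Ioo 0 T)) : IntegrableOn (fun t ↦ ψ t • w t) (Ioo 0 T) := by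
  rw [← integrableOn_Icc_iff_integrableOn_Ioo] at hw ⊢
  exact hw.continuousOn_smul hψ.1.continuous.continuousOn isCompact_Icc

/-- The du Bois-Reymond lemma: a function with an integrable weak time derivative is a primitive. -/
theorem IsWeakTimeDeriv.exists_ae_eq_primitive {T : ℝ} (hT : 0 < T) {f w : ℝ → X}
    (hf : IntegrableOn f (Ioo 0 T)) (hw : IntegrableOn w (Ioo 0 T)) (h : IsWeakTimeDeriv T f w) :
    ∃ c, ∀ᵐ t ∂timeMeasure T, f t = c + ∫ τ in (0)..t, w τ := by
  obtain ⟨ρ, hρ, hρ1⟩ := exists_timeTestFunction_integral_one hT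
  -- The function z has weak derivative zero; it remains to see that z is constant almost
  -- everywhere.
  set z : ℝ → X := fun t ↦ f t - ∫ τ in (0)..t, w τ with hz
  have hWi : IntegrableOn (fun t ↦ ∫ τ in (0)..t, w τ) (Ioo 0 T) :=
    (continuousOn_primitive_Icc hw).integrableOn_Icc.mono_set Ioo_subset_Icc_self
  have hzi : IntegrableOn z (Ioo 0 T) := hf.sub hWi
  have hd : ∀ η, IsTimeTestFunction T η → ContDiff ℝ 1 η := fun η hη ↦
    hη.1.of_le (mod_cast le_top)
  have hz0 : ∀ η, IsTimeTestFunction T η → ∫ t in Ioo 0 T, deriv η t • z t = 0 := by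
    intro η hη
    have h1 := integral_deriv_smul_primitive hT (hd η hη) hw 0
    rw [hη.eq_zero (t := T) (by simp), hη.eq_zero (t := 0) (by simp)] at h1
    have hdc := (hd η hη).continuous_deriv le_rfl
    have h3 : ∀ g : ℝ → X, IntegrableOn g (Ioo 0 T) →
        IntegrableOn (fun t ↦ deriv η t • g t) (Ioo 0 T) := by
      intro g hg
      rw [← integrableOn_Icc_iff_integrableOn_Ioo] at hg ⊢
      exact hg.continuousOn_smul hdc.continuousOn isCompact_Icc
    simp only [hz, smul_sub]
    rw [integral_sub (h3 f hf) (h3 _ hWi), h η hη]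
    simp only [zero_add, zero_smul, zero_sub, sub_zero] at h1
    rw [h1, sub_self]
  refine ⟨∫ t in Ioo 0 T, ρ t • z t, ?_⟩
  set c := ∫ t in Ioo 0 T, ρ t • z t with hc
  have key := IsOpen.ae_eq_zero_of_integral_contDiff_smul_eq_zero (μ := volume)
    (f := fun t ↦ z t - c) (isOpen_Ioo (a := (0 : ℝ)) (b := T))
    ((hzi.sub (integrableOn_const (by simp))).locallyIntegrableOn) ?_
  · rw [ae_restrict_iff' measurableSet_Ioo]
    filter_upwards [key] with t ht hmem
    have := ht hmem
    simp only [hz] at this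
    rw [← sub_eq_zero, ← this]; abel
  · intro ψ hψ1 hψ2 hψ3
    have hψ : IsTimeTestFunction T ψ := ⟨hψ1, hψ2, hψ3⟩
    -- Subtracting (∫ψ) ρ makes the mean zero, so the difference is some η' and is annihilated by z.
    -- Hence ∫ ψ z = (∫ψ) ∫ ρ z = ∫ ψ c.
    obtain ⟨η, hη, hηd⟩ := exists_timeTestFunction_primitive (hψ.sub_smul hρ (∫ t, ψ t)) (by
      rw [integral_sub (hψ1.continuous.integrable_of_hasCompactSupport hψ2)
        ((hρ.1.continuous.integrable_of_hasCompactSupport hρ.2.1).const_mul _),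
        integral_const_mul, hρ1, mul_one, sub_self])
    have h1 := hz0 η hη
    rw [hηd] at h1
    simp only [sub_smul, mul_smul] at h1
    rw [integral_sub (hψ.integrableOn_smul hzi) ((hρ.integrableOn_smul hzi).fun_smul (∫ t, ψ t)),
      integral_smul, ← hc] at h1
    have h2 : ∫ t, ψ t • (z t - c) = ∫ t in Ioo 0 T, ψ t • (z t - c) := by
      refine (setIntegral_eq_integral_of_forall_compl_eq_zero fun t ht ↦ ?_).symm
      rw [hψ.eq_zero ht, zero_smul]
    rw [h2]
    simp only [smul_sub]
    rw [integral_sub (hψ.integrableOn_smul hzi)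
      (hψ.integrableOn_smul (integrableOn_const (by simp))), integral_smul_const, hψ.integral_eq, h1]

end WeakDeriv


/-! ### Translations in L² and averages over short time intervals -/

section Translation

variable {V : Type*} [NormedAddCommGroup V] [InnerProductSpace ℝ V]

theorem integrable_inner_of_memLp {α : Type*} [MeasurableSpace α] {μ : Measure α} {f g : α → V}
    (hf : MemLp f 2 μ) (hg : MemLp g 2 μ) : Integrable (fun a ↦ inner ℝ (f a) (g a)) μ := by
  refine (L2.integrable_inner (𝕜 := ℝ) (hf.toLp f) (hg.toLp g)).congr ?_
  filter_upwards [hf.coeFn_toLp, hg.coeFn_toLp] with a h1 h2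
  rw [h1, h2]

theorem inner_toLp {α : Type*} [MeasurableSpace α] {μ : Measure α} {f g : α → V}
    (hf : MemLp f 2 μ) (hg : MemLp g 2 μ) :
    inner ℝ (hf.toLp f) (hg.toLp g) = ∫ a, inner ℝ (f a) (g a) ∂μ := by
  rw [L2.inner_def]
  refine integral_congr_ae ?_
  filter_upwards [hf.coeFn_toLp, hg.coeFn_toLp] with a h1 h2
  rw [h1, h2]

theorem memLp_translate {Y : Type*} [NormedAddCommGroup Y] {f : ℝ → Y} (hf : MemLp f 2 volume) (h : ℝ) :
    MemLp (fun t ↦ f (t + h)) 2 volume :=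
  hf.comp_measurePreserving (measurePreserving_add_right volume h)

/-- Translation is the action of the additive group ℝ on L² by shifts of the domain, which is
continuous because the exponent is finite. -/
theorem continuous_toLp_translate {Y : Type*} [NormedAddCommGroup Y] {f : ℝ → Y} (hf : MemLp f 2 volume) :
    Continuous fun h : ℝ ↦ (memLp_translate hf h).toLp (fun t ↦ f (t + h)) := by
  have : Fact ((2 : ℝ≥0∞) ≠ ⊤) := ⟨by norm_num⟩
  have h1 : Continuous fun h : ℝ ↦ (DomAddAct.mk h +ᵥ hf.toLp f : Lp Y 2 (volume : Measure ℝ)) :=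
    DomAddAct.continuous_mk.vadd continuous_const
  convert h1 using 2 with h
  rw [DomAddAct.mk_vadd_toLp]
  congr 1
  ext t
  simp [add_comm]

variable [CompleteSpace V]

/-- Fubini, after writing the integral of F from τ to τ + h as the integral of F(τ + θ) over 0 < θ <
h. -/
theorem integral_inner_average {F y : ℝ → V} (hF : MemLp F 2 volume) (hy : MemLp y 2 volume)
    {h : ℝ} (hh : 0 ≤ h) :
    ∫ τ, inner ℝ (∫ σ in τ..(τ + h), F σ) (y τ) =
      ∫ θ in (0)..h, ∫ τ, inner ℝ (F (τ + θ)) (y τ) := by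
  have hqm : Measure.QuasiMeasurePreserving (fun z : ℝ × ℝ ↦ z.2 + z.1)
      ((volume.restrict (Ioc 0 h)).prod volume) volume := by
    have := quasiMeasurePreserving_add (G := ℝ) (volume.restrict (Ioc 0 h)) volume
    simpa only [add_comm] using this
  -- The shear (θ, τ) ↦ (θ, θ + τ) preserves the product measure, which makes F(τ + θ) square
  -- integrable in both variables.
  have hmp : MeasurePreserving (fun z : ℝ × ℝ ↦ (z.1, z.1 + z.2))
      ((volume.restrict (Ioc 0 h)).prod volume) ((volume.restrict (Ioc 0 h)).prod volume) :=
    measurePreserving_prod_add _ _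
  have hsq : ∀ {g : ℝ → V}, MemLp g 2 volume → Integrable (fun z : ℝ × ℝ ↦ ‖g z.2‖ ^ 2)
      ((volume.restrict (Ioc 0 h)).prod volume) := fun hg ↦
    ((memLp_two_iff_integrable_sq_norm hg.1).mp hg).comp_snd _
  have hint : Integrable (fun z : ℝ × ℝ ↦ inner ℝ (F (z.2 + z.1)) (y z.2))
      ((volume.restrict (Ioc 0 h)).prod volume) := by
    have h1 : Integrable (fun z : ℝ × ℝ ↦ ‖F (z.2 + z.1)‖ ^ 2)
        ((volume.restrict (Ioc 0 h)).prod volume) := by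
      have := hmp.integrable_comp_of_integrable (hsq hF)
      simpa only [Function.comp_def, add_comm] using this
    refine (h1.add (hsq hy)).mono' ?_ (Eventually.of_forall fun z ↦ ?_)
    · exact (hF.1.comp_quasiMeasurePreserving hqm).inner hy.1.comp_snd
    · refine (norm_inner_le_norm _ _).trans ?_
      simp only [Pi.add_apply]
      nlinarith [two_mul_le_add_sq ‖F (z.2 + z.1)‖ ‖y z.2‖, sq_nonneg ‖F (z.2 + z.1)‖,
        sq_nonneg ‖y z.2‖]
  rw [intervalIntegral.integral_of_le hh, integral_integral_swap hint]
  congr 1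
  ext τ
  have hFi : IntervalIntegrable (fun θ ↦ F (τ + θ)) volume 0 h := by
    have : LocallyIntegrable (fun θ ↦ F (τ + θ)) volume :=
      (hF.comp_measurePreserving (measurePreserving_add_left volume τ)).locallyIntegrable
        (by norm_num)
    exact intervalIntegrable_iff.mpr
      ((this.integrableOn_isCompact isCompact_uIcc).mono_set uIoc_subset_uIcc)
  have hsub : ∫ σ in τ..(τ + h), F σ = ∫ θ in (0)..h, F (τ + θ) := by
    rw [intervalIntegral.integral_comp_add_left (fun x ↦ F x)]; simp
  rw [hsub, intervalIntegral.integral_of_le hh, real_inner_comm,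
    ← integral_inner ((intervalIntegrable_iff_integrableOn_Ioc_of_le hh).mp hFi)]
  simp only [real_inner_comm]

/-- By `integral_inner_average` the quotient is the mean over 0 < θ < h of Ψ(θ, h) = ∫_S ⟨F(τ + θ),
v(τ) + v(τ + h)⟩. Since translations are continuous in L², Ψ is jointly continuous and the mean
tends to Ψ(0, 0). This takes the place of a regularization in time. -/
theorem tendsto_average_inner {F v : ℝ → V} (hF : MemLp F 2 volume) (hv : MemLp v 2 volume)
    {S : Set ℝ} (hS : MeasurableSet S) :
    Tendsto (fun h ↦ h⁻¹ * ∫ τ in S, inner ℝ (∫ σ in τ..(τ + h), F σ) (v τ + v (τ + h)))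
      (𝓝[>] 0) (𝓝 (2 * ∫ τ in S, inner ℝ (F τ) (v τ))) := by
  let Ψ : ℝ → ℝ → ℝ := fun θ h ↦ ∫ τ in S, inner ℝ (F (τ + θ)) (v τ + v (τ + h))
  have hΨ : Continuous fun z : ℝ × ℝ ↦ Ψ z.1 z.2 := by
    let R := LpToLpRestrictCLM ℝ V ℝ volume 2 S
    have h1 : Continuous fun z : ℝ × ℝ ↦
        inner ℝ (R ((memLp_translate hF z.1).toLp (fun t ↦ F (t + z.1))))
          (R (hv.toLp v + (memLp_translate hv z.2).toLp (fun t ↦ v (t + z.2)))) :=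
      (R.continuous.comp ((continuous_toLp_translate hF).comp continuous_fst)).inner
        (R.continuous.comp (continuous_const.add
          ((continuous_toLp_translate hv).comp continuous_snd)))
    convert h1 using 2 with z
    rw [L2.inner_def]
    refine integral_congr_ae ?_
    filter_upwards [LpToLpRestrictCLM_coeFn ℝ S ((memLp_translate hF z.1).toLp _),
      LpToLpRestrictCLM_coeFn ℝ S (hv.toLp v + (memLp_translate hv z.2).toLp _),
      ae_restrict_of_ae (memLp_translate hF z.1).coeFn_toLp,
      ae_restrict_of_ae (memLp_translate hv z.2).coeFn_toLp, ae_restrict_of_ae hv.coeFn_toLp,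
      ae_restrict_of_ae (Lp.coeFn_add (hv.toLp v) ((memLp_translate hv z.2).toLp _))]
      with t h1 h2 h3 h4 h5 h6
    rw [h1, h2, h6, Pi.add_apply, h3, h4, h5]
  have h0 : Ψ 0 0 = 2 * ∫ τ in S, inner ℝ (F τ) (v τ) := by
    simp only [Ψ, add_zero]
    rw [← integral_const_mul]
    congr 1; ext τ
    rw [← two_smul ℝ, real_inner_smul_right]
  have heq : ∀ h : ℝ, 0 < h →
      h⁻¹ * ∫ τ in S, inner ℝ (∫ σ in τ..(τ + h), F σ) (v τ + v (τ + h)) =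
        h⁻¹ * ∫ θ in (0)..h, Ψ θ h := by
    intro h hh
    congr 1
    have hy : MemLp (S.indicator fun τ ↦ v τ + v (τ + h)) 2 volume :=
      (hv.add (memLp_translate hv h)).indicator hS
    have hind : ∀ G : ℝ → V, ∫ τ in S, inner ℝ (G τ) (v τ + v (τ + h)) =
        ∫ τ, inner ℝ (G τ) (S.indicator (fun τ ↦ v τ + v (τ + h)) τ) := by
      intro G
      rw [← integral_indicator hS]
      congr 1; ext τ
      by_cases hτ : τ ∈ S <;> simp [hτ]
    rw [hind, integral_inner_average hF hy hh.le]
    simp only [Ψ]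
    congr 1; ext θ
    rw [hind (fun τ ↦ F (τ + θ))]
  rw [← h0, Metric.tendsto_nhdsWithin_nhds]
  intro ε hε
  obtain ⟨δ, hδ, hδε⟩ := Metric.continuousAt_iff.mp (hΨ.continuousAt (x := (0, 0))) (ε / 2)
    (by linarith)
  refine ⟨δ, hδ, fun {h} hh hd ↦ ?_⟩
  have hh : 0 < h := hh
  rw [heq h hh, dist_eq_norm]
  have hci : IntervalIntegrable (fun θ ↦ Ψ θ h) volume 0 h :=
    (hΨ.comp (continuous_id.prodMk continuous_const)).intervalIntegrable _ _
  have h2 : h⁻¹ * ∫ θ in (0)..h, Ψ θ h = Ψ 0 0 + h⁻¹ * ∫ θ in (0)..h, (Ψ θ h - Ψ 0 0) := by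
    rw [intervalIntegral.integral_sub hci intervalIntegrable_const]
    simp only [intervalIntegral.integral_const, sub_zero, smul_eq_mul]
    field_simp; ring
  have h3 : ‖∫ θ in (0)..h, (Ψ θ h - Ψ 0 0)‖ ≤ ε / 2 * |h - 0| := by
    refine intervalIntegral.norm_integral_le_of_norm_le_const fun θ hθ ↦ ?_
    rw [uIoc_of_le hh.le] at hθ
    rw [← dist_eq_norm]
    refine (hδε (x := (θ, h)) ?_).le
    rw [Real.dist_eq, sub_zero, abs_of_pos hh] at hd
    rw [Prod.dist_eq, max_lt_iff, Real.dist_eq, Real.dist_eq, sub_zero, sub_zero,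
      abs_of_pos hh, abs_of_pos hθ.1]
    exact ⟨hθ.2.trans_lt hd, hd⟩
  rw [h2, add_sub_cancel_left, norm_mul, norm_inv, Real.norm_of_nonneg hh.le]
  rw [sub_zero, abs_of_pos hh] at h3
  calc h⁻¹ * _ ≤ h⁻¹ * (ε / 2 * h) := by gcongr
    _ = ε / 2 := by field_simp
    _ < ε := by linarith

end Translation


/-! ### Uniqueness of continuous representatives -/

theorem Icc_subset_closure_of_ae {T : ℝ} (hT : 0 < T) {S : Set ℝ}
    (hS : ∀ᵐ t ∂timeMeasure T, t ∈ S) : Icc 0 T ⊆ closure (Ioo 0 T ∩ S) := by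
  rw [ae_restrict_iff' measurableSet_Ioo] at hS
  have hd := Measure.dense_of_ae hS
  have h1 := hd.open_subset_closure_inter (isOpen_Ioo (a := (0 : ℝ)) (b := T))
  have h2 : Ioo 0 T ∩ {x | x ∈ Ioo 0 T → x ∈ S} = Ioo 0 T ∩ S := by
    ext x; simp only [mem_inter_iff, mem_ofPred_eq]; tauto
  rw [h2] at h1
  rw [← closure_Ioo hT.ne]
  exact closure_minimal h1 isClosed_closure

theorem eqOn_Icc_of_ae {Y : Type*} [TopologicalSpace Y] [T2Space Y] {T : ℝ} (hT : 0 < T)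
    {f g : ℝ → Y} (hf : ContinuousOn f (Icc 0 T)) (hg : ContinuousOn g (Icc 0 T))
    (h : f =ᵐ[timeMeasure T] g) : EqOn f g (Icc 0 T) :=
  Set.EqOn.of_subset_closure (s := Ioo 0 T ∩ {t | f t = g t}) (fun _ ht ↦ ht.2) hf hg
    (fun _ ht ↦ Ioo_subset_Icc_self ht.1) (Icc_subset_closure_of_ae hT h)

theorem IsContinuousRep.eqOn {Y : Type*} [NormedAddCommGroup Y] {T : ℝ} (hT : 0 < T)
    {u U U' : ℝ → Y} (h : IsContinuousRep T u U) (h' : IsContinuousRep T u U') :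
    EqOn U U' (Icc 0 T) :=
  eqOn_Icc_of_ae hT h.1 h'.1 (h.2.symm.trans h'.2)

/-! ### Energy balance between almost all pairs of times -/

section LionsMagenes

variable {V H : Type*} [NormedAddCommGroup V] [InnerProductSpace ℝ V] [CompleteSpace V]
  [NormedAddCommGroup H] [InnerProductSpace ℝ H] [CompleteSpace H]

theorem memLp_time_integrableOn {Y : Type*} [NormedAddCommGroup Y] {T : ℝ} {f : ℝ → Y}
    (hf : MemLp f 2 (timeMeasure T)) : IntegrableOn f (Ioo 0 T) :=
  hf.integrable one_le_two

/-- The operator `ι†ι` on `V` that represents the inner product of `H`. -/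
noncomputable def gram (ι : V →L[ℝ] H) : V →L[ℝ] V := ι.adjoint ∘L ι

theorem inner_gram (ι : V →L[ℝ] H) (x y : V) :
    inner ℝ (gram ι x) y = inner ℝ (ι x) (ι y) := by
  simp [gram, ContinuousLinearMap.adjoint_inner_left]

/-- The integrated energy balance between almost all pairs of times. -/
theorem energy_balance_of_primitive (ι : V →L[ℝ] H) {T : ℝ} {v F : ℝ → V}
    (hv : MemLp v 2 (timeMeasure T)) (hF : MemLp F 2 (timeMeasure T)) {c : V}
    (h : ∀ᵐ t ∂timeMeasure T, gram ι (v t) = c + ∫ τ in (0)..t, F τ) :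
    ∃ S ⊆ Ioo 0 T, (∀ᵐ t ∂timeMeasure T, t ∈ S) ∧
      (∀ t ∈ S, gram ι (v t) = c + ∫ τ in (0)..t, F τ) ∧
      ∀ a ∈ S, ∀ b ∈ S, a < b →
        ‖ι (v b)‖ ^ 2 - ‖ι (v a)‖ ^ 2 = 2 * ∫ τ in a..b, inner ℝ (F τ) (v τ) := by
  -- Extension by zero to the whole line makes the translation results applicable.
  set v' : ℝ → V := (Ioo 0 T).indicator v with hv'
  set F' : ℝ → V := (Ioo 0 T).indicator F with hF'
  have hv'L : MemLp v' 2 volume := (memLp_indicator_iff_restrict measurableSet_Ioo).mpr hv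
  have hF'L : MemLp F' 2 volume := (memLp_indicator_iff_restrict measurableSet_Ioo).mpr hF
  have hv'eq : ∀ t ∈ Ioo 0 T, v' t = v t := fun t ht ↦ indicator_of_mem ht _
  have hF'eq : ∀ t ∈ Ioo 0 T, F' t = F t := fun t ht ↦ indicator_of_mem ht _
  set g : ℝ → ℝ := fun t ↦ ‖ι (v' t)‖ ^ 2 with hg
  have hgi : Integrable g volume := by
    have h1 : MemLp (fun t ↦ ι (v' t)) 2 volume := ι.comp_memLp' hv'L
    exact (memLp_two_iff_integrable_sq_norm h1.1).mp h1
  have hgint : ∀ a b, IntervalIntegrable g volume a b := fun a b ↦ hgi.intervalIntegrable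
  have hFint : ∀ a ∈ Ioo 0 T, ∀ b ∈ Ioo 0 T, ∫ τ in a..b, F' τ = ∫ τ in a..b, F τ := by
    intro a ha b hb
    refine intervalIntegral.integral_congr fun τ hτ ↦ hF'eq τ ?_
    exact (convex_Ioo 0 T).ordConnected.uIcc_subset ha hb hτ
  have hFi := memLp_time_integrableOn hF
  set S₀ : Set ℝ := {t | t ∈ Ioo 0 T ∧ gram ι (v t) = c + ∫ τ in (0)..t, F τ} with hS₀
  have hS₀sub : ∀ t ∈ S₀, t ∈ Icc 0 T := fun t ht ↦ Ioo_subset_Icc_self ht.1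
  have hdiff : ∀ a ∈ S₀, ∀ b ∈ S₀, gram ι (v b) - gram ι (v a) = ∫ τ in a..b, F τ := by
    intro a ha b hb
    have h0 : (0 : ℝ) ∈ Icc 0 T := ⟨le_rfl, (ha.1.1.trans ha.1.2).le⟩
    rw [hb.2, ha.2, ← intervalIntegral.integral_interval_sub_left
      (intervalIntegrable_of_integrableOn_Ioo hFi h0 (hS₀sub b hb))
      (intervalIntegrable_of_integrableOn_Ioo hFi h0 (hS₀sub a ha))]
    abel
  -- The symmetry of ι†ι gives ⟨ι†ι (y - x), x + y⟩ = ‖ι y‖² - ‖ι x‖², so the increment of the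
  -- square is exact and v itself need not be differentiable.
  have hbal : ∀ a ∈ S₀, ∀ b ∈ S₀, inner ℝ (∫ τ in a..b, F' τ) (v' a + v' b) = g b - g a := by
    intro a ha b hb
    rw [hFint a ha.1 b hb.1, ← hdiff a ha b hb, ← map_sub, inner_gram]
    simp only [hg, hv'eq a ha.1, hv'eq b hb.1, map_sub, map_add, inner_add_right, inner_sub_left,
      real_inner_self_eq_norm_sq]
    rw [real_inner_comm (ι (v b)) (ι (v a))]
    ring
  have hSae : ∀ᵐ t : ℝ, t ∈ Ioo 0 T → t ∈ S₀ := by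
    rw [ae_restrict_iff' measurableSet_Ioo] at h
    filter_upwards [h] with t ht hm using ⟨hm, ht hm⟩
  -- The good times are those at which the primitive formula holds and the primitives of ‖ι v‖² have
  -- the expected derivative; both conditions hold almost everywhere.
  refine ⟨{t | t ∈ S₀ ∧ ∀ c, HasDerivAt (fun x ↦ ∫ τ in c..x, g τ) (g t) t}, fun t ht ↦ ht.1.1,
    ?_, fun t ht ↦ ht.1.2, ?_⟩
  · rw [ae_restrict_iff' measurableSet_Ioo]
    filter_upwards [hSae, LocallyIntegrable.ae_hasDerivAt_integral hgi.locallyIntegrable] with t h1 h2 hm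
      using ⟨h1 hm, h2⟩
  rintro a ⟨ha, hda⟩ b ⟨hb, hdb⟩ hab
  have hlim := tendsto_average_inner hF'L hv'L (measurableSet_Ioc (a := a) (b := b))
  have hslope : ∀ x, HasDerivAt (fun x ↦ ∫ τ in (0)..x, g τ) (g x) x →
      Tendsto (fun h ↦ h⁻¹ * ((∫ τ in (0)..(x + h), g τ) - ∫ τ in (0)..x, g τ)) (𝓝[>] 0)
        (𝓝 (g x)) := by
    intro x hx
    have := (hasDerivAt_iff_tendsto_slope_zero.mp hx).mono_left
      (nhdsWithin_mono 0 (show Ioi (0 : ℝ) ⊆ {0}ᶜ from fun y hy ↦ ne_of_gt hy))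
    simpa using this
  have hlim2 := (hslope b (hdb 0)).sub (hslope a (hda 0))
  -- Integrating the exact increments over (a, b] telescopes to integrals of g near b and near a.
  -- Divided by h they tend to g(b) - g(a), while the other side tends to 2 ∫ ⟨F, v⟩.
  have hev : ∀ᶠ h in 𝓝[>] (0 : ℝ),
      h⁻¹ * ∫ τ in Ioc a b, inner ℝ (∫ σ in τ..(τ + h), F' σ) (v' τ + v' (τ + h)) =
        h⁻¹ * ((∫ τ in (0)..(b + h), g τ) - ∫ τ in (0)..b, g τ) -
          h⁻¹ * ((∫ τ in (0)..(a + h), g τ) - ∫ τ in (0)..a, g τ) := by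
    have hT : 0 < T - b := sub_pos.mpr hb.1.2
    filter_upwards [Ioo_mem_nhdsGT hT] with h hh
    rw [← mul_sub]
    congr 1
    have hshift : ∀ᵐ τ : ℝ, τ + h ∈ Ioo 0 T → τ + h ∈ S₀ :=
      (measurePreserving_add_right volume h).quasiMeasurePreserving.ae hSae
    have h1 : ∫ τ in Ioc a b, inner ℝ (∫ σ in τ..(τ + h), F' σ) (v' τ + v' (τ + h)) =
        ∫ τ in Ioc a b, (g (τ + h) - g τ) := by
      refine setIntegral_congr_ae measurableSet_Ioc ?_
      filter_upwards [hSae, hshift] with τ h2 h3 hm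
      refine hbal τ (h2 ⟨ha.1.1.trans hm.1, hm.2.trans_lt hb.1.2⟩) (τ + h) (h3 ⟨?_, ?_⟩)
      · linarith [ha.1.1, hm.1, hh.1]
      · linarith [hm.2, hh.2]
    rw [h1, ← intervalIntegral.integral_of_le hab.le, intervalIntegral.integral_sub
      ((hgi.comp_add_right h).intervalIntegrable) (hgint _ _),
      intervalIntegral.integral_comp_add_right g h]
    have e1 := intervalIntegral.integral_interval_sub_left (hgint 0 b) (hgint 0 a)
    have e2 := intervalIntegral.integral_interval_sub_left (hgint 0 (b + h)) (hgint 0 (a + h))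
    rw [← e1, ← e2]; ring
  have huniq := tendsto_nhds_unique (hlim.congr' hev) hlim2
  simp only [hg, hv'eq a ha.1, hv'eq b hb.1] at huniq
  rw [← huniq, intervalIntegral.integral_of_le hab.le]
  congr 1
  refine setIntegral_congr_fun measurableSet_Ioc fun τ hτ ↦ ?_
  have hm : τ ∈ Ioo 0 T := ⟨ha.1.1.trans hτ.1, hτ.2.trans_lt hb.1.2⟩
  simp only [hv'eq τ hm, hF'eq τ hm]

end LionsMagenes


/-! ### Continuity in time with values in H -/

section LionsMagenes

variable {V H : Type*} [NormedAddCommGroup V] [InnerProductSpace ℝ V] [CompleteSpace V]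
  [NormedAddCommGroup H] [InnerProductSpace ℝ H] [CompleteSpace H]

/-- The left side is |2 ∫ ⟨F, v - y⟩|, and 2 ‖F‖ (‖v‖ + ‖y‖) ≤ 2 ‖F‖² + ‖v‖² + ‖y‖² pointwise. It is
applied with y the value of v at one end of the interval. -/
theorem abs_integral_inner_sub_le {F v : ℝ → V} {p r : ℝ} (hpr : p ≤ r)
    (hF : MemLp F 2 (volume.restrict (Ioc p r))) (hv : MemLp v 2 (volume.restrict (Ioc p r)))
    (y : V) :
    |2 * (∫ τ in p..r, inner ℝ (F τ) (v τ)) - 2 * inner ℝ (∫ τ in p..r, F τ) y| ≤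
      2 * (∫ τ in p..r, ‖F τ‖ ^ 2) + (∫ τ in p..r, ‖v τ‖ ^ 2) + (r - p) * ‖y‖ ^ 2 := by
  have hi1 : IntervalIntegrable (fun τ ↦ inner ℝ (F τ) (v τ)) volume p r :=
    (intervalIntegrable_iff_integrableOn_Ioc_of_le hpr).mpr (integrable_inner_of_memLp hF hv)
  have hi2 : IntervalIntegrable (fun τ ↦ inner ℝ (F τ) y) volume p r :=
    (intervalIntegrable_iff_integrableOn_Ioc_of_le hpr).mpr
      (integrable_inner_of_memLp hF (memLp_const y))
  have hF2 : IntervalIntegrable (fun τ ↦ ‖F τ‖ ^ 2) volume p r :=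
    (intervalIntegrable_iff_integrableOn_Ioc_of_le hpr).mpr
      ((memLp_two_iff_integrable_sq_norm hF.1).mp hF)
  have hv2 : IntervalIntegrable (fun τ ↦ ‖v τ‖ ^ 2) volume p r :=
    (intervalIntegrable_iff_integrableOn_Ioc_of_le hpr).mpr
      ((memLp_two_iff_integrable_sq_norm hv.1).mp hv)
  have h1 : inner ℝ (∫ τ in p..r, F τ) y = ∫ τ in p..r, inner ℝ (F τ) y := by
    rw [intervalIntegral.integral_of_le hpr, intervalIntegral.integral_of_le hpr, real_inner_comm,
      ← integral_inner (hF.integrable one_le_two)]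
    simp only [real_inner_comm]
  have h2 : ∫ τ in p..r, (2 * ‖F τ‖ ^ 2 + ‖v τ‖ ^ 2 + ‖y‖ ^ 2) =
      2 * (∫ τ in p..r, ‖F τ‖ ^ 2) + (∫ τ in p..r, ‖v τ‖ ^ 2) + (r - p) * ‖y‖ ^ 2 := by
    rw [intervalIntegral.integral_add ((hF2.const_mul 2).add hv2) intervalIntegrable_const,
      intervalIntegral.integral_add (hF2.const_mul 2) hv2, intervalIntegral.integral_const_mul,
      intervalIntegral.integral_const, smul_eq_mul]
  rw [h1, ← mul_sub, ← intervalIntegral.integral_sub hi1 hi2,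
    ← intervalIntegral.integral_const_mul, ← h2, ← Real.norm_eq_abs]
  refine intervalIntegral.norm_integral_le_of_norm_le hpr ?_
    (((hF2.const_mul 2).add hv2).add intervalIntegrable_const)
  refine Eventually.of_forall fun τ _ ↦ ?_
  rw [← inner_sub_right, norm_mul, Real.norm_of_nonneg zero_le_two]
  have h3 : ‖inner ℝ (F τ) (v τ - y)‖ ≤ ‖F τ‖ * (‖v τ‖ + ‖y‖) :=
    (norm_inner_le_norm _ _).trans (by gcongr; exact norm_sub_le _ _)
  nlinarith [sq_nonneg (‖F τ‖ - ‖v τ‖), sq_nonneg (‖F τ‖ - ‖y‖)]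

/-- Modulus of continuity in `H` of a function with a weak derivative in the dual of `V`. -/
theorem sq_norm_sub_le_of_energy_balance (ι : V →L[ℝ] H) {T : ℝ} {v F : ℝ → V}
    (hv : MemLp v 2 (timeMeasure T)) (hF : MemLp F 2 (timeMeasure T)) {c : V}
    {S : Set ℝ} (hS : S ⊆ Ioo 0 T) (hSae : ∀ᵐ t ∂timeMeasure T, t ∈ S)
    (h1 : ∀ t ∈ S, gram ι (v t) = c + ∫ τ in (0)..t, F τ)
    (h2 : ∀ a ∈ S, ∀ b ∈ S, a < b →
        ‖ι (v b)‖ ^ 2 - ‖ι (v a)‖ ^ 2 = 2 * ∫ τ in a..b, inner ℝ (F τ) (v τ))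
    {a b : ℝ} (ha : a ∈ S) (hb : b ∈ S) (hab : a < b) :
    ‖ι (v b) - ι (v a)‖ ^ 2 ≤ 8 * ∫ τ in a..b, (‖F τ‖ ^ 2 + ‖v τ‖ ^ 2) := by
  have hFi := memLp_time_integrableOn hF
  have hsub : ∀ p ∈ S, ∀ r ∈ S, Ioc p r ⊆ Ioo 0 T := fun p hp r hr τ hτ ↦
    ⟨(hS hp).1.trans hτ.1, hτ.2.trans_lt (hS hr).2⟩
  have hFL : ∀ p ∈ S, ∀ r ∈ S, MemLp F 2 (volume.restrict (Ioc p r)) := fun p hp r hr ↦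
    hF.mono_measure (Measure.restrict_mono (hsub p hp r hr) le_rfl)
  have hvL : ∀ p ∈ S, ∀ r ∈ S, MemLp v 2 (volume.restrict (Ioc p r)) := fun p hp r hr ↦
    hv.mono_measure (Measure.restrict_mono (hsub p hp r hr) le_rfl)
  have hF2 : IntegrableOn (fun τ ↦ ‖F τ‖ ^ 2) (Ioo 0 T) :=
    (memLp_two_iff_integrable_sq_norm hF.1).mp hF
  have hv2 : IntegrableOn (fun τ ↦ ‖v τ‖ ^ 2) (Ioo 0 T) :=
    (memLp_two_iff_integrable_sq_norm hv.1).mp hv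
  have hint : ∀ {f : ℝ → ℝ}, IntegrableOn f (Ioo 0 T) → ∀ p ∈ S, ∀ r ∈ S,
      IntervalIntegrable f volume p r := fun hf p hp r hr ↦
    intervalIntegrable_of_integrableOn_Ioo hf (Ioo_subset_Icc_self (hS hp))
      (Ioo_subset_Icc_self (hS hr))
  have hdiff : ∀ p ∈ S, ∀ r ∈ S, ∀ y, inner ℝ (∫ τ in p..r, F τ) y =
      inner ℝ (ι (v r) - ι (v p)) (ι y) := by
    intro p hp r hr y
    have h0 : (0 : ℝ) ∈ Icc 0 T := ⟨le_rfl, ((hS ha).1.trans (hS ha).2).le⟩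
    rw [← map_sub, ← inner_gram, map_sub, h1 r hr, h1 p hp,
      ← intervalIntegral.integral_interval_sub_left
      (intervalIntegrable_of_integrableOn_Ioo hFi h0 (Ioo_subset_Icc_self (hS hr)))
      (intervalIntegrable_of_integrableOn_Ioo hFi h0 (Ioo_subset_Icc_self (hS hp)))]
    congr 1; abel
  -- With e = p, ‖ι v(r) - ι v(p)‖² is the increment of ‖ι v‖² minus 2 ⟨ι v(r) - ι v(p), ι v(p)⟩;
  -- with e = r both signs change. Either end may thus serve as the anchor whose V norm enters the
  -- bound.
  have hbd : ∀ p ∈ S, ∀ r ∈ S, p < r → ∀ e, e = p ∨ e = r → ‖ι (v r) - ι (v p)‖ ^ 2 ≤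
      2 * (∫ τ in p..r, ‖F τ‖ ^ 2) + (∫ τ in p..r, ‖v τ‖ ^ 2) + (r - p) * ‖v e‖ ^ 2 := by
    intro p hp r hr hpr e he
    have h3 := abs_le.mp (abs_integral_inner_sub_le hpr.le (hFL p hp r hr) (hvL p hp r hr) (v e))
    rw [← h2 p hp r hr hpr, hdiff p hp r hr] at h3
    have h4 := norm_sub_sq_real (ι (v r)) (ι (v p))
    rw [inner_sub_left] at h3
    rcases he with rfl | rfl
    · rw [real_inner_self_eq_norm_sq] at h3
      linarith [h3.2]
    · rw [real_inner_self_eq_norm_sq, real_inner_comm] at h3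
      linarith [h3.1]
  -- The V norm of v at a and b is not controlled. The interval is therefore split at a time s where
  -- ‖v‖² is at most its mean, and s is the anchor on both halves.
  obtain ⟨s, hs, hsa, hsb, hsle⟩ : ∃ s ∈ S, a < s ∧ s < b ∧
      (b - a) * ‖v s‖ ^ 2 ≤ ∫ τ in a..b, ‖v τ‖ ^ 2 := by
    have hsub' : Ioo a b ⊆ Ioo 0 T := Ioo_subset_Ioo (hS ha).1.le (hS hb).2.le
    have hnull : volume.restrict (Ioo a b) ({t | t ∈ S} ∩ Ioo a b)ᶜ = 0 := by
      have e1 : ∀ᵐ t ∂volume.restrict (Ioo a b), t ∈ S :=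
        ae_restrict_of_ae_restrict_of_subset hsub' hSae
      have e2 : ∀ᵐ t ∂volume.restrict (Ioo a b), t ∈ Ioo a b := ae_restrict_mem measurableSet_Ioo
      have := e1.and e2
      rw [ae_iff] at this
      exact this
    obtain ⟨s, hs1, hs2⟩ := exists_notMem_null_le_average
      (μ := volume.restrict (Ioo a b)) (f := fun τ ↦ ‖v τ‖ ^ 2)
      (by simp [hab]) (hv2.mono_set hsub') hnull
    rw [mem_compl_iff, not_not] at hs1
    refine ⟨s, hs1.1, hs1.2.1, hs1.2.2, ?_⟩
    rw [setAverage_eq, Real.volume_real_Ioo_of_le hab.le, smul_eq_mul,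
      ← integral_Ioc_eq_integral_Ioo, ← intervalIntegral.integral_of_le hab.le] at hs2
    have hpos : 0 < b - a := sub_pos.mpr hab
    calc (b - a) * ‖v s‖ ^ 2 ≤ (b - a) * ((b - a)⁻¹ * ∫ τ in a..b, ‖v τ‖ ^ 2) := by gcongr
      _ = _ := by field_simp
  have e1 := hbd a ha s hs hsa s (Or.inr rfl)
  have e2 := hbd s hs b hb hsb s (Or.inl rfl)
  have e3 := intervalIntegral.integral_add_adjacent_intervals (hint hF2 a ha s hs)
    (hint hF2 s hs b hb)
  have e4 := intervalIntegral.integral_add_adjacent_intervals (hint hv2 a ha s hs)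
    (hint hv2 s hs b hb)
  have e5 : ‖ι (v b) - ι (v a)‖ ^ 2 ≤
      2 * (‖ι (v b) - ι (v s)‖ ^ 2 + ‖ι (v s) - ι (v a)‖ ^ 2) := by
    have h3 : ‖ι (v b) - ι (v a)‖ ≤ ‖ι (v b) - ι (v s)‖ + ‖ι (v s) - ι (v a)‖ := by
      have := norm_add_le (ι (v b) - ι (v s)) (ι (v s) - ι (v a))
      simpa using this
    nlinarith [sq_nonneg (‖ι (v b) - ι (v s)‖ - ‖ι (v s) - ι (v a)‖), norm_nonneg (ι (v b) - ι (v a))]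
  rw [intervalIntegral.integral_add (hint hF2 a ha b hb) (hint hv2 a ha b hb)]
  have e6 : 0 ≤ ∫ τ in a..b, ‖F τ‖ ^ 2 :=
    intervalIntegral.integral_nonneg hab.le fun _ _ ↦ sq_nonneg _
  have e7 : 0 ≤ ∫ τ in a..b, ‖v τ‖ ^ 2 :=
    intervalIntegral.integral_nonneg hab.le fun _ _ ↦ sq_nonneg _
  nlinarith

/-- The embedding of `{v ∈ L²(0,T;V) : ∂ₜ(ι†ι v) ∈ L²(0,T;V)}` into `C([0,T];H)`, with the energy
identity. -/
theorem exists_continuousRep_of_isWeakTimeDeriv (ι : V →L[ℝ] H) {T : ℝ} (hT : 0 < T)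
    {v F : ℝ → V} (hv : MemLp v 2 (timeMeasure T)) (hF : MemLp F 2 (timeMeasure T))
    (h : IsWeakTimeDeriv T (fun t ↦ gram ι (v t)) F) :
    ∃ U, IsContinuousRep T (fun t ↦ ι (v t)) U ∧ ∀ t ∈ Icc 0 T,
      ‖U t‖ ^ 2 = ‖U 0‖ ^ 2 + 2 * (∫ τ in (0)..t, inner ℝ (F τ) (v τ)) ∧
      ∀ x, inner ℝ (U t) (ι x) = inner ℝ (U 0) (ι x) + inner ℝ (∫ τ in (0)..t, F τ) x := by
  have hvi := memLp_time_integrableOn hv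
  have hFi := memLp_time_integrableOn hF
  obtain ⟨c, hc⟩ := h.exists_ae_eq_primitive hT ((gram ι).integrable_comp hvi) hFi
  obtain ⟨S, hS, hSae, h1, h2⟩ := energy_balance_of_primitive ι hv hF hc
  have hcl : Icc 0 T ⊆ closure S := by
    have := Icc_subset_closure_of_ae hT hSae
    rwa [inter_eq_self_of_subset_right hS] at this
  have hSI : S ⊆ Icc 0 T := hS.trans Ioo_subset_Icc_self
  have hm : IntegrableOn (fun τ ↦ ‖F τ‖ ^ 2 + ‖v τ‖ ^ 2) (Ioo 0 T) :=
    ((memLp_two_iff_integrable_sq_norm hF.1).mp hF).add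
      ((memLp_two_iff_integrable_sq_norm hv.1).mp hv)
  have h0 : (0 : ℝ) ∈ Icc 0 T := ⟨le_rfl, hT.le⟩
  set Θ : ℝ → ℝ := fun t ↦ ∫ τ in (0)..t, (‖F τ‖ ^ 2 + ‖v τ‖ ^ 2) with hΘ
  have hΘc : ContinuousOn Θ (Icc 0 T) := continuousOn_primitive_Icc hm
  -- The bound is stated through the continuous function Θ, so that it gives the Cauchy property
  -- also at times outside S.
  have hmod : ∀ a ∈ S, ∀ b ∈ S, ‖ι (v b) - ι (v a)‖ ^ 2 ≤ 8 * |Θ b - Θ a| := by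
    have hlt : ∀ a ∈ S, ∀ b ∈ S, a < b → ‖ι (v b) - ι (v a)‖ ^ 2 ≤ 8 * |Θ b - Θ a| := by
      intro a ha b hb hab
      refine (sq_norm_sub_le_of_energy_balance ι hv hF hS hSae h1 h2 ha hb hab).trans ?_
      rw [← intervalIntegral.integral_interval_sub_left
        (intervalIntegrable_of_integrableOn_Ioo hm h0 (hSI hb))
        (intervalIntegrable_of_integrableOn_Ioo hm h0 (hSI ha))]
      gcongr
      exact le_abs_self _
    intro a ha b hb
    rcases lt_trichotomy a b with hab | rfl | hab
    · exact hlt a ha b hb hab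
    · simp
    · rw [norm_sub_rev, abs_sub_comm]; exact hlt b hb a ha hab
  have hlim : ∀ t ∈ Icc 0 T, ∃ y, Tendsto (fun t ↦ ι (v t)) (𝓝[S] t) (𝓝 y) := by
    intro t ht
    have hne : (𝓝[S] t).NeBot := mem_closure_iff_nhdsWithin_neBot.mp (hcl ht)
    refine cauchy_map_iff_exists_tendsto.mp (Metric.cauchy_iff.mpr ⟨hne.map _, fun ε hε ↦ ?_⟩)
    have hev : ∀ᶠ x in 𝓝[S] t, |Θ x - Θ t| < ε ^ 2 / 16 :=
      ((hΘc t ht).mono hSI).eventually (Metric.ball_mem_nhds (Θ t) (by positivity))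
    refine ⟨_, image_mem_map (inter_mem hev self_mem_nhdsWithin), ?_⟩
    rintro _ ⟨x, ⟨hx, hxS⟩, rfl⟩ _ ⟨y, ⟨hy, hyS⟩, rfl⟩
    rw [dist_eq_norm]
    refine lt_of_pow_lt_pow_left₀ 2 hε.le ((hmod y hyS x hxS).trans_lt ?_)
    have : |Θ x - Θ y| ≤ |Θ x - Θ t| + |Θ t - Θ y| := abs_sub_le _ _ _
    have hy' : |Θ t - Θ y| < ε ^ 2 / 16 := by rw [abs_sub_comm]; exact hy
    have hx' : |Θ x - Θ t| < ε ^ 2 / 16 := hx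
    linarith
  set U := extendFrom S (fun t ↦ ι (v t)) with hU
  have hUc : ContinuousOn U (Icc 0 T) := continuousOn_extendFrom hcl hlim
  have hUS : ∀ t ∈ S, U t = ι (v t) := by
    intro t ht
    obtain ⟨y, hy⟩ := hlim t (hSI ht)
    -- Since t ∈ S, every set of the filter `𝓝[S] t` contains t, so the limit can only be the value
    -- at t.
    have hyt : y = ι (v t) := by
      by_contra hne
      obtain ⟨A, B, hA, hB, hyA, hvB, hAB⟩ := t2_separation hne
      have hm1 := hy (hA.mem_nhds hyA)
      have := mem_of_mem_nhdsWithin ht hm1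
      exact disjoint_left.mp hAB this hvB
    exact extendFrom_eq (hcl (hSI ht)) (hyt ▸ hy)
  refine ⟨U, ⟨hUc, ?_⟩, ?_⟩
  · filter_upwards [hSae] with t ht using (hUS t ht).symm
  obtain ⟨t₀, ht₀⟩ : S.Nonempty := by
    rw [← closure_nonempty_iff]; exact ⟨0, hcl h0⟩
  -- A continuous function that is constant on the dense set S is constant on [0,T]. This carries
  -- both identities from S to all times.
  have hconst : ∀ {Y : Type _} [NormedAddCommGroup Y] (p : ℝ → Y), ContinuousOn p (Icc 0 T) →
      (∀ t ∈ S, p t = p t₀) → ∀ t ∈ Icc 0 T, p t = p 0 := by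
    intro Y _ p hp hpS t ht
    have heq : EqOn p (fun _ ↦ p t₀) (Icc 0 T) :=
      Set.EqOn.of_subset_closure hpS hp continuousOn_const hSI hcl
    exact (heq ht).trans (heq h0).symm
  intro t ht
  have hi : IntegrableOn (fun τ ↦ inner ℝ (F τ) (v τ)) (Ioo 0 T) := integrable_inner_of_memLp hF hv
  constructor
  · have := hconst (fun t ↦ ‖U t‖ ^ 2 - 2 * ∫ τ in (0)..t, inner ℝ (F τ) (v τ))
      ((hUc.norm.pow 2).sub (continuousOn_const.mul (continuousOn_primitive_Icc hi))) ?_ t ht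
    · simp only [intervalIntegral.integral_same, mul_zero, sub_zero] at this
      linarith
    have hlt : ∀ a ∈ S, ∀ b ∈ S, a < b →
        ‖U b‖ ^ 2 - 2 * (∫ τ in (0)..b, inner ℝ (F τ) (v τ)) =
          ‖U a‖ ^ 2 - 2 * ∫ τ in (0)..a, inner ℝ (F τ) (v τ) := by
      intro a ha b hb hab
      have e1 := h2 a ha b hb hab
      rw [← intervalIntegral.integral_interval_sub_left
        (intervalIntegrable_of_integrableOn_Ioo hi h0 (hSI hb))
        (intervalIntegrable_of_integrableOn_Ioo hi h0 (hSI ha))] at e1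
      rw [hUS a ha, hUS b hb]
      linarith
    intro r hr
    rcases lt_trichotomy r t₀ with hrt | rfl | hrt
    · exact (hlt r hr t₀ ht₀ hrt).symm
    · rfl
    · exact hlt t₀ ht₀ r hr hrt
  · intro x
    have := hconst (fun t ↦ inner ℝ (U t) (ι x) - inner ℝ (∫ τ in (0)..t, F τ) x)
      ((hUc.inner continuousOn_const).sub
        ((continuousOn_primitive_Icc hFi).inner continuousOn_const)) ?_ t ht
    · simp only [intervalIntegral.integral_same, inner_zero_left, sub_zero] at this
      linarith
    have hS' : ∀ r ∈ S, inner ℝ (U r) (ι x) - inner ℝ (∫ τ in (0)..r, F τ) x = inner ℝ c x := by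
      intro r hr
      rw [hUS r hr, ← inner_gram, h1 r hr, inner_add_left]; ring
    intro r hr
    simp only [hS' r hr, hS' t₀ ht₀]

end LionsMagenes


/-! ### Representation of functionals on a range -/

/-- A bounded functional on the range of a linear map into a Hilbert space is represented by a
vector. -/
theorem exists_inner_eq_of_abs_le {Φ X : Type*} [AddCommGroup Φ] [Module ℝ Φ]
    [NormedAddCommGroup X] [InnerProductSpace ℝ X] [CompleteSpace X] (N : Φ →ₗ[ℝ] X)
    (ℓ : Φ →ₗ[ℝ] ℝ) {C : ℝ} (h : ∀ φ, |ℓ φ| ≤ C * ‖N φ‖) : ∃ w : X, ∀ φ, inner ℝ w (N φ) = ℓ φ := by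
  have hker : LinearMap.ker N ≤ LinearMap.ker ℓ := by
    intro φ hφ
    have := h φ
    rw [LinearMap.mem_ker.mp hφ, norm_zero, mul_zero] at this
    exact abs_nonpos_iff.mp this
  let f : LinearMap.range N →ₗ[ℝ] ℝ :=
    (LinearMap.ker N).liftQ ℓ hker ∘ₗ N.quotKerEquivRange.symm.toLinearMap
  have hf : ∀ φ, f ⟨N φ, LinearMap.mem_range_self N φ⟩ = ℓ φ := by
    intro φ
    have : N.quotKerEquivRange.symm ⟨N φ, LinearMap.mem_range_self N φ⟩ =
        (LinearMap.ker N).mkQ φ := LinearMap.quotKerEquivRange_symm_apply_image N φ _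
    simp [f, this]
  let fc : StrongDual ℝ (LinearMap.range N) := f.mkContinuous C (by
    rintro ⟨_, φ, rfl⟩
    rw [hf]
    exact h φ)
  -- The range of N need not be closed, so the functional is extended by Hahn–Banach before the
  -- Riesz theorem is applied.
  obtain ⟨g, hg, -⟩ := exists_extension_norm_eq (LinearMap.range N) fc
  refine ⟨(InnerProductSpace.toDual ℝ X).symm g, fun φ ↦ ?_⟩
  rw [InnerProductSpace.toDual_symm_apply]
  exact (hg ⟨N φ, LinearMap.mem_range_self N φ⟩).trans (hf φ)

/-! ### Measurability of time dependent bilinear forms -/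

section Measurability

variable {V : Type*} [NormedAddCommGroup V] [NormedSpace ℝ V] {α : Type*} [MeasurableSpace α]
  {μ : Measure α}

theorem aemeasurable_simpleFunc_apply {Z : Type*} (s : SimpleFunc α Z) {F : Z → α → ℝ}
    (hF : ∀ z, AEMeasurable (F z) μ) : AEMeasurable (fun t ↦ F (s t) t) μ := by
  classical
  have h : (fun t ↦ F (s t) t) = fun t ↦ ∑ z ∈ s.range, (s ⁻¹' {z}).indicator (F z) t := by
    ext t
    rw [Finset.sum_eq_single (s t)]
    · simp
    · intro z _ hz
      exact indicator_of_notMem (by simpa using hz.symm) _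
    · intro hn; exact absurd (s.mem_range_self t) hn
  rw [h]
  exact Finset.aemeasurable_fun_sum _ fun z _ ↦ (hF z).indicator (s.measurableSet_fiber z)

/-- Measurability of a weakly measurable family of bilinear forms along measurable arguments. -/
theorem aestronglyMeasurable_bilin {B : α → V →L[ℝ] V →L[ℝ] ℝ}
    (hB : ∀ u v, AEMeasurable (fun t ↦ B t u v) μ) {u v : α → V}
    (hu : AEStronglyMeasurable u μ) (hv : AEStronglyMeasurable v μ) :
    AEStronglyMeasurable (fun t ↦ B t (u t) (v t)) μ := by
  -- For simple functions as arguments only countably many fixed pairs of vectors occur, in fact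
  -- finitely many, and weak measurability suffices. The general case is a pointwise limit, by
  -- continuity of each B t.
  let su := hu.stronglyMeasurable_mk.approx
  let sv := hv.stronglyMeasurable_mk.approx
  refine aestronglyMeasurable_of_tendsto_ae atTop (f := fun k t ↦ B t (su k t) (sv k t))
    (fun k ↦ ?_) ?_
  · exact (aemeasurable_simpleFunc_apply ((su k).pair (sv k)) (F := fun z t ↦ B t z.1 z.2)
      fun z ↦ hB z.1 z.2).aestronglyMeasurable
  · filter_upwards [hu.ae_eq_mk, hv.ae_eq_mk] with t h1 h2
    rw [h1, h2]
    have hc : Continuous fun z : V × V ↦ B t z.1 z.2 :=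
      ((B t).continuous.comp continuous_fst).clm_apply continuous_snd
    exact (hc.tendsto (hu.mk u t, hv.mk v t)).comp
      ((hu.stronglyMeasurable_mk.tendsto_approx t).prodMk_nhds
        (hv.stronglyMeasurable_mk.tendsto_approx t))

end Measurability

/-! ### Operators on L²(0,T;V): bounded forms and the primitive -/

section TimeOperators

variable {V : Type*} [NormedAddCommGroup V] [InnerProductSpace ℝ V]

theorem integrable_bilin {α : Type*} [MeasurableSpace α] {μ : Measure α}
    {B : α → V →L[ℝ] V →L[ℝ] ℝ} {M : ℝ} (hM : ∀ t u v, |B t u v| ≤ M * ‖u‖ * ‖v‖)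
    (hB : ∀ u v, AEMeasurable (fun t ↦ B t u v) μ) {u v : α → V} (hu : MemLp u 2 μ)
    (hv : MemLp v 2 μ) : Integrable (fun t ↦ B t (u t) (v t)) μ := by
  have h1 : Integrable (fun t ↦ ‖u t‖ * ‖v t‖) μ := hu.norm.integrable_mul hv.norm
  refine (h1.const_mul M).mono' (aestronglyMeasurable_bilin hB hu.1 hv.1)
    (Eventually.of_forall fun t ↦ ?_)
  rw [Real.norm_eq_abs, ← mul_assoc]
  exact hM t _ _

/-- The operator on `L²(μ;V)` that represents a weakly measurable bounded family of bilinear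
forms. -/
theorem exists_operator_of_bilin [CompleteSpace V] {α : Type*} [MeasurableSpace α] {μ : Measure α}
    {B : α → V →L[ℝ] V →L[ℝ] ℝ} {M : ℝ} (hM : ∀ t u v, |B t u v| ≤ M * ‖u‖ * ‖v‖)
    (hB : ∀ u v, AEMeasurable (fun t ↦ B t u v) μ) :
    ∃ Q : Lp V 2 μ →L[ℝ] Lp V 2 μ, ∀ u v : Lp V 2 μ,
      inner ℝ (Q u) v = ∫ t, B t (u t) (v t) ∂μ := by
  have hint : ∀ u v : Lp V 2 μ, Integrable (fun t ↦ B t (u t) (v t)) μ := fun u v ↦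
    integrable_bilin hM hB (Lp.memLp u) (Lp.memLp v)
  let b : Lp V 2 μ →ₗ[ℝ] Lp V 2 μ →ₗ[ℝ] ℝ := LinearMap.mk₂ ℝ
    (fun u v ↦ ∫ t, B t (u t) (v t) ∂μ)
    (fun u u' v ↦ by
      rw [← integral_add (hint u v) (hint u' v)]
      refine integral_congr_ae ?_
      filter_upwards [Lp.coeFn_add u u'] with t h
      rw [h]; simp)
    (fun c u v ↦ by
      rw [smul_eq_mul, ← integral_const_mul]
      refine integral_congr_ae ?_
      filter_upwards [Lp.coeFn_smul c u] with t h
      rw [h]; simp)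
    (fun u v v' ↦ by
      rw [← integral_add (hint u v) (hint u v')]
      refine integral_congr_ae ?_
      filter_upwards [Lp.coeFn_add v v'] with t h
      rw [h]; simp)
    (fun c u v ↦ by
      rw [smul_eq_mul, ← integral_const_mul]
      refine integral_congr_ae ?_
      filter_upwards [Lp.coeFn_smul c v] with t h
      rw [h]; simp)
  have hbound : ∀ u v, ‖b u v‖ ≤ |M| * ‖u‖ * ‖v‖ := by
    intro u v
    have hn : Integrable (fun t ↦ ‖u t‖ * ‖v t‖) μ :=
      (Lp.memLp u).norm.integrable_mul (Lp.memLp v).norm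
    have h1 : ‖b u v‖ ≤ ∫ t, |M| * (‖u t‖ * ‖v t‖) ∂μ := by
      refine norm_integral_le_of_norm_le (hn.const_mul _) (Eventually.of_forall fun t ↦ ?_)
      rw [Real.norm_eq_abs, ← mul_assoc]
      refine (hM t _ _).trans ?_
      gcongr
      exact le_abs_self M
    refine h1.trans ?_
    rw [integral_const_mul, mul_assoc]
    gcongr
    -- Cauchy–Schwarz in time, as an inner product of the real functions ‖u‖ and ‖v‖ in L².
    have h2 := real_inner_le_norm ((Lp.memLp u).norm.toLp (fun t ↦ ‖u t‖))
      ((Lp.memLp v).norm.toLp (fun t ↦ ‖v t‖))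
    rw [inner_toLp, Lp.norm_toLp, Lp.norm_toLp, eLpNorm_norm, eLpNorm_norm] at h2
    simpa [Lp.norm_def, mul_comm] using h2
  refine ⟨InnerProductSpace.continuousLinearMapOfBilin (𝕜 := ℝ) (b.mkContinuous₂ |M| hbound),
    fun u v ↦ ?_⟩
  rw [InnerProductSpace.continuousLinearMapOfBilin_apply]
  rfl

variable {T : ℝ}

theorem integral_norm_le_sqrt_mul_norm (hT : 0 ≤ T) (w : Lp V 2 (timeMeasure T)) :
    ∫ τ in Ioo 0 T, ‖w τ‖ ≤ √T * ‖w‖ := by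
  have h2 := real_inner_le_norm ((Lp.memLp w).norm.toLp (fun t ↦ ‖w t‖))
    ((memLp_const (μ := timeMeasure T) (p := 2) (1 : ℝ)).toLp _)
  rw [inner_toLp, Lp.norm_toLp, Lp.norm_toLp, eLpNorm_norm] at h2
  rw [eLpNorm_const' _ (by norm_num) (by norm_num), Measure.restrict_apply_univ, Real.volume_Ioo,
    sub_zero, ENNReal.toReal_mul, ← ENNReal.toReal_rpow, ENNReal.toReal_ofReal hT] at h2
  simpa [Lp.norm_def, Real.sqrt_eq_rpow, mul_comm] using h2

theorem norm_primitive_le {w : ℝ → V} (hw : IntegrableOn w (Ioo 0 T)) {t : ℝ} (ht : t ∈ Icc 0 T) :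
    ‖∫ τ in (0)..t, w τ‖ ≤ ∫ τ in Ioo 0 T, ‖w τ‖ := by
  refine (intervalIntegral.norm_integral_le_integral_norm ht.1).trans ?_
  rw [← integral_Ioo_eq_interval ht.1]
  exact setIntegral_mono_set hw.norm (Eventually.of_forall fun _ ↦ norm_nonneg _)
    (Ioo_subset_Ioo_right ht.2).eventuallyLE

theorem memLp_time_of_continuousOn {Y : Type*} [NormedAddCommGroup Y] {f : ℝ → Y} {p : ℝ≥0∞}
    (hf : ContinuousOn f (Icc 0 T)) : MemLp f p (timeMeasure T) := by
  obtain ⟨C, hC⟩ := isCompact_Icc.exists_bound_of_continuousOn hf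
  refine MemLp.of_bound ((hf.mono Ioo_subset_Icc_self).aestronglyMeasurable measurableSet_Ioo) C ?_
  filter_upwards [ae_restrict_mem measurableSet_Ioo] with t ht using hC t (Ioo_subset_Icc_self ht)

theorem memLp_primitive (w : Lp V 2 (timeMeasure T)) :
    MemLp (fun t ↦ ∫ τ in (0)..t, w τ) 2 (timeMeasure T) :=
  memLp_time_of_continuousOn (continuousOn_primitive_Icc (memLp_time_integrableOn (Lp.memLp w)))

/-- The primitive `t ↦ ∫₀ᵗ w` as a bounded operator on `L²(0,T;V)`. -/
noncomputable def primitive (hT : 0 ≤ T) : Lp V 2 (timeMeasure T) →L[ℝ] Lp V 2 (timeMeasure T) :=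
  LinearMap.mkContinuous
    { toFun := fun w ↦ (memLp_primitive w).toLp _
      map_add' := fun w w' ↦ by
        rw [← MemLp.toLp_add]
        refine MemLp.toLp_congr _ _ ?_
        filter_upwards [ae_restrict_mem measurableSet_Ioo] with t ht
        have hsub : ∀ w : Lp V 2 (timeMeasure T), IntervalIntegrable w volume 0 t := fun w ↦
          intervalIntegrable_of_integrableOn_Ioo (memLp_time_integrableOn (Lp.memLp w))
            ⟨le_rfl, hT⟩ (Ioo_subset_Icc_self ht)
        rw [Pi.add_apply, ← intervalIntegral.integral_add (hsub w) (hsub w')]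
        rw [← integral_Ioo_eq_interval ht.1.le, ← integral_Ioo_eq_interval ht.1.le]
        exact integral_congr_ae (ae_restrict_of_ae_restrict_of_subset
          (Ioo_subset_Ioo_right ht.2.le) (Lp.coeFn_add w w'))
      map_smul' := fun c w ↦ by
        rw [RingHom.id_apply, ← MemLp.toLp_const_smul]
        refine MemLp.toLp_congr _ _ ?_
        filter_upwards [ae_restrict_mem measurableSet_Ioo] with t ht
        rw [Pi.smul_apply, ← intervalIntegral.integral_smul]
        rw [← integral_Ioo_eq_interval ht.1.le, ← integral_Ioo_eq_interval ht.1.le]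
        exact integral_congr_ae (ae_restrict_of_ae_restrict_of_subset
          (Ioo_subset_Ioo_right ht.2.le) (Lp.coeFn_smul c w)) }
    -- The primitive is bounded in V by √T ‖w‖ at every time; the other factor is the L² norm of the
    -- constant 1 on (0,T).
    ((measureUnivNNReal (timeMeasure T) : ℝ) ^ (2 : ℝ≥0∞).toReal⁻¹ * √T) (fun w ↦ by
      rw [mul_assoc]
      refine Lp.norm_le_of_ae_bound (by positivity) ?_
      filter_upwards [(memLp_primitive w).coeFn_toLp, ae_restrict_mem measurableSet_Ioo]
        with t h1 ht
      refine (congrArg norm h1).le.trans ?_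
      exact (norm_primitive_le (memLp_time_integrableOn (Lp.memLp w))
        (Ioo_subset_Icc_self ht)).trans (integral_norm_le_sqrt_mul_norm hT w))

theorem primitive_coeFn (hT : 0 ≤ T) (w : Lp V 2 (timeMeasure T)) :
    primitive hT w =ᵐ[timeMeasure T] fun t ↦ ∫ τ in (0)..t, w τ :=
  (memLp_primitive w).coeFn_toLp

end TimeOperators


/-! ### Weighted energy estimate for the adjoint problem -/

section Existence

variable {V H H₂ : Type*} [NormedAddCommGroup V] [InnerProductSpace ℝ V] [CompleteSpace V]
  [NormedAddCommGroup H] [InnerProductSpace ℝ H] [CompleteSpace H]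
  [NormedAddCommGroup H₂] [InnerProductSpace ℝ H₂] [CompleteSpace H₂]

/-- A continuous function as an element of `L²(0,T;V)`. -/
noncomputable def contToLp (V : Type*) [NormedAddCommGroup V] [InnerProductSpace ℝ V] (T : ℝ) :
    C(ℝ, V) →ₗ[ℝ] Lp V 2 (timeMeasure T) where
  toFun g := (memLp_time_of_continuousOn g.continuous.continuousOn).toLp g
  map_add' _ _ := rfl
  map_smul' _ _ := rfl

theorem contToLp_coeFn {T : ℝ} (g : C(ℝ, V)) : contToLp V T g =ᵐ[timeMeasure T] g :=
  (memLp_time_of_continuousOn g.continuous.continuousOn).coeFn_toLp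

/-- The primitive `t ↦ ∫ₜᵀ g` of a continuous function. -/
noncomputable def tailIntegral (V : Type*) [NormedAddCommGroup V] [InnerProductSpace ℝ V]
    [CompleteSpace V] (T : ℝ) : C(ℝ, V) →ₗ[ℝ] C(ℝ, V) where
  toFun g := ⟨fun t ↦ ∫ τ in t..T, g τ, by
    simp_rw [intervalIntegral.integral_symm T]
    exact (intervalIntegral.continuous_primitive
      (fun a b ↦ g.continuous.intervalIntegrable a b) T).neg⟩
  map_add' g g' := by
    ext t
    exact intervalIntegral.integral_add (g.continuous.intervalIntegrable _ _)
      (g'.continuous.intervalIntegrable _ _)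
  map_smul' c g := by
    ext t
    exact intervalIntegral.integral_smul _ _

theorem hasDerivAt_tailIntegral {T : ℝ} (g : C(ℝ, V)) (t : ℝ) :
    HasDerivAt (tailIntegral V T g) (-g t) t :=
  intervalIntegral.integral_hasDerivAt_left (g.continuous.intervalIntegrable _ _)
    (g.continuous.stronglyMeasurableAtFilter _ _) g.continuous.continuousAt

theorem tailIntegral_end {T : ℝ} (g : C(ℝ, V)) : tailIntegral V T g T = 0 :=
  intervalIntegral.integral_same

theorem inner_compLpL {α : Type*} [MeasurableSpace α] {μ : Measure α} (A : V →L[ℝ] V)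
    (u v : Lp V 2 μ) : inner ℝ (A.compLpL 2 μ u) v = ∫ t, inner ℝ (A (u t)) (v t) ∂μ := by
  rw [L2.inner_def]
  refine integral_congr_ae ?_
  filter_upwards [A.coeFn_compLpL u] with t h
  rw [h]

/-- The energy estimate for the weighted test function `exp(λ t) ψ(t)`, where `ψ(t) = ∫ₜᵀ g`. -/
theorem weighted_energy_le (ι : V →L[ℝ] H) (κ : V →L[ℝ] H₂) {C₀ M lam T : ℝ} (hT : 0 < T)
    (hC₀ : 0 < C₀) (hco : ∀ v, ‖v‖ ^ 2 ≤ C₀ * (‖κ v‖ ^ 2 + ‖ι v‖ ^ 2)) (hM : 0 ≤ M)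
    (hlam : 2 + (M + ‖ι‖) + (M + ‖ι‖) * C₀ ≤ lam) (g ψ z : ℝ → V) (hg : Continuous g)
    (hψ : ∀ t, HasDerivAt ψ (-g t) t) (hψT : ψ T = 0)
    (hz : ∀ t, HasDerivAt z (Real.exp (lam * t) • ψ t) t) (hz0 : z 0 = 0) (b : ℝ → ℝ)
    (hb : ∀ t, |b t| ≤ M * ‖z t‖ * ‖ι (ψ t)‖) (hbi : IntegrableOn b (Ioo 0 T)) :
    1 / 2 * ‖ι (ψ 0)‖ ^ 2 + C₀⁻¹ * ∫ t in Ioo 0 T, ‖ψ t‖ ^ 2 ≤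
      ∫ t in Ioo 0 T, (Real.exp (lam * t) * inner ℝ (ι (ψ t)) (ι (g t)) +
        Real.exp (lam * t) * ‖κ (ψ t)‖ ^ 2 + inner ℝ (κ (z t)) (κ (ψ t)) + b t) := by
  set m : ℝ → ℝ := fun t ↦ Real.exp (lam * t) with hm
  have hm0 : ∀ t, 0 < m t := fun t ↦ Real.exp_pos _
  have hψc : Continuous ψ := continuous_iff_continuousAt.mpr fun t ↦ (hψ t).continuousAt
  have hzc : Continuous z := continuous_iff_continuousAt.mpr fun t ↦ (hz t).continuousAt
  have hmc : Continuous m := by fun_prop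
  have hmi : Continuous fun t ↦ Real.exp (-(lam * t)) := by fun_prop
  -- Since ψ' = -g and ψ = exp(-λt) z', the first and third terms of the integrand are derivatives
  -- of weighted squares up to positive multiples of λ. The square ‖ι z‖² is added because ‖κ z‖²
  -- alone does not control ‖z‖²; it costs the cross term ⟨ι z, ι ψ⟩.
  set e : ℝ → ℝ := fun t ↦ -(1 / 2 * (m t * ‖ι (ψ t)‖ ^ 2)) +
    1 / 2 * (Real.exp (-(lam * t)) * (‖κ (z t)‖ ^ 2 + ‖ι (z t)‖ ^ 2)) with he
  set e' : ℝ → ℝ := fun t ↦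
    -(1 / 2 * (lam * m t * ‖ι (ψ t)‖ ^ 2 - 2 * m t * inner ℝ (ι (ψ t)) (ι (g t)))) +
    1 / 2 * (-lam * Real.exp (-(lam * t)) * (‖κ (z t)‖ ^ 2 + ‖ι (z t)‖ ^ 2) +
      2 * (inner ℝ (κ (z t)) (κ (ψ t)) + inner ℝ (ι (z t)) (ι (ψ t)))) with he'
  have hderiv : ∀ t, HasDerivAt e (e' t) t := by
    intro t
    have h1 : HasDerivAt (fun t ↦ lam * t) lam t := by simpa using (hasDerivAt_id t).const_mul lam
    have h2 := h1.exp
    have h3 := h1.neg.exp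
    have h4 := (ι.hasFDerivAt.comp_hasDerivAt t (hψ t)).norm_sq
    have h5 := (ι.hasFDerivAt.comp_hasDerivAt t (hz t)).norm_sq
    have h6 := (κ.hasFDerivAt.comp_hasDerivAt t (hz t)).norm_sq
    have h7 := ((h2.mul h4).const_mul (1 / 2)).neg.add ((h3.mul (h6.add h5)).const_mul (1 / 2))
    have hmm : Real.exp (-(lam * t)) * Real.exp (lam * t) = 1 := by
      rw [← Real.exp_add]; simp
    refine h7.congr_deriv ?_
    simp only [he', hm, Function.comp_apply, Pi.mul_apply, Pi.add_apply, Pi.neg_apply, map_smul,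
      map_neg, inner_neg_right, real_inner_smul_right]
    linear_combination (inner ℝ (κ (z t)) (κ (ψ t)) + inner ℝ (ι (z t)) (ι (ψ t))) * hmm
  have he'c : Continuous e' := by
    rw [he']
    fun_prop
  have hftc : ∫ t in (0)..T, e' t = e T - e 0 :=
    intervalIntegral.integral_eq_sub_of_hasDerivAt (fun t _ ↦ hderiv t) (he'c.intervalIntegrable _ _)
  have hends : 1 / 2 * ‖ι (ψ 0)‖ ^ 2 ≤ e T - e 0 := by
    simp only [he, hψT, hz0, hm, map_zero, norm_zero, mul_zero, Real.exp_zero]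
    have : 0 ≤ Real.exp (-(lam * T)) * (‖κ (z T)‖ ^ 2 + ‖ι (z T)‖ ^ 2) := by positivity
    linarith
  -- The gain λ/2 on both weighted squares absorbs the potential and the cross term, of total size
  -- M' ‖z‖ ‖ι ψ‖ with M' = M + ‖ι‖. In the lower bound for λ, the 2 pays for the term ‖ι ψ‖² of the
  -- coercivity, M' for half of Young's inequality, and M' C₀ for its other half, where ‖z‖² is
  -- bounded by coercivity.
  have hpt : ∀ t ∈ Ioo 0 T, e' t + C₀⁻¹ * ‖ψ t‖ ^ 2 ≤ m t * inner ℝ (ι (ψ t)) (ι (g t)) +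
        m t * ‖κ (ψ t)‖ ^ 2 + inner ℝ (κ (z t)) (κ (ψ t)) + b t := by
    intro t ht
    have hl0 : 0 ≤ lam := le_trans (by positivity) hlam
    have hm1 : 1 ≤ m t := Real.one_le_exp (mul_nonneg hl0 ht.1.le)
    set r := Real.exp (-(lam * t)) with hr
    have hr0 : 0 < r := Real.exp_pos _
    have hmr : r * m t = 1 := by simp only [hr, hm]; rw [← Real.exp_add]; simp
    have h1 : C₀⁻¹ * ‖ψ t‖ ^ 2 ≤ m t * (‖κ (ψ t)‖ ^ 2 + ‖ι (ψ t)‖ ^ 2) := by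
      rw [inv_mul_le_iff₀ hC₀]
      calc ‖ψ t‖ ^ 2 ≤ C₀ * (1 * (‖κ (ψ t)‖ ^ 2 + ‖ι (ψ t)‖ ^ 2)) := by rw [one_mul]; exact hco _
        _ ≤ _ := by gcongr
    have h2 : -(M * ‖z t‖ * ‖ι (ψ t)‖) ≤ b t := (abs_le.mp (hb t)).1
    have h3 : inner ℝ (ι (z t)) (ι (ψ t)) ≤ ‖ι‖ * ‖z t‖ * ‖ι (ψ t)‖ :=
      (real_inner_le_norm _ _).trans (by gcongr; exact ι.le_opNorm _)
    have h4 : ‖z t‖ * ‖ι (ψ t)‖ ≤ 1 / 2 * (r * ‖z t‖ ^ 2 + m t * ‖ι (ψ t)‖ ^ 2) := by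
      have h5 : 0 ≤ r * (‖z t‖ - m t * ‖ι (ψ t)‖) ^ 2 := by positivity
      have h6 : r * (‖z t‖ - m t * ‖ι (ψ t)‖) ^ 2 = r * ‖z t‖ ^ 2 -
          2 * (r * m t) * (‖z t‖ * ‖ι (ψ t)‖) + (r * m t) * (m t * ‖ι (ψ t)‖ ^ 2) := by ring
      rw [h6, hmr] at h5
      linarith
    have h7 : r * ‖z t‖ ^ 2 ≤ C₀ * (r * (‖κ (z t)‖ ^ 2 + ‖ι (z t)‖ ^ 2)) := by
      calc r * ‖z t‖ ^ 2 ≤ r * (C₀ * (‖κ (z t)‖ ^ 2 + ‖ι (z t)‖ ^ 2)) := by gcongr; exact hco _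
        _ = _ := by ring
    set M' := M + ‖ι‖ with hM'
    have hM'0 : 0 ≤ M' := by positivity
    have h8 : M' * (‖z t‖ * ‖ι (ψ t)‖) ≤ M' / 2 * (C₀ * (r * (‖κ (z t)‖ ^ 2 + ‖ι (z t)‖ ^ 2))) +
        M' / 2 * (m t * ‖ι (ψ t)‖ ^ 2) := by
      have := mul_le_mul_of_nonneg_left h4 hM'0
      have := mul_le_mul_of_nonneg_left h7 hM'0
      linarith
    have hMC : 0 ≤ M' * C₀ := by positivity
    have h9 : M' * C₀ * (r * (‖κ (z t)‖ ^ 2 + ‖ι (z t)‖ ^ 2)) ≤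
        lam * (r * (‖κ (z t)‖ ^ 2 + ‖ι (z t)‖ ^ 2)) := by
      gcongr; linarith
    have h10 : (2 + M') * (m t * ‖ι (ψ t)‖ ^ 2) ≤ lam * (m t * ‖ι (ψ t)‖ ^ 2) := by
      have := hm0 t
      gcongr; linarith
    have h11 : M' * (‖z t‖ * ‖ι (ψ t)‖) = M * ‖z t‖ * ‖ι (ψ t)‖ + ‖ι‖ * ‖z t‖ * ‖ι (ψ t)‖ := by
      rw [hM']; ring
    simp only [he', ← hr]
    linarith
  have hI1 : IntegrableOn (fun t ↦ e' t + C₀⁻¹ * ‖ψ t‖ ^ 2) (Ioo 0 T) :=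
    ((he'c.add (by fun_prop)).integrableOn_Icc).mono_set Ioo_subset_Icc_self
  have hI2 : IntegrableOn (fun t ↦ m t * inner ℝ (ι (ψ t)) (ι (g t)) +
        m t * ‖κ (ψ t)‖ ^ 2 + inner ℝ (κ (z t)) (κ (ψ t)) + b t) (Ioo 0 T) := by
    refine Integrable.add ?_ hbi
    have hc : Continuous fun t ↦ m t * inner ℝ (ι (ψ t)) (ι (g t)) +
        m t * ‖κ (ψ t)‖ ^ 2 + inner ℝ (κ (z t)) (κ (ψ t)) := by fun_prop
    exact hc.integrableOn_Icc.mono_set Ioo_subset_Icc_self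
  have hmono := setIntegral_mono_on hI1 hI2 measurableSet_Ioo hpt
  have hi1 : IntegrableOn e' (Ioo 0 T) := he'c.integrableOn_Icc.mono_set Ioo_subset_Icc_self
  have hi2 : IntegrableOn (fun t ↦ C₀⁻¹ * ‖ψ t‖ ^ 2) (Ioo 0 T) := by
    have hc : Continuous fun t ↦ C₀⁻¹ * ‖ψ t‖ ^ 2 := by fun_prop
    exact hc.integrableOn_Icc.mono_set Ioo_subset_Icc_self
  rw [integral_add hi1 hi2, integral_const_mul, integral_Ioo_eq_interval hT.le, hftc] at hmono
  linarith

end Existence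


/-! ### Existence of a variational solution -/

section Existence

variable {V H H₂ : Type*} [NormedAddCommGroup V] [InnerProductSpace ℝ V] [CompleteSpace V]
  [NormedAddCommGroup H] [InnerProductSpace ℝ H] [CompleteSpace H]
  [NormedAddCommGroup H₂] [InnerProductSpace ℝ H₂] [CompleteSpace H₂]

theorem inner_gram_compLpL_comm {W : Type*} [NormedAddCommGroup W] [InnerProductSpace ℝ W]
    [CompleteSpace W] {α : Type*} [MeasurableSpace α] {μ : Measure α} (ι : V →L[ℝ] W)
    (u v : Lp V 2 μ) :
    inner ℝ u ((gram ι).compLpL 2 μ v) = inner ℝ ((gram ι).compLpL 2 μ u) v := by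
  rw [real_inner_comm, inner_compLpL, inner_compLpL]
  congr 1
  ext t
  rw [inner_gram, inner_gram, real_inner_comm]

theorem primitive_contToLp {T : ℝ} (hT : 0 ≤ T) (φ : C(ℝ, V)) :
    primitive hT (contToLp V T φ) =ᵐ[timeMeasure T] fun t ↦ ∫ τ in (0)..t, φ τ := by
  filter_upwards [primitive_coeFn hT (contToLp V T φ), ae_restrict_mem measurableSet_Ioo] with t h ht
  rw [h, ← integral_Ioo_eq_interval ht.1.le, ← integral_Ioo_eq_interval ht.1.le]
  exact integral_congr_ae (ae_restrict_of_ae_restrict_of_subset (Ioo_subset_Ioo_right ht.2.le)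
    (contToLp_coeFn φ))

/-- A variational solution `w = ∂ₜu` of the damped wave equation, tested against all primitives
`ψ(t) = ∫ₜᵀ g` of continuous functions. -/
theorem exists_variational_solution (ι : V →L[ℝ] H) (κ : V →L[ℝ] H₂) {C₀ M T : ℝ} (hT : 0 < T)
    (hC₀ : 0 < C₀) (hco : ∀ v, ‖v‖ ^ 2 ≤ C₀ * (‖κ v‖ ^ 2 + ‖ι v‖ ^ 2)) (hM : 0 ≤ M)
    {Q : ℝ → V →L[ℝ] V →L[ℝ] ℝ} (hQ : ∀ t u v, |Q t u v| ≤ M * ‖u‖ * ‖ι v‖)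
    (hQm : ∀ u v, AEMeasurable (fun t ↦ Q t u v) (timeMeasure T))
    (QX : Lp V 2 (timeMeasure T) →L[ℝ] Lp V 2 (timeMeasure T))
    (hQX : ∀ u v, inner ℝ (QX u) v = ∫ t, Q t (u t) (v t) ∂timeMeasure T)
    (f : Lp V 2 (timeMeasure T)) (u₁ : H) :
    ∃ w : Lp V 2 (timeMeasure T), ∀ g : C(ℝ, V),
      inner ℝ w ((gram ι).compLpL 2 (timeMeasure T) (contToLp V T g)) =
        inner ℝ (f - (gram κ).compLpL 2 (timeMeasure T) w -
          (gram κ).compLpL 2 (timeMeasure T) (primitive hT.le w) - QX (primitive hT.le w))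
          (contToLp V T (tailIntegral V T g)) + inner ℝ u₁ (ι (tailIntegral V T g 0)) := by
  set K := (gram ι).compLpL 2 (timeMeasure T) with hK
  set A := (gram κ).compLpL 2 (timeMeasure T) with hA
  set J := primitive (V := V) hT.le with hJ
  let Ψ : C(ℝ, V) →ₗ[ℝ] Lp V 2 (timeMeasure T) := contToLp V T ∘ₗ tailIntegral V T
  -- N g is what w is paired with after all operators are moved to ψ = Ψ g. The time derivative
  -- contributes K g because -ψ' = g; its boundary term vanishes at T and at 0 gives the u₁ term of
  -- ℓ.
  let N : C(ℝ, V) →ₗ[ℝ] Lp V 2 (timeMeasure T) := K.toLinearMap ∘ₗ contToLp V T +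
    (A + J.adjoint ∘L (A + QX.adjoint)).toLinearMap ∘ₗ Ψ
  have hAs : ∀ u v, inner ℝ u (A v) = inner ℝ (A u) v := inner_gram_compLpL_comm κ
  have hN : ∀ w g, inner ℝ w (N g) = inner ℝ w (K (contToLp V T g)) + inner ℝ (A w) (Ψ g) +
      inner ℝ (A (J w)) (Ψ g) + inner ℝ (QX (J w)) (Ψ g) := by
    intro w g
    simp only [N, LinearMap.add_apply, LinearMap.comp_apply, ContinuousLinearMap.coe_coe,
      _root_.add_apply, ContinuousLinearMap.comp_apply, inner_add_right,
      ContinuousLinearMap.adjoint_inner_right]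
    rw [hAs, hAs]
    ring
  let ev : C(ℝ, V) →ₗ[ℝ] V :=
    { toFun := fun g ↦ tailIntegral V T g 0
      map_add' := fun g g' ↦ by rw [map_add]; rfl
      map_smul' := fun c g ↦ by rw [map_smul]; rfl }
  let ℓ : C(ℝ, V) →ₗ[ℝ] ℝ := (innerSL ℝ f).toLinearMap ∘ₗ Ψ +
    (innerSL ℝ u₁ ∘L ι).toLinearMap ∘ₗ ev
  have hℓ : ∀ g, ℓ g = inner ℝ f (Ψ g) + inner ℝ u₁ (ι (tailIntegral V T g 0)) := fun g ↦ rfl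
  set lam := 2 + (M + ‖ι‖) + (M + ‖ι‖) * C₀ with hlam
  set m := Real.exp (lam * T) with hm
  have hm0 : 0 < m := Real.exp_pos _
  have hlam0 : 0 ≤ lam := by positivity
  have hcoer : ∀ g : C(ℝ, V), 1 / 2 * ‖ι (tailIntegral V T g 0)‖ ^ 2 + C₀⁻¹ * ‖Ψ g‖ ^ 2 ≤
      m * ‖Ψ g‖ * ‖N g‖ := by
    intro g
    set ψ := tailIntegral V T g with hψ
    -- The pairing of φ = exp(λt) ψ with N g is exactly the integral in `weighted_energy_le`, with z
    -- = J φ.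
    let φ : C(ℝ, V) := ⟨fun t ↦ Real.exp (lam * t) • ψ t, by fun_prop⟩
    set z : ℝ → V := fun t ↦ ∫ τ in (0)..t, φ τ with hz
    have hzd : ∀ t, HasDerivAt z (φ t) t := fun t ↦
      intervalIntegral.integral_hasDerivAt_right (φ.continuous.intervalIntegrable _ _)
        (φ.continuous.stronglyMeasurableAtFilter _ _) φ.continuous.continuousAt
    have hzc : Continuous z := continuous_iff_continuousAt.mpr fun t ↦ (hzd t).continuousAt
    have hzJ : J (contToLp V T φ) =ᵐ[timeMeasure T] z := primitive_contToLp hT.le φ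
    have hQi : Integrable (fun t ↦ Q t (z t) (ψ t)) (timeMeasure T) :=
      integrable_bilin (M := M * ‖ι‖) (fun t u v ↦ (hQ t u v).trans (by
        calc M * ‖u‖ * ‖ι v‖ ≤ M * ‖u‖ * (‖ι‖ * ‖v‖) := by gcongr; exact ι.le_opNorm v
          _ = _ := by ring)) hQm (memLp_time_of_continuousOn hzc.continuousOn)
        (memLp_time_of_continuousOn ψ.continuous.continuousOn)
    have key := weighted_energy_le ι κ hT hC₀ hco hM hlam.ge g ψ z g.continuous
      (hasDerivAt_tailIntegral g) (tailIntegral_end g) hzd intervalIntegral.integral_same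
      (fun t ↦ Q t (z t) (ψ t)) (fun t ↦ hQ t _ _) hQi
    have hci : ∀ {p : ℝ → ℝ}, Continuous p → Integrable p (timeMeasure T) := fun hp ↦
      hp.integrableOn_Icc.mono_set Ioo_subset_Icc_self
    have hrhs : ∫ t in Ioo 0 T, (Real.exp (lam * t) * inner ℝ (ι (ψ t)) (ι (g t)) +
        Real.exp (lam * t) * ‖κ (ψ t)‖ ^ 2 + inner ℝ (κ (z t)) (κ (ψ t)) + Q t (z t) (ψ t)) =
        inner ℝ (contToLp V T φ) (N g) := by
      rw [integral_add (hci (by fun_prop)) hQi, integral_add (hci (by fun_prop)) (hci (by fun_prop)),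
        integral_add (hci (by fun_prop)) (hci (by fun_prop)), hN, hQX, real_inner_comm (K _) _,
        hK, hA, inner_compLpL, inner_compLpL, inner_compLpL]
      congr 1
      · congr 1
        · congr 1
          · refine integral_congr_ae ?_
            filter_upwards [contToLp_coeFn (T := T) φ, contToLp_coeFn (T := T) g] with t h1 h2
            rw [h1, h2, inner_gram, real_inner_comm]
            simp [φ, real_inner_smul_right]
          · refine integral_congr_ae ?_
            filter_upwards [contToLp_coeFn (T := T) φ, contToLp_coeFn (T := T) ψ] with t h1 h2
            rw [h1, show Ψ g t = ψ t from h2, inner_gram, ← real_inner_self_eq_norm_sq]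
            simp [φ, real_inner_smul_left]
        · refine integral_congr_ae ?_
          filter_upwards [hzJ, contToLp_coeFn (T := T) ψ] with t h1 h2
          rw [h1, show Ψ g t = ψ t from h2, inner_gram]
      · refine integral_congr_ae ?_
        filter_upwards [hzJ, contToLp_coeFn (T := T) ψ] with t h1 h2
        rw [h1, show Ψ g t = ψ t from h2]
    have hψn : ∫ t in Ioo 0 T, ‖ψ t‖ ^ 2 = ‖Ψ g‖ ^ 2 := by
      rw [← real_inner_self_eq_norm_sq, L2.inner_def]
      refine integral_congr_ae ?_
      filter_upwards [contToLp_coeFn (T := T) ψ] with t h2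
      rw [show Ψ g t = ψ t from h2, real_inner_self_eq_norm_sq]
    have hφn : ‖contToLp V T φ‖ ≤ m * ‖Ψ g‖ := by
      refine Lp.norm_le_mul_norm_of_ae_le_mul ?_
      filter_upwards [contToLp_coeFn (T := T) φ, contToLp_coeFn (T := T) ψ,
        ae_restrict_mem measurableSet_Ioo] with t h1 h2 ht
      rw [h1, show Ψ g t = ψ t from h2]
      simp only [φ, ContinuousMap.coe_mk, norm_smul, Real.norm_of_nonneg (Real.exp_pos _).le]
      gcongr
      exact Real.exp_le_exp.mpr (mul_le_mul_of_nonneg_left ht.2.le hlam0)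
    rw [hrhs, hψn] at key
    exact key.trans ((real_inner_le_norm _ _).trans (by gcongr))
  -- The constants come from `hcoer`: first ‖Ψ g‖ ≤ C₀ m ‖N g‖, then ‖ι ψ(0)‖² ≤ 2 C₀ m² ‖N g‖². The
  -- `+ 1` avoids the square root, as x ≤ (x + 1)² for x ≥ 0.
  obtain ⟨w, hw⟩ := exists_inner_eq_of_abs_le N ℓ
    (C := ‖f‖ * (C₀ * m) + ‖u₁‖ * (2 * C₀ * m ^ 2 + 1)) (by
    intro g
    have h1 := hcoer g
    set a := ‖Ψ g‖ with ha
    set b := ‖ι (tailIntegral V T g 0)‖ with hb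
    have ha0 : 0 ≤ a := norm_nonneg _
    have hb0 : 0 ≤ b := norm_nonneg _
    have hn0 : 0 ≤ ‖N g‖ := norm_nonneg _
    have h2 : a ≤ C₀ * m * ‖N g‖ := by
      rcases ha0.eq_or_lt with h | h
      · rw [← h]; positivity
      · have h3 : C₀⁻¹ * a ^ 2 ≤ m * a * ‖N g‖ := by nlinarith [sq_nonneg b]
        rw [inv_mul_le_iff₀ hC₀] at h3
        have h4 : a * a ≤ a * (C₀ * m * ‖N g‖) := by linarith
        exact le_of_mul_le_mul_left h4 h
    have h3 : b ≤ (2 * C₀ * m ^ 2 + 1) * ‖N g‖ := by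
      refine abs_le_of_sq_le_sq' ?_ (by positivity) |>.2
      have h4 : 0 ≤ C₀⁻¹ * a ^ 2 := by positivity
      have h5 : m * a * ‖N g‖ ≤ m * (C₀ * m * ‖N g‖) * ‖N g‖ := by gcongr
      have h6 : b ^ 2 ≤ (2 * C₀ * m ^ 2) * ‖N g‖ ^ 2 := by nlinarith
      have h7 : 0 ≤ 2 * C₀ * m ^ 2 := by positivity
      rw [mul_pow]
      refine h6.trans ?_
      gcongr
      nlinarith
    rw [hℓ]
    calc |inner ℝ f (Ψ g) + inner ℝ u₁ (ι (tailIntegral V T g 0))|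
        ≤ ‖f‖ * a + ‖u₁‖ * b := (abs_add_le _ _).trans
          (add_le_add (abs_real_inner_le_norm _ _) (abs_real_inner_le_norm _ _))
      _ ≤ ‖f‖ * (C₀ * m * ‖N g‖) + ‖u₁‖ * ((2 * C₀ * m ^ 2 + 1) * ‖N g‖) := by gcongr
      _ = _ := by ring)
  refine ⟨w, fun g ↦ ?_⟩
  have h1 := hw g
  rw [hN, hℓ] at h1
  change _ = inner ℝ _ (Ψ g) + _
  simp only [inner_sub_left]
  linarith

end Existence


/-! ### From variational to weak solutions with initial values -/

section Existence

variable {V H H₂ : Type*} [NormedAddCommGroup V] [InnerProductSpace ℝ V] [CompleteSpace V]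
  [NormedAddCommGroup H] [InnerProductSpace ℝ H] [CompleteSpace H]
  [NormedAddCommGroup H₂] [InnerProductSpace ℝ H₂] [CompleteSpace H₂]

/-- The test functions ∫ₜᵀ g include all η(t) x with η(T) = 0. Nothing is required at t = 0, which
is how the initial velocity is seen. -/
theorem tailIntegral_neg_deriv_smul {T : ℝ} {η : ℝ → ℝ} (hη : ContDiff ℝ 1 η) (hηT : η T = 0) (x : V)
    (t : ℝ) :
    tailIntegral V T ⟨fun t ↦ -deriv η t • x,
      ((hη.continuous_deriv le_rfl).neg).smul continuous_const⟩ t = η t • x := by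
  have h1 : ∫ τ in t..T, -deriv η τ = η t := by
    rw [intervalIntegral.integral_neg, intervalIntegral.integral_deriv_eq_sub
      (fun x _ ↦ hη.differentiable one_ne_zero x)
      ((hη.continuous_deriv le_rfl).intervalIntegrable _ _), hηT]
    ring
  change ∫ τ in t..T, -deriv η τ • x = _
  rw [intervalIntegral.integral_smul_const, h1]

/-- Variational solutions are weak solutions with the prescribed initial value. -/
theorem weak_of_variational (ι : V →L[ℝ] H) {T : ℝ} (hT : 0 < T)
    (hι : ∀ y : H, (∀ x, inner ℝ y (ι x) = 0) → y = 0) (w G : Lp V 2 (timeMeasure T)) (u₁ : H)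
    (h : ∀ g : C(ℝ, V), inner ℝ w ((gram ι).compLpL 2 (timeMeasure T) (contToLp V T g)) =
      inner ℝ G (contToLp V T (tailIntegral V T g)) + inner ℝ u₁ (ι (tailIntegral V T g 0))) :
    IsWeakTimeDeriv T (fun t ↦ gram ι (w t)) G ∧
      ∃ U, IsContinuousRep T (fun t ↦ ι (w t)) U ∧ U 0 = u₁ := by
  have hwi : IntegrableOn (fun t ↦ gram ι (w t)) (Ioo 0 T) :=
    (gram ι).integrable_comp (memLp_time_integrableOn (Lp.memLp w))
  have hGi : IntegrableOn G (Ioo 0 T) := memLp_time_integrableOn (Lp.memLp G)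
  have key : ∀ η : ℝ → ℝ, ContDiff ℝ 1 η → η T = 0 → ∀ x : V,
      -inner ℝ (∫ t in Ioo 0 T, deriv η t • gram ι (w t)) x =
        inner ℝ (∫ t in Ioo 0 T, η t • G t) x + η 0 * inner ℝ u₁ (ι x) := by
    intro η hη hηT x
    have hsm : ∀ {p : ℝ → ℝ} {f : ℝ → V}, Continuous p → IntegrableOn f (Ioo 0 T) →
        IntegrableOn (fun t ↦ p t • f t) (Ioo 0 T) := by
      intro p f hp hf
      rw [← integrableOn_Icc_iff_integrableOn_Ioo] at hf ⊢
      exact hf.continuousOn_smul hp.continuousOn isCompact_Icc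
    have h1 := h ⟨fun t ↦ -deriv η t • x,
      ((hη.continuous_deriv le_rfl).neg).smul continuous_const⟩
    rw [tailIntegral_neg_deriv_smul hη hηT, map_smul, real_inner_smul_right,
      inner_gram_compLpL_comm, inner_compLpL, L2.inner_def] at h1
    rw [real_inner_comm x, real_inner_comm x, ← integral_inner (hsm (hη.continuous_deriv le_rfl) hwi),
      ← integral_inner (hsm hη.continuous hGi), ← integral_neg]
    refine (integral_congr_ae ?_).trans (h1.trans (congrArg (· + _) (integral_congr_ae ?_)))
    · filter_upwards [contToLp_coeFn (T := T) (⟨fun t ↦ -deriv η t • x,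
        ((hη.continuous_deriv le_rfl).neg).smul continuous_const⟩ : C(ℝ, V))] with t h2
      rw [h2]
      simp [real_inner_smul_right, real_inner_smul_left, real_inner_comm]
    · filter_upwards [contToLp_coeFn (T := T) (tailIntegral V T ⟨fun t ↦ -deriv η t • x,
        ((hη.continuous_deriv le_rfl).neg).smul continuous_const⟩)] with t h2
      rw [h2, tailIntegral_neg_deriv_smul hη hηT]
      simp [real_inner_smul_right, real_inner_smul_left, real_inner_comm]
  have hweak : IsWeakTimeDeriv T (fun t ↦ gram ι (w t)) G := by
    intro η hη
    refine ext_inner_right ℝ fun x ↦ ?_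
    have h1 := key η (hη.1.of_le (mod_cast le_top)) (hη.eq_zero (by simp)) x
    rw [hη.eq_zero (t := 0) (by simp), zero_mul, add_zero] at h1
    rw [inner_neg_left, ← h1, neg_neg]
  refine ⟨hweak, ?_⟩
  obtain ⟨U, hU, hUeq⟩ := exists_continuousRep_of_isWeakTimeDeriv ι hT (Lp.memLp w) (Lp.memLp G) hweak
  refine ⟨U, hU, ?_⟩
  obtain ⟨c, hc⟩ := hweak.exists_ae_eq_primitive hT hwi hGi
  -- The function T - t vanishes at T but not at 0. Inserting it in `key` and integrating ι†ι w = c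
  -- + ∫₀ᵗ G by parts leaves T (⟨c, x⟩ - ⟨u₁, ι x⟩) = 0, and ⟨c, x⟩ = ⟨U 0, ι x⟩. Density of ι(V) in
  -- H then gives U 0 = u₁.
  have hη : ContDiff ℝ 1 (fun t : ℝ ↦ T - t) := contDiff_const.sub contDiff_id
  rw [← sub_eq_zero]
  refine hι _ fun x ↦ ?_
  rw [inner_sub_left]
  have h1 : inner ℝ (U 0) (ι x) = inner ℝ c x := by
    have hne : (ae (timeMeasure T)).NeBot := by
      rw [ae_neBot, Ne, Measure.restrict_eq_zero, Real.volume_Ioo]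
      simpa using hT
    obtain ⟨t, ht1, ht2, ht3⟩ := (hc.and (hU.2.and (ae_restrict_mem measurableSet_Ioo))).exists
    have h2 := (hUeq t (Ioo_subset_Icc_self ht3)).2 x
    rw [← ht2, ← inner_gram, ht1, inner_add_left] at h2
    linarith
  have h2 := key _ hη (sub_self T) x
  have h3 : ∫ t in Ioo 0 T, deriv (fun t : ℝ ↦ T - t) t • gram ι (w t) =
      ∫ t in Ioo 0 T, deriv (fun t : ℝ ↦ T - t) t • (c + ∫ τ in (0)..t, G τ) := by
    refine integral_congr_ae ?_
    filter_upwards [hc] with t ht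
    rw [ht]
  rw [h3, integral_deriv_smul_primitive hT hη hGi] at h2
  simp only [sub_self, zero_smul, sub_zero, zero_sub, inner_sub_left, inner_neg_left,
    real_inner_smul_left] at h2
  have h4 : T * (inner ℝ c x - inner ℝ u₁ (ι x)) = 0 := by linarith
  rw [h1]
  exact (mul_eq_zero.mp h4).resolve_left hT.ne'

/-- Writing u = u₀ + ∫₀ᵗ w moves the constant function u₀ to the right hand side as the source -κ†κ
u₀ - QX u₀, which reduces the problem to zero initial displacement. -/
theorem exists_weak_solution (ι : V →L[ℝ] H) (κ : V →L[ℝ] H₂) {C₀ M T : ℝ} (hT : 0 < T)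
    (hC₀ : 0 < C₀) (hco : ∀ v, ‖v‖ ^ 2 ≤ C₀ * (‖κ v‖ ^ 2 + ‖ι v‖ ^ 2)) (hM : 0 ≤ M)
    (hι : ∀ y : H, (∀ x, inner ℝ y (ι x) = 0) → y = 0)
    {Q : ℝ → V →L[ℝ] V →L[ℝ] ℝ} (hQ : ∀ t u v, |Q t u v| ≤ M * ‖u‖ * ‖ι v‖)
    (hQm : ∀ u v, AEMeasurable (fun t ↦ Q t u v) (timeMeasure T))
    (QX : Lp V 2 (timeMeasure T) →L[ℝ] Lp V 2 (timeMeasure T))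
    (hQX : ∀ u v, inner ℝ (QX u) v = ∫ t, Q t (u t) (v t) ∂timeMeasure T)
    (f : Lp V 2 (timeMeasure T)) (u₀ : V) (u₁ : H) :
    ∃ u w : Lp V 2 (timeMeasure T), IsWeakTimeDeriv T u w ∧
      IsWeakTimeDeriv T (fun t ↦ gram ι (w t))
        (f - (gram κ).compLpL 2 (timeMeasure T) w - (gram κ).compLpL 2 (timeMeasure T) u - QX u :
          Lp V 2 (timeMeasure T)) ∧
      (∃ U, IsContinuousRep T u U ∧ U 0 = u₀) ∧
      ∃ U, IsContinuousRep T (fun t ↦ ι (w t)) U ∧ U 0 = u₁ := by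
  set A := (gram κ).compLpL 2 (timeMeasure T) with hA
  let c₀ : Lp V 2 (timeMeasure T) := (memLp_const u₀).toLp _
  obtain ⟨w, hw⟩ := exists_variational_solution ι κ hT hC₀ hco hM hQ hQm QX hQX
    (f - A c₀ - QX c₀) u₁
  have hwi : IntegrableOn w (Ioo 0 T) := memLp_time_integrableOn (Lp.memLp w)
  have hu : (c₀ + primitive hT.le w : Lp V 2 (timeMeasure T)) =ᵐ[timeMeasure T]
      fun t ↦ u₀ + ∫ τ in (0)..t, w τ := by
    filter_upwards [Lp.coeFn_add c₀ (primitive hT.le w), primitive_coeFn hT.le w,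
      (memLp_const (μ := timeMeasure T) (p := 2) u₀).coeFn_toLp] with t h1 h2 h3
    rw [h1, Pi.add_apply, h2]
    exact congrArg (· + _) h3
  have hG : f - A c₀ - QX c₀ - A w - A (primitive hT.le w) - QX (primitive hT.le w) =
      f - A w - A (c₀ + primitive hT.le w) - QX (c₀ + primitive hT.le w) := by
    rw [map_add, map_add]; abel
  rw [← hA] at hw
  simp only [hG] at hw
  obtain ⟨h1, h2⟩ := weak_of_variational ι hT hι w _ u₁ hw
  refine ⟨c₀ + primitive hT.le w, w, isWeakTimeDeriv_of_ae_eq_primitive hT hwi hu, h1,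
    ⟨fun t ↦ u₀ + ∫ τ in (0)..t, w τ, ⟨continuousOn_const.add (continuousOn_primitive_Icc hwi), hu⟩,
      by simp⟩, h2⟩

end Existence


/-! ### Gronwall's lemma, energy identity and a priori estimate -/

theorem le_mul_exp_of_le_integral {y : ℝ → ℝ} {a b T : ℝ} (hb : 0 ≤ b)
    (hy : ContinuousOn y (Icc 0 T)) (h : ∀ t ∈ Icc 0 T, y t ≤ a + b * ∫ τ in (0)..t, y τ) :
    ∀ t ∈ Icc 0 T, y t ≤ a * Real.exp (b * t) := by
  intro t ht
  have hT : 0 ≤ T := ht.1.trans ht.2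
  have hyi : IntegrableOn y (Ioo 0 T) := hy.integrableOn_Icc.mono_set Ioo_subset_Icc_self
  -- The derivative is -b exp(-bt) (a + b ∫₀ᵗ y - y(t)), which is nonpositive by the hypothesis.
  have hanti : AntitoneOn (fun t ↦ Real.exp (-(b * t)) * (a + b * ∫ τ in (0)..t, y τ)) (Icc 0 T) := by
    refine antitoneOn_of_hasDerivWithinAt_nonpos (convex_Icc 0 T)
      (f' := fun t ↦ Real.exp (-(b * t)) * -b * (a + b * ∫ τ in (0)..t, y τ) +
        Real.exp (-(b * t)) * (b * y t)) ?_ ?_ ?_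
    · exact ContinuousOn.mul (by fun_prop)
        (continuousOn_const.add (continuousOn_const.mul (continuousOn_primitive_Icc hyi)))
    · intro x hx
      rw [interior_Icc] at hx
      have h1 : HasDerivAt (fun t ↦ -(b * t)) (-b) x :=
        ((hasDerivAt_id x).const_mul b).neg.congr_deriv (by simp)
      have h2 : HasDerivAt (fun t ↦ ∫ τ in (0)..t, y τ) (y x) x := by
        refine intervalIntegral.integral_hasDerivAt_right
          (intervalIntegrable_of_integrableOn_Ioo hyi ⟨le_rfl, hT⟩ (Ioo_subset_Icc_self hx)) ?_
          (hy.continuousAt (Icc_mem_nhds hx.1 hx.2))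
        exact ContinuousOn.stronglyMeasurableAtFilter isOpen_Ioo (hy.mono Ioo_subset_Icc_self) x hx
      exact (h1.exp.mul ((h2.const_mul b).const_add a)).hasDerivWithinAt
    · intro x hx
      rw [interior_Icc] at hx
      have h3 := h x (Ioo_subset_Icc_self hx)
      have h4 : Real.exp (-(b * x)) * -b * (a + b * ∫ τ in (0)..x, y τ) +
        Real.exp (-(b * x)) * (b * y x) =
          -(Real.exp (-(b * x)) * b * ((a + b * ∫ τ in (0)..x, y τ) - y x)) := by ring
      rw [h4, neg_nonpos]
      have := sub_nonneg.mpr h3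
      positivity
  have h5 := hanti ⟨le_rfl, hT⟩ ht ht.1
  simp only [mul_zero, neg_zero, Real.exp_zero, intervalIntegral.integral_same, add_zero, one_mul]
    at h5
  refine (h t ht).trans ?_
  rw [Real.exp_neg, inv_mul_le_iff₀ (Real.exp_pos _)] at h5
  linarith

section Energy

variable {V H H₂ : Type*} [NormedAddCommGroup V] [InnerProductSpace ℝ V] [CompleteSpace V]
  [NormedAddCommGroup H] [InnerProductSpace ℝ H] [CompleteSpace H]
  [NormedAddCommGroup H₂] [InnerProductSpace ℝ H₂] [CompleteSpace H₂]

omit [CompleteSpace V] in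
-- Replacing v by its restriction to a measurable set of times gives equality of the integrals over
-- every such set, hence equality almost everywhere.
theorem operator_ae_eq_bilin {α : Type*} [MeasurableSpace α] {μ : Measure α}
    {B : α → V →L[ℝ] V →L[ℝ] ℝ} {M : ℝ} (hM : ∀ t u v, |B t u v| ≤ M * ‖u‖ * ‖v‖)
    (hB : ∀ u v, AEMeasurable (fun t ↦ B t u v) μ) (QX : Lp V 2 μ →L[ℝ] Lp V 2 μ)
    (hQX : ∀ u v, inner ℝ (QX u) v = ∫ t, B t (u t) (v t) ∂μ) (u v : Lp V 2 μ) :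
    ∀ᵐ t ∂μ, inner ℝ (QX u t) (v t) = B t (u t) (v t) := by
  refine Integrable.ae_eq_of_forall_setIntegral_eq _ _
    (integrable_inner_of_memLp (Lp.memLp _) (Lp.memLp _))
    (integrable_bilin hM hB (Lp.memLp u) (Lp.memLp v)) fun s hs _ ↦ ?_
  have h1 := hQX u (((Lp.memLp v).indicator hs).toLp _)
  rw [L2.inner_def] at h1
  rw [← integral_indicator hs, ← integral_indicator hs]
  convert h1 using 1
  · refine integral_congr_ae ?_
    filter_upwards [((Lp.memLp v).indicator hs).coeFn_toLp] with t ht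
    rw [ht]
    by_cases hts : t ∈ s <;> simp [hts]
  · refine integral_congr_ae ?_
    filter_upwards [((Lp.memLp v).indicator hs).coeFn_toLp] with t ht
    rw [ht]
    by_cases hts : t ∈ s <;> simp [hts]

theorem IsWeakTimeDeriv.clm_comp {X Y : Type*} [NormedAddCommGroup X] [NormedSpace ℝ X]
    [CompleteSpace X] [NormedAddCommGroup Y] [NormedSpace ℝ Y] [CompleteSpace Y] (A : X →L[ℝ] Y)
    {T : ℝ} {u w : ℝ → X} (hu : IntegrableOn u (Ioo 0 T)) (hw : IntegrableOn w (Ioo 0 T))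
    (h : IsWeakTimeDeriv T u w) : IsWeakTimeDeriv T (fun t ↦ A (u t)) (fun t ↦ A (w t)) := by
  intro η hη
  have hd : IntegrableOn (fun t ↦ deriv η t • u t) (Ioo 0 T) := by
    rw [← integrableOn_Icc_iff_integrableOn_Ioo] at hu ⊢
    exact hu.continuousOn_smul ((hη.1.continuous_deriv (by simp)).continuousOn) isCompact_Icc
  have h1 := congrArg A (h η hη)
  rw [map_neg, ← A.integral_comp_comm hd, ← A.integral_comp_comm (hη.integrableOn_smul hw)] at h1
  simpa only [map_smul] using h1

/-- Energy balance of a function that is continuous in `V`, for any quadratic form `‖κ v‖²`. -/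
theorem sq_norm_rep_eq (κ : V →L[ℝ] H₂) {T : ℝ} (hT : 0 < T) {u w : Lp V 2 (timeMeasure T)}
    (h : IsWeakTimeDeriv T u w) {U : ℝ → V} (hU : IsContinuousRep T u U) {t : ℝ}
    (ht : t ∈ Icc 0 T) :
    ‖κ (U t)‖ ^ 2 = ‖κ (U 0)‖ ^ 2 + 2 * ∫ τ in (0)..t, inner ℝ (κ (u τ)) (κ (w τ)) := by
  -- Here κ plays the role of ι: since ∂ₜu = w holds in V, the function κ†κ u has derivative κ†κ w
  -- in L²(0,T;V), so the continuity theorem applies to u.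
  have hA := h.clm_comp (gram κ) (memLp_time_integrableOn (Lp.memLp u))
    (memLp_time_integrableOn (Lp.memLp w))
  obtain ⟨U', hU', hid⟩ := exists_continuousRep_of_isWeakTimeDeriv κ hT (Lp.memLp u)
    ((gram κ).comp_memLp' (Lp.memLp w)) hA
  have hκU : IsContinuousRep T (fun t ↦ κ (u t)) (fun t ↦ κ (U t)) :=
    ⟨κ.continuous.comp_continuousOn hU.1, hU.2.mono fun t ht ↦ congrArg κ ht⟩
  have heq := hU'.eqOn hT hκU
  have h1 := (hid t ht).1
  rw [heq ht, heq ⟨le_rfl, hT.le⟩] at h1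
  have hc : ∀ τ, inner ℝ (gram κ (w τ)) (u τ) = inner ℝ (κ (u τ)) (κ (w τ)) := fun τ ↦ by
    rw [inner_gram, real_inner_comm]
  rw [h1]
  simp only [Function.comp_apply, hc]

/-- The energy identity for weak solutions. -/
theorem weak_energy_identity (ι : V →L[ℝ] H) (κ : V →L[ℝ] H₂) {T : ℝ} (hT : 0 < T)
    {u w f R : Lp V 2 (timeMeasure T)} (h1 : IsWeakTimeDeriv T u w)
    (h2 : IsWeakTimeDeriv T (fun t ↦ gram ι (w t))
      (f - (gram κ).compLpL 2 (timeMeasure T) w - (gram κ).compLpL 2 (timeMeasure T) u - R :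
          Lp V 2 (timeMeasure T)))
    {U : ℝ → V} {U₁ : ℝ → H} (hU : IsContinuousRep T u U)
    (hU₁ : IsContinuousRep T (fun t ↦ ι (w t)) U₁) {t : ℝ} (ht : t ∈ Icc 0 T) :
    ‖U₁ t‖ ^ 2 + ‖κ (U t)‖ ^ 2 + 2 * ∫ τ in (0)..t, ‖κ (w τ)‖ ^ 2 =
      ‖U₁ 0‖ ^ 2 + ‖κ (U 0)‖ ^ 2 + 2 * (∫ τ in (0)..t, inner ℝ (f τ) (w τ)) -
        2 * ∫ τ in (0)..t, inner ℝ (R τ) (w τ) := by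
  -- The term ⟨κ u, κ w⟩ has opposite signs in the balances of ‖κ u‖² and of ‖ι w‖²; their sum is
  -- the energy identity.
  have e1 := sq_norm_rep_eq κ hT h1 hU ht
  obtain ⟨U', hU', hid⟩ := exists_continuousRep_of_isWeakTimeDeriv ι hT (Lp.memLp w) (Lp.memLp _) h2
  have heq := hU'.eqOn hT hU₁
  have e2 := (hid t ht).1
  rw [heq ht, heq ⟨le_rfl, hT.le⟩] at e2
  have hii : ∀ {p : ℝ → ℝ}, Integrable p (timeMeasure T) → IntervalIntegrable p volume 0 t :=
    fun hp ↦ intervalIntegrable_of_integrableOn_Ioo hp ⟨le_rfl, hT.le⟩ ht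
  have hκ : ∀ v : Lp V 2 (timeMeasure T), MemLp (fun t ↦ κ (v t)) 2 (timeMeasure T) := fun v ↦
    κ.comp_memLp' (Lp.memLp v)
  have i1 := hii (integrable_inner_of_memLp (Lp.memLp f) (Lp.memLp w))
  have i2 := hii ((memLp_two_iff_integrable_sq_norm (hκ w).1).mp (hκ w))
  have i3 := hii (integrable_inner_of_memLp (hκ u) (hκ w))
  have i4 := hii (integrable_inner_of_memLp (Lp.memLp R) (Lp.memLp w))
  have e3 : ∫ τ in (0)..t, inner ℝ ((f - (gram κ).compLpL 2 (timeMeasure T) w -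
      (gram κ).compLpL 2 (timeMeasure T) u - R : Lp V 2 (timeMeasure T)) τ) (w τ) =
      ∫ τ in (0)..t, (inner ℝ (f τ) (w τ) - ‖κ (w τ)‖ ^ 2 - inner ℝ (κ (u τ)) (κ (w τ)) -
        inner ℝ (R τ) (w τ)) := by
    rw [← integral_Ioo_eq_interval ht.1, ← integral_Ioo_eq_interval ht.1]
    refine integral_congr_ae (ae_restrict_of_ae_restrict_of_subset (Ioo_subset_Ioo_right ht.2) ?_)
    filter_upwards [Lp.coeFn_sub (f - (gram κ).compLpL 2 (timeMeasure T) w -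
      (gram κ).compLpL 2 (timeMeasure T) u) R, Lp.coeFn_sub (f - (gram κ).compLpL 2 (timeMeasure T) w)
      ((gram κ).compLpL 2 (timeMeasure T) u), Lp.coeFn_sub f ((gram κ).compLpL 2 (timeMeasure T) w),
      (gram κ).coeFn_compLpL w, (gram κ).coeFn_compLpL u] with τ a1 a2 a3 a4 a5
    rw [a1, Pi.sub_apply, a2, Pi.sub_apply, a3, Pi.sub_apply, a4, a5]
    simp only [inner_sub_left, inner_gram, real_inner_self_eq_norm_sq]
  rw [e3, intervalIntegral.integral_sub ((i1.sub i2).sub i3) i4,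
    intervalIntegral.integral_sub (i1.sub i2) i3, intervalIntegral.integral_sub i1 i2] at e2
  linarith

omit [CompleteSpace V] in
theorem integral_sq_norm_eq {α : Type*} [MeasurableSpace α] {μ : Measure α} (g : Lp V 2 μ) :
    ∫ t, ‖g t‖ ^ 2 ∂μ = ‖g‖ ^ 2 := by
  rw [← real_inner_self_eq_norm_sq, L2.inner_def]
  simp only [real_inner_self_eq_norm_sq]

/-- The integral inequality for the energy, ready for the Gronwall lemma. -/
theorem energy_le_integral_energy (ι : V →L[ℝ] H) (κ : V →L[ℝ] H₂) {C₀ M T : ℝ} (hT : 0 < T)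
    (hC₀ : 0 < C₀) (hco : ∀ v, ‖v‖ ^ 2 ≤ C₀ * (‖κ v‖ ^ 2 + ‖ι v‖ ^ 2))
    {u w f R : Lp V 2 (timeMeasure T)} (h1 : IsWeakTimeDeriv T u w)
    (h2 : IsWeakTimeDeriv T (fun t ↦ gram ι (w t))
      (f - (gram κ).compLpL 2 (timeMeasure T) w - (gram κ).compLpL 2 (timeMeasure T) u - R :
          Lp V 2 (timeMeasure T)))
    (hR : ∀ᵐ t ∂timeMeasure T, |inner ℝ (R t) (w t)| ≤ M * ‖u t‖ * ‖ι (w t)‖)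
    {U : ℝ → V} {U₁ : ℝ → H} (hU : IsContinuousRep T u U)
    (hU₁ : IsContinuousRep T (fun t ↦ ι (w t)) U₁) {t : ℝ} (ht : t ∈ Icc 0 T) :
    ‖U₁ t‖ ^ 2 + ‖κ (U t)‖ ^ 2 + ‖ι (U t)‖ ^ 2 + ∫ τ in (0)..t, ‖κ (w τ)‖ ^ 2 ≤
      ‖U₁ 0‖ ^ 2 + ‖κ (U 0)‖ ^ 2 + ‖ι (U 0)‖ ^ 2 + C₀ * ‖f‖ ^ 2 + (M ^ 2 * C₀ + 3) *
        ∫ τ in (0)..t, (‖U₁ τ‖ ^ 2 + ‖κ (U τ)‖ ^ 2 + ‖ι (U τ)‖ ^ 2) := by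
  -- The energy is augmented by ‖ι U‖² so that it controls ‖U‖². The 3 counts the terms ‖U₁‖² from
  -- the Young inequalities for the source, the potential and the extra term ⟨ι u, ι w⟩; M² C₀ comes
  -- from bounding ‖U‖² by coercivity.
  set C₁ := M ^ 2 * C₀ + 3 with hC₁
  set y : ℝ → ℝ := fun t ↦ ‖U₁ t‖ ^ 2 + ‖κ (U t)‖ ^ 2 + ‖ι (U t)‖ ^ 2 with hy
  have hyc : ContinuousOn y (Icc 0 T) :=
    ((hU₁.1.norm.pow 2).add ((κ.continuous.comp_continuousOn hU.1).norm.pow 2)).add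
      ((ι.continuous.comp_continuousOn hU.1).norm.pow 2)
  have hyi : IntegrableOn y (Ioo 0 T) := hyc.integrableOn_Icc.mono_set Ioo_subset_Icc_self
  have hκw : MemLp (fun t ↦ κ (w t)) 2 (timeMeasure T) := κ.comp_memLp' (Lp.memLp w)
  have iw : IntegrableOn (fun t ↦ ‖κ (w t)‖ ^ 2) (Ioo 0 T) :=
    (memLp_two_iff_integrable_sq_norm hκw.1).mp hκw
  have if2 : IntegrableOn (fun t ↦ ‖f t‖ ^ 2) (Ioo 0 T) :=
    (memLp_two_iff_integrable_sq_norm (Lp.memLp f).1).mp (Lp.memLp f)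
  have e1 := weak_energy_identity ι κ hT h1 h2 hU hU₁ ht
  have e2 := sq_norm_rep_eq ι hT h1 hU ht
  have hii : ∀ {p : ℝ → ℝ}, Integrable p (timeMeasure T) → IntervalIntegrable p volume 0 t :=
    fun hp ↦ intervalIntegrable_of_integrableOn_Ioo hp ⟨le_rfl, hT.le⟩ ht
  have hι : ∀ v : Lp V 2 (timeMeasure T), MemLp (fun t ↦ ι (v t)) 2 (timeMeasure T) := fun v ↦
    ι.comp_memLp' (Lp.memLp v)
  have i1 := hii (integrable_inner_of_memLp (Lp.memLp f) (Lp.memLp w))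
  have i3 := hii (integrable_inner_of_memLp (hι u) (hι w))
  have i4 := hii (integrable_inner_of_memLp (Lp.memLp R) (Lp.memLp w))
  -- Half of the dissipation 2 ‖κ w‖² absorbs the source: 2 ⟨f, w⟩ ≤ C₀ ‖f‖² + C₀⁻¹ ‖w‖², and
  -- coercivity bounds the last term by ‖κ w‖² + ‖U₁‖².
  have e3 : ∫ τ in (0)..t, (2 * inner ℝ (f τ) (w τ) - 2 * inner ℝ (R τ) (w τ) +
      2 * inner ℝ (ι (u τ)) (ι (w τ))) ≤
      ∫ τ in (0)..t, (C₀ * ‖f τ‖ ^ 2 + ‖κ (w τ)‖ ^ 2 + C₁ * y τ) := by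
    refine intervalIntegral.integral_mono_ae_restrict ht.1
      (((i1.const_mul 2).sub (i4.const_mul 2)).add (i3.const_mul 2))
      ((((hii if2).const_mul C₀).add (hii iw)).add ((hii hyi).const_mul C₁)) ?_
    rw [← Measure.restrict_congr_set Ioo_ae_eq_Icc]
    refine ae_restrict_of_ae_restrict_of_subset (Ioo_subset_Ioo_right ht.2) ?_
    filter_upwards [hR, hU.2, hU₁.2] with τ b1 b2 b3
    rw [b2]
    rw [b2, b3] at b1
    rw [b3]
    have c1 : inner ℝ (f τ) (w τ) ≤ ‖f τ‖ * ‖w τ‖ := real_inner_le_norm _ _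
    have c2 : ‖w τ‖ ^ 2 ≤ C₀ * (‖κ (w τ)‖ ^ 2 + ‖U₁ τ‖ ^ 2) := b3 ▸ hco (w τ)
    have c3 : 2 * (‖f τ‖ * ‖w τ‖) ≤ C₀ * ‖f τ‖ ^ 2 + C₀⁻¹ * ‖w τ‖ ^ 2 := by
      have : 0 ≤ C₀⁻¹ * (C₀ * ‖f τ‖ - ‖w τ‖) ^ 2 := by positivity
      have h5 : C₀⁻¹ * (C₀ * ‖f τ‖ - ‖w τ‖) ^ 2 = C₀ * ‖f τ‖ ^ 2 - 2 * (‖f τ‖ * ‖w τ‖) +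
          C₀⁻¹ * ‖w τ‖ ^ 2 := by field_simp; ring
      linarith
    have c4 : C₀⁻¹ * ‖w τ‖ ^ 2 ≤ ‖κ (w τ)‖ ^ 2 + ‖U₁ τ‖ ^ 2 := by
      rwa [inv_mul_le_iff₀ hC₀]
    have c5 : -(M * ‖U τ‖ * ‖U₁ τ‖) ≤ inner ℝ (R τ) (w τ) := (abs_le.mp b1).1
    have c6 : 2 * (M * ‖U τ‖ * ‖U₁ τ‖) ≤ M ^ 2 * ‖U τ‖ ^ 2 + ‖U₁ τ‖ ^ 2 := by
      nlinarith [sq_nonneg (M * ‖U τ‖ - ‖U₁ τ‖)]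
    have c7 : M ^ 2 * ‖U τ‖ ^ 2 ≤ M ^ 2 * (C₀ * (‖κ (U τ)‖ ^ 2 + ‖ι (U τ)‖ ^ 2)) := by
      gcongr; exact hco _
    have c8 : inner ℝ (ι (U τ)) (U₁ τ) ≤ ‖ι (U τ)‖ * ‖U₁ τ‖ := real_inner_le_norm _ _
    have c9 : 2 * (‖ι (U τ)‖ * ‖U₁ τ‖) ≤ ‖ι (U τ)‖ ^ 2 + ‖U₁ τ‖ ^ 2 := by
      nlinarith [sq_nonneg (‖ι (U τ)‖ - ‖U₁ τ‖)]
    have d1 : 0 ≤ M ^ 2 * C₀ * ‖U₁ τ‖ ^ 2 := by positivity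
    have d2 : 0 ≤ ‖κ (U τ)‖ ^ 2 := by positivity
    have d3 : 0 ≤ ‖ι (U τ)‖ ^ 2 := by positivity
    simp only [hy, hC₁]
    linarith
  rw [intervalIntegral.integral_add ((i1.const_mul 2).sub (i4.const_mul 2)) (i3.const_mul 2),
    intervalIntegral.integral_sub (i1.const_mul 2) (i4.const_mul 2),
    intervalIntegral.integral_add (((hii if2).const_mul C₀).add (hii iw))
      ((hii hyi).const_mul C₁),
    intervalIntegral.integral_add ((hii if2).const_mul C₀) (hii iw)] at e3
  simp only [intervalIntegral.integral_const_mul] at e3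
  have e4 : ∫ τ in (0)..t, ‖f τ‖ ^ 2 ≤ ‖f‖ ^ 2 := by
    rw [← integral_sq_norm_eq f, ← integral_Ioo_eq_interval ht.1]
    exact setIntegral_mono_set if2 (Eventually.of_forall fun _ ↦ sq_nonneg _)
      (Ioo_subset_Ioo_right ht.2).eventuallyLE
  have e5 := mul_le_mul_of_nonneg_left e4 hC₀.le
  linarith

/-- The a priori estimate for weak solutions. -/
theorem exists_stability_constant (ι : V →L[ℝ] H) (κ : V →L[ℝ] H₂) {C₀ M T : ℝ} (hT : 0 < T)
    (hC₀ : 0 < C₀) (hco : ∀ v, ‖v‖ ^ 2 ≤ C₀ * (‖κ v‖ ^ 2 + ‖ι v‖ ^ 2)) :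
    ∃ C : ℝ, 0 < C ∧ ∀ u w f R : Lp V 2 (timeMeasure T), IsWeakTimeDeriv T u w →
      IsWeakTimeDeriv T (fun t ↦ gram ι (w t))
        (f - (gram κ).compLpL 2 (timeMeasure T) w - (gram κ).compLpL 2 (timeMeasure T) u - R :
          Lp V 2 (timeMeasure T)) →
      (∀ᵐ t ∂timeMeasure T, |inner ℝ (R t) (w t)| ≤ M * ‖u t‖ * ‖ι (w t)‖) →
      ∀ U U₁, IsContinuousRep T u U → IsContinuousRep T (fun t ↦ ι (w t)) U₁ →
      (∀ t ∈ Icc 0 T, ‖U t‖ ≤ C * (‖U 0‖ + ‖U₁ 0‖ + ‖f‖)) ∧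
      (∀ t ∈ Icc 0 T, ‖U₁ t‖ ≤ C * (‖U 0‖ + ‖U₁ 0‖ + ‖f‖)) ∧
      ‖w‖ ≤ C * (‖U 0‖ + ‖U₁ 0‖ + ‖f‖) := by
  set C₁ := M ^ 2 * C₀ + 3 with hC₁
  have hC₁0 : 0 ≤ C₁ := by positivity
  set c₂ := 1 + ‖κ‖ ^ 2 + ‖ι‖ ^ 2 + C₀ with hc₂
  set e := Real.exp (C₁ * T) with he
  have he1 : 1 ≤ e := Real.one_le_exp (by positivity)
  -- The factor c₂ e is the Gronwall bound of the energy, C₀ + 1 covers the passage from the energy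
  -- to the norm of V, and 1 + C₁ T + T covers the time integration in the bound of w.
  set C := (C₀ + 1) * c₂ * (1 + C₁ * T + T) * e with hC
  have hCpos : 0 < C := by positivity
  -- The squares are bounded by C D²; as C ≤ (C + 1)², the constant C + 1 serves without taking a
  -- root.
  refine ⟨C + 1, by positivity, fun u w f R h1 h2 hR U U₁ hU hU₁ ↦ ?_⟩
  set D := ‖U 0‖ + ‖U₁ 0‖ + ‖f‖ with hD
  have hD0 : 0 ≤ D := by positivity
  set y : ℝ → ℝ := fun t ↦ ‖U₁ t‖ ^ 2 + ‖κ (U t)‖ ^ 2 + ‖ι (U t)‖ ^ 2 with hy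
  have hyc : ContinuousOn y (Icc 0 T) :=
    ((hU₁.1.norm.pow 2).add ((κ.continuous.comp_continuousOn hU.1).norm.pow 2)).add
      ((ι.continuous.comp_continuousOn hU.1).norm.pow 2)
  have hy0 : ∀ t, 0 ≤ y t := fun t ↦ by positivity
  have hyi : IntegrableOn y (Ioo 0 T) := hyc.integrableOn_Icc.mono_set Ioo_subset_Icc_self
  have hκw : MemLp (fun t ↦ κ (w t)) 2 (timeMeasure T) := κ.comp_memLp' (Lp.memLp w)
  have iw : IntegrableOn (fun t ↦ ‖κ (w t)‖ ^ 2) (Ioo 0 T) :=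
    (memLp_two_iff_integrable_sq_norm hκw.1).mp hκw
  set R₀ := y 0 + C₀ * ‖f‖ ^ 2 with hR₀
  have hR₀0 : 0 ≤ R₀ := add_nonneg (hy0 0) (by positivity)
  have hR₀D : R₀ ≤ c₂ * D ^ 2 := by
    have a1 : ‖κ (U 0)‖ ^ 2 ≤ ‖κ‖ ^ 2 * ‖U 0‖ ^ 2 := by
      rw [← mul_pow]; gcongr; exact κ.le_opNorm _
    have a2 : ‖ι (U 0)‖ ^ 2 ≤ ‖ι‖ ^ 2 * ‖U 0‖ ^ 2 := by
      rw [← mul_pow]; gcongr; exact ι.le_opNorm _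
    have b1 : ‖U 0‖ ^ 2 ≤ D ^ 2 := by
      gcongr; linarith [norm_nonneg (U₁ 0), norm_nonneg f]
    have b2 : ‖U₁ 0‖ ^ 2 ≤ D ^ 2 := by
      gcongr; linarith [norm_nonneg (U 0), norm_nonneg f]
    have b3 : ‖f‖ ^ 2 ≤ D ^ 2 := by
      gcongr; linarith [norm_nonneg (U 0), norm_nonneg (U₁ 0)]
    have b4 : ‖κ‖ ^ 2 * ‖U 0‖ ^ 2 ≤ ‖κ‖ ^ 2 * D ^ 2 := by gcongr
    have b5 : ‖ι‖ ^ 2 * ‖U 0‖ ^ 2 ≤ ‖ι‖ ^ 2 * D ^ 2 := by gcongr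
    have b6 : C₀ * ‖f‖ ^ 2 ≤ C₀ * D ^ 2 := by gcongr
    simp only [hR₀, hy, hc₂]
    linarith
  have key : ∀ t ∈ Icc 0 T, y t + ∫ τ in (0)..t, ‖κ (w τ)‖ ^ 2 ≤ R₀ + C₁ * ∫ τ in (0)..t, y τ :=
    fun t ht ↦ energy_le_integral_energy ι κ hT hC₀ hco h1 h2 hR hU hU₁ ht
  have hgron := le_mul_exp_of_le_integral (a := R₀) (b := C₁) hC₁0 hyc (fun t ht ↦ by
    have := key t ht
    have h3 : 0 ≤ ∫ τ in (0)..t, ‖κ (w τ)‖ ^ 2 :=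
      intervalIntegral.integral_nonneg ht.1 fun _ _ ↦ sq_nonneg _
    linarith)
  have hyle : ∀ t ∈ Icc 0 T, y t ≤ c₂ * e * D ^ 2 := by
    intro t ht
    refine (hgron t ht).trans ?_
    have h3 : Real.exp (C₁ * t) ≤ e := Real.exp_le_exp.mpr (by gcongr; exact ht.2)
    calc R₀ * Real.exp (C₁ * t) ≤ (c₂ * D ^ 2) * e := by gcongr
      _ = _ := by ring
  have hc₂0 : 0 < c₂ := by positivity
  have hfin : ∀ x : ℝ, 0 ≤ x → x ^ 2 ≤ C * D ^ 2 → x ≤ (C + 1) * D := by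
    intro x hx hxC
    refine abs_le_of_sq_le_sq' ?_ (by positivity) |>.2
    rw [mul_pow]
    exact hxC.trans (mul_le_mul_of_nonneg_right (by linarith [sq_nonneg C, hCpos]) (sq_nonneg D))
  have hT1 : 1 ≤ 1 + C₁ * T + T := by have := mul_nonneg hC₁0 hT.le; linarith
  have hbig : c₂ * e * D ^ 2 ≤ C * D ^ 2 ∧ C₀ * (c₂ * e * D ^ 2) ≤ C * D ^ 2 := by
    have h3 : c₂ * e ≤ c₂ * e * (1 + C₁ * T + T) := le_mul_of_one_le_right (by positivity) hT1
    have h4 : 0 ≤ C₀ * (c₂ * e * (1 + C₁ * T + T)) := by positivity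
    have h5 : C = C₀ * (c₂ * e * (1 + C₁ * T + T)) + c₂ * e * (1 + C₁ * T + T) := by
      rw [hC]; ring
    constructor
    · gcongr; linarith
    · rw [← mul_assoc]
      gcongr
      have h6 : C₀ * (c₂ * e) ≤ C₀ * (c₂ * e * (1 + C₁ * T + T)) := by gcongr
      have h7 : 0 ≤ c₂ * e := by positivity
      linarith
  refine ⟨fun t ht ↦ hfin _ (norm_nonneg _) ?_, fun t ht ↦ hfin _ (norm_nonneg _) ?_,
    hfin _ (norm_nonneg _) ?_⟩
  · refine (hco (U t)).trans (le_trans ?_ hbig.2)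
    gcongr
    refine le_trans ?_ (hyle t ht)
    simp only [hy]
    linarith [sq_nonneg ‖U₁ t‖]
  · refine le_trans ?_ ((hyle t ht).trans hbig.1)
    simp only [hy]
    linarith [sq_nonneg ‖κ (U t)‖, sq_nonneg ‖ι (U t)‖]
  · have hTm : T ∈ Icc 0 T := ⟨hT.le, le_rfl⟩
    -- Gronwall discarded the dissipation. Returning to the integral inequality at time T with the
    -- energy now bounded gives the L² bound of κ w, hence of w in V.
    have e1 := key T hTm
    have e2 : ∫ τ in (0)..T, y τ ≤ T * (c₂ * e * D ^ 2) := by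
      have := intervalIntegral.integral_mono_on hT.le
        (intervalIntegrable_of_integrableOn_Ioo hyi ⟨le_rfl, hT.le⟩ hTm)
        (intervalIntegrable_const (c := c₂ * e * D ^ 2)) (fun t ht ↦ hyle t ht)
      rwa [intervalIntegral.integral_const, sub_zero, smul_eq_mul] at this
    have e3 : ‖w‖ ^ 2 ≤ C₀ * ((∫ τ in (0)..T, ‖κ (w τ)‖ ^ 2) + ∫ τ in (0)..T, y τ) := by
      rw [← integral_sq_norm_eq w, ← integral_Ioo_eq_interval hT.le, ← integral_Ioo_eq_interval hT.le,
        ← integral_add iw hyi, ← integral_const_mul]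
      refine integral_mono_ae ((memLp_two_iff_integrable_sq_norm (Lp.memLp w).1).mp (Lp.memLp w))
        ((iw.add hyi).const_mul C₀) ?_
      filter_upwards [hU₁.2] with t b1
      refine (hco (w t)).trans ?_
      rw [b1]
      simp only [hy]
      gcongr
      linarith [sq_nonneg ‖κ (U t)‖, sq_nonneg ‖ι (U t)‖]
    have e4 : 0 ≤ y T := hy0 T
    have e5 : c₂ * D ^ 2 ≤ c₂ * e * D ^ 2 := by
      gcongr; exact le_mul_of_one_le_right hc₂0.le he1
    have e6 : (∫ τ in (0)..T, ‖κ (w τ)‖ ^ 2) + ∫ τ in (0)..T, y τ ≤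
        (1 + C₁ * T + T) * (c₂ * e * D ^ 2) := by
      have := mul_le_mul_of_nonneg_left e2 hC₁0
      linarith
    calc ‖w‖ ^ 2 ≤ C₀ * ((1 + C₁ * T + T) * (c₂ * e * D ^ 2)) := e3.trans (by gcongr)
      _ ≤ (C₀ + 1) * ((1 + C₁ * T + T) * (c₂ * e * D ^ 2)) := by gcongr; linarith
      _ = C * D ^ 2 := by rw [hC]; ring

end Energy


/-! ### The fractional Laplacian as a Fourier multiplier, and coercivity -/

section Multiplier

variable {n : ℕ} {s : ℝ}

theorem lp_real_smul (c : ℝ) (g : Lp ℂ 2 (volume : Measure (E n))) : c • g = (c : ℂ) • g := by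
  apply Lp.ext
  filter_upwards [Lp.coeFn_smul c g, Lp.coeFn_smul (c : ℂ) g] with x h1 h2
  rw [h1, h2, Pi.smul_apply, Pi.smul_apply, Complex.coe_smul]

theorem fourier_toL2_ae (hs : 0 ≤ s) (u : SobolevSpace n s) :
    ∀ᵐ ξ, 𝓕 (SobolevSpace.toL2 n hs u) ξ =
      (besselSymbol n (-s) ξ : ℂ) * 𝓕 (SobolevSpace.besselL2 n s u) ξ := by
  rw [SobolevSpace.fourier_toL2 hs u]
  filter_upwards [Lp.coeFn_lpSMul (r := 2) (besselSymbol_memLp_top n hs).toLp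
    (𝓕 (SobolevSpace.besselL2 n s u)), (besselSymbol_memLp_top n hs).coeFn_toLp] with ξ h1 h2
  rw [h1, Pi.smul_apply', h2, smul_eq_mul]

theorem fourier_besselL2_ae (hs : 0 ≤ s) (u : SobolevSpace n s) :
    ∀ᵐ ξ, 𝓕 (SobolevSpace.besselL2 n s u) ξ =
      (besselSymbol n s ξ : ℂ) * 𝓕 (SobolevSpace.toL2 n hs u) ξ := by
  filter_upwards [fourier_toL2_ae hs u] with ξ h
  have h0 : besselSymbol n 0 ξ = 1 := by simp [besselSymbol]
  rw [h, ← mul_assoc, ← Complex.ofReal_mul, besselSymbol_mul, add_neg_cancel, h0,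
    Complex.ofReal_one, one_mul]

theorem fourier_halfLap_ae (hs : 0 ≤ s) (u : SobolevSpace n s) :
    ∀ᵐ ξ, 𝓕 (SobolevSpace.halfLap hs u) ξ =
      (((2 * π * ‖ξ‖) ^ s : ℝ) : ℂ) * 𝓕 (SobolevSpace.toL2 n hs u) ξ := by
  rw [SobolevSpace.halfLap, fourier_fourierInv_eq]
  exact (SobolevSpace.memLp_halfLap hs u).coeFn_toLp

theorem rpow_le_besselSymbol (hs : 0 ≤ s) (ξ : E n) :
    (2 * π * ‖ξ‖) ^ s ≤ besselSymbol n s ξ := by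
  have hx : 0 ≤ 2 * π * ‖ξ‖ := by positivity
  calc (2 * π * ‖ξ‖) ^ s = ((2 * π * ‖ξ‖) ^ 2) ^ (s / 2) := by
        rw [← Real.rpow_natCast, ← Real.rpow_mul hx]; congr 1; push_cast; ring
    _ ≤ _ := Real.rpow_le_rpow (by positivity) (by linarith) (by positivity)

/-- With y = (2π|ξ|)² this is (1 + y)^s ≤ (2 max(y, 1))^s ≤ 2^s (y^s + 1). It is the source of the
coercivity constant 2^s. -/
theorem sq_besselSymbol_le (hs : 0 ≤ s) (ξ : E n) :
    besselSymbol n s ξ ^ 2 ≤ 2 ^ s * (((2 * π * ‖ξ‖) ^ s) ^ 2 + 1) := by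
  have hx : 0 ≤ 2 * π * ‖ξ‖ := by positivity
  have h1 : besselSymbol n s ξ ^ 2 = (1 + (2 * π * ‖ξ‖) ^ 2) ^ s := by
    rw [besselSymbol, ← Real.rpow_natCast, ← Real.rpow_mul (by positivity)]; congr 1; push_cast; ring
  have h2 : ((2 * π * ‖ξ‖) ^ s) ^ 2 = ((2 * π * ‖ξ‖) ^ 2) ^ s := by
    rw [← Real.rpow_natCast, ← Real.rpow_natCast, ← Real.rpow_mul hx, ← Real.rpow_mul hx, mul_comm s]
  rw [h1, h2]
  have hy0 : 0 ≤ (2 * π * ‖ξ‖) ^ 2 := sq_nonneg _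
  generalize (2 * π * ‖ξ‖) ^ 2 = y at hy0
  have h3 : (1 + y) ^ s ≤ (2 * max y 1) ^ s :=
    Real.rpow_le_rpow (by positivity) (by linarith [le_max_left y 1, le_max_right y 1]) hs
  rw [Real.mul_rpow (by norm_num) (by positivity)] at h3
  refine h3.trans ?_
  gcongr
  rcases le_total y 1 with h | h
  · rw [max_eq_right h, Real.one_rpow]; linarith [Real.rpow_nonneg hy0 s]
  · rw [max_eq_left h]; linarith

theorem norm_halfLap_le (hs : 0 ≤ s) (u : SobolevSpace n s) : ‖SobolevSpace.halfLap hs u‖ ≤ ‖u‖ := by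
  rw [SobolevSpace.norm_eq, ← Lp.norm_fourier_eq (SobolevSpace.halfLap hs u),
    ← Lp.norm_fourier_eq (SobolevSpace.besselL2 n s u)]
  refine Lp.norm_le_norm_of_ae_le ?_
  filter_upwards [fourier_halfLap_ae hs u, fourier_besselL2_ae hs u] with ξ h1 h2
  rw [h1, h2, norm_mul, norm_mul, Complex.norm_real, Complex.norm_real,
    Real.norm_of_nonneg (by positivity), Real.norm_of_nonneg (besselSymbol_pos n s ξ).le]
  gcongr
  exact rpow_le_besselSymbol hs ξ

theorem fourier_injective_L2 {f g : Lp ℂ 2 (volume : Measure (E n))} (h : 𝓕 f = 𝓕 g) : f = g := by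
  rw [← fourierInv_fourier_eq (F := Lp ℂ 2 (volume : Measure (E n))) f, h, fourierInv_fourier_eq]

theorem halfLap_add (hs : 0 ≤ s) (u v : SobolevSpace n s) :
    SobolevSpace.halfLap hs (u + v) = SobolevSpace.halfLap hs u + SobolevSpace.halfLap hs v := by
  apply fourier_injective_L2
  have h : 𝓕 (SobolevSpace.toL2 n hs (u + v)) =
      𝓕 (SobolevSpace.toL2 n hs u) + 𝓕 (SobolevSpace.toL2 n hs v) := by
    rw [map_add, FourierTransform.fourier_add]
  have h1 := fourier_halfLap_ae hs (u + v)
  rw [h] at h1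
  rw [FourierTransform.fourier_add]
  apply Lp.ext
  filter_upwards [h1, fourier_halfLap_ae hs u, fourier_halfLap_ae hs v,
    Lp.coeFn_add (𝓕 (SobolevSpace.toL2 n hs u)) (𝓕 (SobolevSpace.toL2 n hs v)),
    Lp.coeFn_add (𝓕 (SobolevSpace.halfLap hs u)) (𝓕 (SobolevSpace.halfLap hs v))] with ξ a b c d e
  rw [a, d, e, Pi.add_apply, Pi.add_apply, b, c, mul_add]

theorem halfLap_smul (hs : 0 ≤ s) (c : ℝ) (u : SobolevSpace n s) :
    SobolevSpace.halfLap hs (c • u) = c • SobolevSpace.halfLap hs u := by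
  apply fourier_injective_L2
  have h : 𝓕 (SobolevSpace.toL2 n hs (c • u)) = (c : ℂ) • 𝓕 (SobolevSpace.toL2 n hs u) := by
    rw [map_smul, lp_real_smul, FourierTransform.fourier_smul]
  have h1 := fourier_halfLap_ae hs (c • u)
  rw [h] at h1
  rw [lp_real_smul, FourierTransform.fourier_smul]
  apply Lp.ext
  filter_upwards [h1, fourier_halfLap_ae hs u,
    Lp.coeFn_smul (c : ℂ) (𝓕 (SobolevSpace.toL2 n hs u)),
    Lp.coeFn_smul (c : ℂ) (𝓕 (SobolevSpace.halfLap hs u))] with ξ a b d e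
  rw [a, d, e, Pi.smul_apply, Pi.smul_apply, b, mul_smul_comm]

/-- The fractional Laplacian of order `s / 2` as a bounded operator on `H̃^s(Ω)`. -/
noncomputable def halfLapCLM (hs : 0 ≤ s) (Ω : Set (E n)) :
    tildeSobolev s Ω →L[ℝ] Lp ℂ 2 (volume : Measure (E n)) :=
  (LinearMap.mkContinuous
    { toFun := SobolevSpace.halfLap hs
      map_add' := halfLap_add hs
      map_smul' := halfLap_smul hs } 1
    (fun u ↦ (norm_halfLap_le hs u).trans_eq (one_mul _).symm)) ∘L (tildeSobolev s Ω).subtypeL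

/-- By Plancherel all three norms are integrals in ξ, and the integrands compare pointwise by
`sq_besselSymbol_le`. -/
theorem sq_norm_le_halfLap_add_toL2 (hs : 0 ≤ s) (u : SobolevSpace n s) :
    ‖u‖ ^ 2 ≤ 2 ^ s * (‖SobolevSpace.halfLap hs u‖ ^ 2 + ‖SobolevSpace.toL2 n hs u‖ ^ 2) := by
  rw [SobolevSpace.norm_eq, ← Lp.norm_fourier_eq (SobolevSpace.halfLap hs u),
    ← Lp.norm_fourier_eq (SobolevSpace.besselL2 n s u),
    ← Lp.norm_fourier_eq (SobolevSpace.toL2 n hs u)]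
  rw [← integral_sq_norm_eq, ← integral_sq_norm_eq, ← integral_sq_norm_eq]
  have i : ∀ f : Lp ℂ 2 (volume : Measure (E n)), Integrable (fun x ↦ ‖f x‖ ^ 2) := fun f ↦
    (memLp_two_iff_integrable_sq_norm (Lp.memLp f).1).mp (Lp.memLp f)
  rw [← integral_add (i _) (i _), ← integral_const_mul]
  refine integral_mono_ae (i _) (((i _).add (i _)).const_mul _) ?_
  filter_upwards [fourier_halfLap_ae hs u, fourier_besselL2_ae hs u] with ξ h1 h2
  rw [h1, h2, norm_mul, norm_mul, Complex.norm_real, Complex.norm_real, mul_pow, mul_pow,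
    Real.norm_eq_abs, Real.norm_eq_abs, sq_abs, sq_abs]
  have := mul_le_mul_of_nonneg_right (sq_besselSymbol_le hs ξ)
    (sq_nonneg ‖𝓕 (SobolevSpace.toL2 n hs u) ξ‖)
  linarith

end Multiplier

/-! ### Elements of H̃^s(Ω): support, reality and density -/

section TestFunctions

variable {n : ℕ} {s : ℝ} {Ω : Set (E n)}

theorem toL2_eq_toLp (hs : 0 ≤ s) {u : SobolevSpace n s} {φ : 𝓢(E n, ℂ)}
    (h : SobolevSpace.toDist n s u = (φ : 𝓢'(E n, ℂ))) : SobolevSpace.toL2 n hs u = φ.toLp 2 := by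
  apply toDist_injective
  rw [SobolevSpace.toL2_spec, h, Lp.toTemperedDistribution_toLp_eq]

/-- Vanishing outside Ω and having zero imaginary part hold for test functions and are closed
conditions in H^s(ℝⁿ), so they pass to the closure. -/
theorem tildeSobolev_le_ker (hs : 0 ≤ s) (hΩ : MeasurableSet Ω) :
    tildeSobolev s Ω ≤
      LinearMap.ker (LpToLpRestrictCLM (E n) ℂ ℝ volume 2 Ωᶜ ∘L SobolevSpace.toL2 n hs).toLinearMap ⊓
      LinearMap.ker (Complex.imCLM.compLpL 2 volume ∘L SobolevSpace.toL2 n hs).toLinearMap := by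
  refine Submodule.topologicalClosure_minimal _ (Submodule.span_le.mpr ?_) ?_
  · rintro u ⟨φ, ⟨h1, -, h3⟩, h⟩
    have h4 := toL2_eq_toLp hs h
    have h5 := φ.coeFn_toLp 2 (volume : Measure (E n))
    refine ⟨?_, ?_⟩
    · simp only [SetLike.mem_coe, LinearMap.mem_ker, ContinuousLinearMap.coe_coe,
        ContinuousLinearMap.coe_comp, Function.comp_apply, h4]
      apply Lp.ext
      refine (LpToLpRestrictCLM_coeFn (𝕜 := ℝ) Ωᶜ (φ.toLp 2 volume)).trans ?_
      filter_upwards [Lp.coeFn_zero ℂ 2 (volume.restrict Ωᶜ), ae_restrict_of_ae h5,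
        ae_restrict_mem hΩ.compl] with x a1 a2 a3
      rw [a1, a2]
      exact image_eq_zero_of_notMem_tsupport fun hx ↦ a3 (h3 hx)
    · simp only [SetLike.mem_coe, LinearMap.mem_ker, ContinuousLinearMap.coe_coe,
        ContinuousLinearMap.coe_comp, Function.comp_apply, h4]
      apply Lp.ext
      filter_upwards [Complex.imCLM.coeFn_compLpL (p := 2) (μ := volume) (φ.toLp 2 volume), h5,
        Lp.coeFn_zero ℝ 2 (volume : Measure (E n))] with x a1 a2 a3
      rw [a1, a2, a3]; exact h1 x
  · exact (ContinuousLinearMap.isClosed_ker _).inter (ContinuousLinearMap.isClosed_ker _)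

theorem toL2_eq_zero_ae_compl (hs : 0 ≤ s) (hΩ : MeasurableSet Ω) (u : tildeSobolev s Ω) :
    ∀ᵐ x ∂(volume.restrict Ωᶜ), SobolevSpace.toL2 n hs u.1 x = 0 := by
  have h : LpToLpRestrictCLM (E n) ℂ ℝ volume 2 Ωᶜ (SobolevSpace.toL2 n hs u.1) = 0 :=
    (tildeSobolev_le_ker hs hΩ u.2).1
  have h1 := LpToLpRestrictCLM_coeFn (𝕜 := ℝ) Ωᶜ (SobolevSpace.toL2 n hs u.1)
  rw [h] at h1
  filter_upwards [h1, Lp.coeFn_zero ℂ 2 (volume.restrict Ωᶜ)] with x a1 a2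
  rw [← a1, a2]; rfl

theorem toL2_im_eq_zero (hs : 0 ≤ s) (hΩ : MeasurableSet Ω) (u : tildeSobolev s Ω) :
    ∀ᵐ x, (SobolevSpace.toL2 n hs u.1 x).im = 0 := by
  have h : Complex.imCLM.compLpL 2 volume (SobolevSpace.toL2 n hs u.1) = 0 :=
    (tildeSobolev_le_ker hs hΩ u.2).2
  have h1 := Complex.imCLM.coeFn_compLpL (p := 2) (μ := volume) (SobolevSpace.toL2 n hs u.1)
  rw [h] at h1
  filter_upwards [h1, Lp.coeFn_zero ℝ 2 (volume : Measure (E n))] with x a1 a2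
  rw [← Complex.imCLM_apply, ← a1, a2]; rfl

theorem incl_ae (hs : 0 ≤ s) (u : tildeSobolev s Ω) :
    ∀ᵐ x ∂(volume.restrict Ω), incl hs Ω u x = (SobolevSpace.toL2 n hs u.1 x).re := by
  have h1 := LpToLpRestrictCLM_coeFn (𝕜 := ℝ) Ω
    (Complex.reCLM.compLpL 2 volume (SobolevSpace.toL2 n hs u.1))
  filter_upwards [h1, ae_restrict_of_ae
    (Complex.reCLM.coeFn_compLpL (p := 2) (μ := volume) (SobolevSpace.toL2 n hs u.1))] with x a1 a2
  exact a1.trans a2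

/-- Nothing is lost by restricting to Ω and taking the real part, so the L²(ℝⁿ) norm in the
coercivity may be replaced by the norm of H. -/
theorem norm_toL2_eq_norm_incl (hs : 0 ≤ s) (hΩ : MeasurableSet Ω) (u : tildeSobolev s Ω) :
    ‖SobolevSpace.toL2 n hs u.1‖ = ‖incl hs Ω u‖ := by
  have i : Integrable (fun x ↦ ‖SobolevSpace.toL2 n hs u.1 x‖ ^ 2) :=
    (memLp_two_iff_integrable_sq_norm (Lp.memLp _).1).mp (Lp.memLp _)
  rw [← sq_eq_sq₀ (norm_nonneg _) (norm_nonneg _), ← integral_sq_norm_eq, ← integral_sq_norm_eq,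
    ← integral_add_compl hΩ i]
  have h0 : ∫ x in Ωᶜ, ‖SobolevSpace.toL2 n hs u.1 x‖ ^ 2 = 0 := by
    rw [← integral_zero (E n) ℝ (μ := volume.restrict Ωᶜ)]
    refine integral_congr_ae ?_
    filter_upwards [toL2_eq_zero_ae_compl hs hΩ u] with x hx
    simp [hx]
  rw [h0, add_zero]
  refine integral_congr_ae ?_
  filter_upwards [incl_ae hs u, ae_restrict_of_ae (toL2_im_eq_zero hs hΩ u)] with x a1 a2
  rw [a1, Complex.sq_norm, Complex.normSq_apply, a2, Real.norm_eq_abs, sq_abs]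
  ring

theorem sq_norm_le_halfLap_add_incl (hs : 0 ≤ s) (hΩ : MeasurableSet Ω) (u : tildeSobolev s Ω) :
    ‖u‖ ^ 2 ≤ 2 ^ s * (‖halfLapCLM hs Ω u‖ ^ 2 + ‖incl hs Ω u‖ ^ 2) := by
  rw [← norm_toL2_eq_norm_incl hs hΩ]
  exact sq_norm_le_halfLap_add_toL2 hs u.1

theorem exists_tildeSobolev_of_testFunction (s : ℝ) {φ : 𝓢(E n, ℂ)} (hφ : φ ∈ testFunctions Ω) :
    ∃ u : tildeSobolev s Ω, SobolevSpace.toDist n s u.1 = (φ : 𝓢'(E n, ℂ)) := by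
  have hmem : (φ : 𝓢'(E n, ℂ)) ∈ sobolevSubmodule n s := by
    refine ⟨fun ψ hψ ↦ ?_, (SchwartzMap.fourierMultiplierCLM ℂ
      (fun ξ : E n ↦ (besselSymbol n s ξ : ℂ)) φ).toLp 2, ?_⟩
    · rw [SchwartzMap.coe_apply]
      have h : ∀ x, ψ x • φ x = (((ψ x).re * (φ x).re : ℝ) : ℂ) := fun x ↦ by
        apply Complex.ext <;> simp [hψ x, hφ.1 x]
      simp_rw [h]
      rw [integral_complex_ofReal, Complex.ofReal_im]
    · rw [bessel, Lp.toTemperedDistribution_toLp_eq,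
        fourierMultiplierCLM_toTemperedDistributionCLM_eq (besselSymbol_temperate n s)]
  exact ⟨⟨(⟨φ, hmem⟩ : sobolevSubmodule n s), Submodule.le_topologicalClosure _
    (Submodule.subset_span ⟨φ, hφ, rfl⟩)⟩, rfl⟩

/-- V contains C_c^∞(Ω), so y is orthogonal to all test functions and the fundamental lemma of the
calculus of variations applies. This is the density of V in H. -/
theorem eq_zero_of_inner_incl_eq_zero (hs : 0 ≤ s) (hΩ : IsOpen Ω)
    (y : Lp ℝ 2 (volume.restrict Ω)) (h : ∀ v, inner ℝ y (incl hs Ω v) = 0) : y = 0 := by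
  have key := hΩ.ae_eq_zero_of_integral_contDiff_smul_eq_zero (f := y) (μ := volume.restrict Ω)
    (((Lp.memLp y).locallyIntegrable (by norm_num)).locallyIntegrableOn Ω) ?_
  · apply Lp.ext
    filter_upwards [key, ae_restrict_mem hΩ.measurableSet,
      Lp.coeFn_zero ℝ 2 (volume.restrict Ω)] with x a1 a2 a3
    rw [a1 a2, a3]; rfl
  · intro g hg hc hsub
    have hc' : HasCompactSupport (fun x ↦ (g x : ℂ)) := hc.comp_left Complex.ofReal_zero
    have hg' : ContDiff ℝ ∞ (fun x ↦ (g x : ℂ)) := Complex.ofRealCLM.contDiff.comp hg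
    let φ : 𝓢(E n, ℂ) := hc'.toSchwartzMap hg'
    have hφ : φ ∈ testFunctions Ω := by
      refine ⟨fun x ↦ Complex.ofReal_im _, hc', ?_⟩
      refine Subset.trans (closure_mono ?_) hsub
      intro x hx
      simp only [Function.mem_support] at hx ⊢
      intro h0
      exact hx (by change ((g x : ℝ) : ℂ) = 0; rw [h0, Complex.ofReal_zero])
    obtain ⟨u, hu⟩ := exists_tildeSobolev_of_testFunction s hφ
    have h1 := h u
    rw [L2.inner_def] at h1
    rw [← h1]
    refine integral_congr_ae ?_
    filter_upwards [incl_ae hs u, ae_restrict_of_ae (φ.coeFn_toLp 2 volume)] with x a1 a2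
    rw [a1, toL2_eq_toLp hs hu, a2]
    change g x * y x = inner ℝ (y x) ((g x : ℂ)).re
    rw [Complex.ofReal_re, real_inner_comm]
    simp [mul_comm]

end TestFunctions

/-! ### Bounds and Riesz representation for the duality pairing -/

section Duality

variable {n : ℕ} {s : ℝ} {Ω : Set (E n)}

theorem abs_sobolevPairing_le (v : SobolevSpace n s) (F : SobolevSpace n (-s)) :
    |sobolevPairing n s v F| ≤ ‖F‖ * ‖v‖ := by
  have h1 : |sobolevPairing n s v F| ≤ ‖((ContinuousLinearMap.mul ℂ ℂ).lpPairing volume 2 2)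
      (SobolevSpace.besselL2 n (-s) F) (SobolevSpace.besselL2 n s v)‖ := Complex.abs_re_le_norm _
  refine h1.trans ?_
  rw [ContinuousLinearMap.lpPairing_eq_integral, ← integral_congr_ae
    (ContinuousLinearMap.coeFn_holder (p := 2) (q := 2) (r := 1) (μ := volume)
      (ContinuousLinearMap.mul ℂ ℂ) (SobolevSpace.besselL2 n (-s) F) (SobolevSpace.besselL2 n s v))]
  refine (norm_integral_le_integral_norm _).trans ?_
  rw [← L1.norm_eq_integral_norm]
  refine (ContinuousLinearMap.norm_holder_apply_apply_le (p := 2) (q := 2) (r := 1) (μ := volume)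
    (ContinuousLinearMap.mul ℂ ℂ) (SobolevSpace.besselL2 n (-s) F) (SobolevSpace.besselL2 n s v)).trans ?_
  rw [SobolevSpace.norm_eq, SobolevSpace.norm_eq]
  gcongr
  exact mul_le_of_le_one_left (norm_nonneg _) (ContinuousLinearMap.opNorm_mul_le ℂ ℂ)

/-- The pairing can be computed with any extension of h; one whose norm exceeds the quotient norm by
less than ε / (‖v‖ + 1) costs at most ε. -/
theorem abs_duality_le (h : SobolevOn (-s) Ω) (v : tildeSobolev s Ω) :
    |duality h v| ≤ ‖h‖ * ‖v‖ := by
  refine le_of_forall_pos_le_add fun ε hε ↦ ?_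
  obtain ⟨F, rfl, hF⟩ := Submodule.Quotient.norm_mk_lt h (ε := ε / (‖v‖ + 1)) (by positivity)
  have h1 := abs_sobolevPairing_le v.1 F
  have h2 : duality (Submodule.Quotient.mk F : SobolevOn (-s) Ω) v = sobolevPairing n s v.1 F := rfl
  rw [h2]
  refine h1.trans ?_
  have h3 : ‖v.1‖ = ‖v‖ := rfl
  rw [h3]
  have h4 : ε / (‖v‖ + 1) * ‖v‖ ≤ ε := by
    rw [div_mul_eq_mul_div, div_le_iff₀ (by positivity)]
    nlinarith [norm_nonneg v]
  nlinarith [mul_le_mul_of_nonneg_right hF.le (norm_nonneg v)]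

theorem sobolevPairing_add_left (v w : SobolevSpace n s) (F : SobolevSpace n (-s)) :
    sobolevPairing n s (v + w) F = sobolevPairing n s v F + sobolevPairing n s w F := by
  simp [sobolevPairing]

theorem sobolevPairing_smul_left (c : ℝ) (v : SobolevSpace n s) (F : SobolevSpace n (-s)) :
    sobolevPairing n s (c • v) F = c * sobolevPairing n s v F := by
  simp only [sobolevPairing, map_smul, ContinuousLinearMap.map_smul_of_tower]
  simp

/-- The representative in `H̃^s(Ω)` of an element of `H^{-s}(Ω)`. -/
noncomputable def dualityCLM (s : ℝ) (Ω : Set (E n)) : SobolevOn (-s) Ω →L[ℝ] tildeSobolev s Ω :=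
  (InnerProductSpace.toDual ℝ (tildeSobolev s Ω)).symm.toContinuousLinearEquiv.toContinuousLinearMap
    ∘L LinearMap.mkContinuous₂ (LinearMap.mk₂ ℝ (fun h v ↦ duality h v)
      (fun h k v ↦ by simp [duality]) (fun c h v ↦ by simp [duality])
      (fun h v w ↦ by
        obtain ⟨F, rfl⟩ := Submodule.Quotient.mk_surjective _ h
        exact sobolevPairing_add_left v.1 w.1 F)
      (fun c h v ↦ by
        obtain ⟨F, rfl⟩ := Submodule.Quotient.mk_surjective _ h
        exact sobolevPairing_smul_left c v.1 F)) 1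
      (fun h v ↦ by rw [one_mul]; exact abs_duality_le h v)

theorem inner_dualityCLM (h : SobolevOn (-s) Ω) (v : tildeSobolev s Ω) :
    inner ℝ (dualityCLM s Ω h) v = duality h v :=
  InnerProductSpace.toDual_symm_apply

end Duality


/-! ### The Sobolev inequality by splitting frequencies -/

section Fourier

variable {n : ℕ}

/-- The inverse Fourier transform of an integrable function in `L²` is given by the integral. -/
theorem fourierInv_ae_eq_integral (g : Lp ℂ 2 (volume : Measure (E n))) (hg : Integrable g) :
    ∀ᵐ x, (𝓕⁻ g : Lp ℂ 2 (volume : Measure (E n))) x =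
      VectorFourier.fourierIntegral 𝐞 volume (-innerₗ (E n)) g x := by
  -- The minus sign in the form `-innerₗ` turns the kernel into that of the inverse transform.
  have hL : Continuous fun p : E n × E n ↦ (-innerₗ (E n)) p.1 p.2 := by
    simp only [LinearMap.neg_apply, innerₗ_apply_apply]; fun_prop
  have hflip : (-innerₗ (E n)).flip = -innerₗ (E n) := by
    ext x y; simp [real_inner_comm]
  have hc := VectorFourier.fourierIntegral_continuous Real.continuous_fourierChar hL hg
  -- The two functions are compared against smooth compactly supported functions: in both cases the
  -- transform moves to the test function, on one side by the definition for distributions, on the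
  -- other by Fubini.
  refine ae_eq_of_integral_contDiff_smul_eq ((Lp.memLp _).locallyIntegrable (by norm_num))
    hc.locallyIntegrable fun φ hφ hφc ↦ ?_
  have hc' : HasCompactSupport (fun x ↦ (φ x : ℂ)) := hφc.comp_left Complex.ofReal_zero
  have hg' : ContDiff ℝ ∞ (fun x ↦ (φ x : ℂ)) := Complex.ofRealCLM.contDiff.comp hφ
  let ψ : 𝓢(E n, ℂ) := hc'.toSchwartzMap hg'
  have h1 : ((𝓕⁻ g : Lp ℂ 2 (volume : Measure (E n))) : 𝓢'(E n, ℂ)) ψ =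
      (g : 𝓢'(E n, ℂ)) (𝓕⁻ ψ) := by
    rw [← Lp.fourierInv_toTemperedDistribution_eq, TemperedDistribution.fourierInv_apply]
  rw [Lp.toTemperedDistribution_apply, Lp.toTemperedDistribution_apply] at h1
  have h2 := VectorFourier.integral_fourierIntegral_smul_eq_flip (μ := volume) (ν := volume)
    (L := -innerₗ (E n)) Real.continuous_fourierChar hL ψ.integrable hg
  rw [hflip] at h2
  have h3 : ∀ x, φ x • VectorFourier.fourierIntegral 𝐞 volume (-innerₗ (E n)) g x =
      ψ x • VectorFourier.fourierIntegral 𝐞 volume (-innerₗ (E n)) g x := fun x ↦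
    (Complex.coe_smul _ _).symm
  have h4 : ∀ x, φ x • (𝓕⁻ g : Lp ℂ 2 (volume : Measure (E n))) x =
      ψ x • (𝓕⁻ g : Lp ℂ 2 (volume : Measure (E n))) x := fun x ↦ (Complex.coe_smul _ _).symm
  simp_rw [h3, h4]
  rw [h1, ← h2]
  refine integral_congr_ae (Eventually.of_forall fun x ↦ ?_)
  change 𝓕⁻ ψ x • g x = _
  rw [SchwartzMap.fourierInv_coe]
  rfl

/-- For integrable g the kernel has modulus one; otherwise the right side is infinite. So
integrability need not be assumed. -/
theorem enorm_fourierInv_le (g : Lp ℂ 2 (volume : Measure (E n))) :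
    ∀ᵐ x, ‖(𝓕⁻ g : Lp ℂ 2 (volume : Measure (E n))) x‖ₑ ≤ ∫⁻ ξ, ‖g ξ‖ₑ := by
  by_cases hg : Integrable g
  · filter_upwards [fourierInv_ae_eq_integral g hg] with x hx
    rw [hx, ← ofReal_integral_norm_eq_lintegral_enorm hg, ← ofReal_norm]
    exact ENNReal.ofReal_le_ofReal (VectorFourier.norm_fourierIntegral_le_integral_norm _ _ _ _ _)
  · have : ∫⁻ ξ, ‖g ξ‖ₑ = ⊤ := by
      by_contra h
      exact hg ⟨(Lp.memLp g).1, lt_top_iff_ne_top.mpr h⟩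
    simp [this]

theorem lintegral_sq_enorm_eq {α : Type*} [MeasurableSpace α] {μ : Measure α} (f : Lp ℂ 2 μ) :
    ∫⁻ x, ‖f x‖ₑ ^ 2 ∂μ = ‖f‖ₑ ^ 2 := by
  have := eLpNorm_nnreal_pow_eq_lintegral (f := f) (p := 2) (μ := μ) (by norm_num)
  rw [Lp.enorm_def]
  simpa using this.symm

theorem exists_lp_indicator (F : Lp ℂ 2 (volume : Measure (E n))) {S : Set (E n)}
    (hS : MeasurableSet S) :
    ∃ g : Lp ℂ 2 (volume : Measure (E n)), g =ᵐ[volume] S.indicator F :=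
  ⟨_, ((Lp.memLp F).indicator hS).coeFn_toLp⟩

/-- Estimate of a distribution function by splitting the frequencies. -/
theorem meas_lt_norm_fourierInv_le (F : Lp ℂ 2 (volume : Measure (E n))) {S : Set (E n)}
    (hS : MeasurableSet S) {l : ℝ} (hl : 0 < l)
    (h : ∫⁻ ξ in S, ‖F ξ‖ₑ ≤ ENNReal.ofReal (l / 2)) :
    volume {x | l < ‖(𝓕⁻ F : Lp ℂ 2 (volume : Measure (E n))) x‖} ≤
      ENNReal.ofReal (4 / l ^ 2) * ∫⁻ ξ in Sᶜ, ‖F ξ‖ₑ ^ 2 := by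
  obtain ⟨g₁, e₁⟩ := exists_lp_indicator F hS
  obtain ⟨g₂, e₂⟩ := exists_lp_indicator F hS.compl
  have hsum : (𝓕⁻ F : Lp ℂ 2 (volume : Measure (E n))) = 𝓕⁻ g₁ + 𝓕⁻ g₂ := by
    rw [← FourierTransform.fourierInv_add]
    congr 1
    apply Lp.ext
    filter_upwards [Lp.coeFn_add g₁ g₂, e₁, e₂] with x a b c
    rw [a, Pi.add_apply, b, c, ← Pi.add_apply, Set.indicator_self_add_compl]
  -- The frequencies in S contribute at most l/2 pointwise, so where the whole exceeds l the
  -- remaining part exceeds l/2, and Chebyshev applies to it.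
  have hlow : ∀ᵐ x, ‖(𝓕⁻ g₁ : Lp ℂ 2 (volume : Measure (E n))) x‖ ≤ l / 2 := by
    filter_upwards [enorm_fourierInv_le g₁] with x hx
    have h1 : ∫⁻ ξ, ‖g₁ ξ‖ₑ = ∫⁻ ξ in S, ‖F ξ‖ₑ := by
      rw [← lintegral_indicator hS]
      refine lintegral_congr_ae ?_
      filter_upwards [e₁] with ξ h2
      rw [h2, enorm_indicator_eq_indicator_enorm]
    rw [h1] at hx
    have h2 := hx.trans h
    rwa [← ofReal_norm, ENNReal.ofReal_le_ofReal_iff (by positivity)] at h2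
  have hhigh : ∫⁻ x, ‖(𝓕⁻ g₂ : Lp ℂ 2 (volume : Measure (E n))) x‖ₑ ^ 2 =
      ∫⁻ ξ in Sᶜ, ‖F ξ‖ₑ ^ 2 := by
    have h1 : ‖(𝓕⁻ g₂ : Lp ℂ 2 (volume : Measure (E n)))‖ = ‖g₂‖ := by
      rw [← Lp.norm_fourier_eq (𝓕⁻ g₂ : Lp ℂ 2 (volume : Measure (E n))),
        fourier_fourierInv_eq (F := Lp ℂ 2 (volume : Measure (E n)))]
    rw [lintegral_sq_enorm_eq, ← ofReal_norm, h1, ofReal_norm, ← lintegral_sq_enorm_eq,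
      ← lintegral_indicator hS.compl]
    refine lintegral_congr_ae ?_
    filter_upwards [e₂] with ξ h2
    rw [h2]
    by_cases hξ : ξ ∈ Sᶜ
    · rw [indicator_of_mem hξ, indicator_of_mem hξ]
    · rw [indicator_of_notMem hξ, indicator_of_notMem hξ]; simp
  have hε : ENNReal.ofReal (l ^ 2 / 4) ≠ 0 := by
    rw [Ne, ENNReal.ofReal_eq_zero, not_le]; positivity
  have hcheb := meas_ge_le_lintegral_div (μ := (volume : Measure (E n)))
    (f := fun x ↦ ‖(𝓕⁻ g₂ : Lp ℂ 2 (volume : Measure (E n))) x‖ₑ ^ 2)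
    ((Lp.aestronglyMeasurable _).enorm.pow_const 2) hε ENNReal.ofReal_ne_top
  rw [hhigh, ENNReal.div_eq_inv_mul, ← ENNReal.ofReal_inv_of_pos (by positivity), inv_div] at hcheb
  refine le_trans (measure_mono_ae ?_) hcheb
  filter_upwards [hlow, Lp.coeFn_add (𝓕⁻ g₁ : Lp ℂ 2 (volume : Measure (E n))) (𝓕⁻ g₂)] with x a b hx
  change l < ‖(𝓕⁻ F : Lp ℂ 2 (volume : Measure (E n))) x‖ at hx
  change ENNReal.ofReal (l ^ 2 / 4) ≤ _
  rw [hsum, b, Pi.add_apply] at hx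
  have h1 := hx.trans_le (norm_add_le _ _)
  rw [← ofReal_norm, ← ENNReal.ofReal_pow (norm_nonneg _)]
  apply ENNReal.ofReal_le_ofReal
  have h2 : l / 2 ≤ ‖(𝓕⁻ g₂ : Lp ℂ 2 (volume : Measure (E n))) x‖ := by linarith
  calc l ^ 2 / 4 = (l / 2) ^ 2 := by ring
    _ ≤ _ := by gcongr

/-- The integral of a negative power of the norm over a ball. -/
theorem exists_lintegral_ball_rpow_le (hn : 0 < n) {σ : ℝ} (hσ : 2 * σ < n) :
    ∃ c : ℝ, 0 < c ∧ ∀ A : ℝ, 0 < A → ∫⁻ ξ in Metric.ball (0 : E n) A,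
      ENNReal.ofReal (‖ξ‖ ^ (-(2 * σ))) ≤ ENNReal.ofReal ((c * A ^ (n / 2 - σ)) ^ 2) := by
  have : Nonempty (Fin n) := ⟨⟨0, hn⟩⟩
  have hdim : Module.finrank ℝ (E n) = n := by simp
  set b := n * (volume : Measure (E n)).real (Metric.ball 0 1) / (n - 2 * σ) with hb
  have hn2 : 0 < (n : ℝ) - 2 * σ := by linarith
  have hb0 : 0 ≤ b := by positivity
  -- The `+ 1` makes the constant positive without discussing the volume of the unit ball.
  refine ⟨√(b + 1), by positivity, fun A hA ↦ ?_⟩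
  have hpow : ∀ y ∈ Ioo 0 A, y ^ (n - 1) • y ^ (-(2 * σ)) = y ^ ((n : ℝ) - 1 - 2 * σ) := by
    intro y hy
    rw [smul_eq_mul, ← Real.rpow_natCast, ← Real.rpow_add hy.1, Nat.cast_sub hn]
    congr 1; push_cast; ring
  have hi : IntegrableOn (fun ξ : E n ↦ ‖ξ‖ ^ (-(2 * σ))) (Metric.ball 0 A) := by
    rw [integrableOn_fun_norm_addHaar volume (f := fun y : ℝ ↦ y ^ (-(2 * σ))), hdim,
      integrableOn_congr_fun hpow measurableSet_Ioo,
      intervalIntegral.integrableOn_Ioo_rpow_iff hA]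
    linarith
  rw [← ofReal_integral_eq_lintegral_ofReal hi
    (Eventually.of_forall fun ξ ↦ Real.rpow_nonneg (norm_nonneg _) _)]
  apply ENNReal.ofReal_le_ofReal
  have h1 : ∫ ξ in Metric.ball (0 : E n) A, ‖ξ‖ ^ (-(2 * σ)) =
      ∫ ξ : E n, (Iio A).indicator (fun y : ℝ ↦ y ^ (-(2 * σ))) ‖ξ‖ := by
    rw [← integral_indicator Metric.isOpen_ball.measurableSet]
    congr 1; ext ξ; simp [indicator]
  have h2 : ∫ y in Ioi (0 : ℝ), y ^ (n - 1) • (Iio A).indicator (fun y : ℝ ↦ y ^ (-(2 * σ))) y =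
      A ^ ((n : ℝ) - 2 * σ) / (n - 2 * σ) := by
    have : ∀ y : ℝ, y ^ (n - 1) • (Iio A).indicator (fun y : ℝ ↦ y ^ (-(2 * σ))) y =
        (Iio A).indicator (fun y : ℝ ↦ y ^ (n - 1) • y ^ (-(2 * σ))) y := fun y ↦ by
      by_cases hy : y ∈ Iio A
      · rw [indicator_of_mem hy, indicator_of_mem hy]
      · rw [indicator_of_notMem hy, indicator_of_notMem hy, smul_zero]
    simp_rw [this]
    rw [setIntegral_indicator measurableSet_Iio, Ioi_inter_Iio,
      setIntegral_congr_fun measurableSet_Ioo hpow, integral_Ioo_eq_interval hA.le,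
      integral_rpow (Or.inl (by linarith)), sub_right_comm, sub_add_cancel,
      Real.zero_rpow hn2.ne', sub_zero]
  rw [h1, integral_fun_norm_addHaar, hdim, h2, nsmul_eq_mul, smul_eq_mul, mul_pow,
    Real.sq_sqrt (by positivity), ← Real.rpow_natCast, ← Real.rpow_mul hA.le]
  have h3 : ((n : ℝ) / 2 - σ) * ((2 : ℕ) : ℝ) = n - 2 * σ := by push_cast; ring
  rw [h3]
  calc (n : ℝ) * ((volume : Measure (E n)).real (Metric.ball 0 1) *
        (A ^ ((n : ℝ) - 2 * σ) / (n - 2 * σ))) = b * A ^ ((n : ℝ) - 2 * σ) := by rw [hb]; ring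
    _ ≤ _ := by gcongr; linarith

/-- The `L¹` norm of low frequencies. -/
theorem lintegral_ball_enorm_le {σ c A N : ℝ} (hN : 0 < N) (hA : 0 < A) (hc : 0 < c)
    (h : ∫⁻ ξ in Metric.ball (0 : E n) A, ENNReal.ofReal (‖ξ‖ ^ (-(2 * σ))) ≤
      ENNReal.ofReal ((c * A ^ (n / 2 - σ)) ^ 2)) {F : E n → ℂ} (hF : AEStronglyMeasurable F)
    (hFN : ∫⁻ ξ, ENNReal.ofReal (‖ξ‖ ^ (2 * σ)) * ‖F ξ‖ₑ ^ 2 ≤ ENNReal.ofReal (N ^ 2)) (hn : 0 < n) :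
    ∫⁻ ξ in Metric.ball (0 : E n) A, ‖F ξ‖ₑ ≤ ENNReal.ofReal (c * A ^ (n / 2 - σ) * N) := by
  have : Nonempty (Fin n) := ⟨⟨0, hn⟩⟩
  set μ := (volume : Measure (E n)).restrict (Metric.ball 0 A)
  have hne : ∀ᵐ ξ ∂μ, ξ ≠ 0 := ae_restrict_of_ae (by
    rw [ae_iff]; simp)
  have hm1 : Measurable fun ξ : E n ↦ ENNReal.ofReal (‖ξ‖ ^ (-σ)) := by fun_prop
  have hm2 : Measurable fun ξ : E n ↦ ENNReal.ofReal (‖ξ‖ ^ σ) := by fun_prop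
  -- Inserting ‖ξ‖^(-σ) ‖ξ‖^σ = 1, valid off the origin, prepares Cauchy–Schwarz: the first factor
  -- is integrated over the ball, the second carries the Sobolev norm.
  have e1 : ∫⁻ ξ, ‖F ξ‖ₑ ∂μ = ∫⁻ ξ, ((fun ξ : E n ↦ ENNReal.ofReal (‖ξ‖ ^ (-σ))) *
      fun ξ ↦ ENNReal.ofReal (‖ξ‖ ^ σ) * ‖F ξ‖ₑ) ξ ∂μ := by
    refine lintegral_congr_ae ?_
    filter_upwards [hne] with ξ hξ
    have : 0 < ‖ξ‖ := norm_pos_iff.mpr hξ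
    rw [Pi.mul_apply, ← mul_assoc, ← ENNReal.ofReal_mul (by positivity), ← Real.rpow_add this,
      neg_add_cancel, Real.rpow_zero, ENNReal.ofReal_one, one_mul]
  rw [e1]
  refine (ENNReal.lintegral_mul_le_Lp_mul_Lq μ Real.HolderConjugate.two_two hm1.aemeasurable
    (hm2.aemeasurable.mul hF.restrict.enorm)).trans ?_
  have sq : ∀ x y : ℝ, 0 ≤ x → ENNReal.ofReal (x ^ y) ^ (2 : ℝ) = ENNReal.ofReal (x ^ (2 * y)) := by
    intro x y hx
    rw [ENNReal.ofReal_rpow_of_nonneg (by positivity) (by norm_num), ← Real.rpow_mul hx, mul_comm y]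
  have f1 : ∫⁻ ξ, ENNReal.ofReal (‖ξ‖ ^ (-σ)) ^ (2 : ℝ) ∂μ ≤
      ENNReal.ofReal ((c * A ^ (n / 2 - σ)) ^ 2) := by
    refine le_trans (le_of_eq ?_) h
    refine lintegral_congr fun ξ ↦ ?_
    rw [sq _ _ (norm_nonneg _), mul_neg]
  have f2 : ∫⁻ ξ, (ENNReal.ofReal (‖ξ‖ ^ σ) * ‖F ξ‖ₑ) ^ (2 : ℝ) ∂μ ≤ ENNReal.ofReal (N ^ 2) := by
    refine le_trans (le_of_eq ?_) ((setLIntegral_le_lintegral (Metric.ball 0 A) _).trans hFN)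
    refine lintegral_congr fun ξ ↦ ?_
    rw [ENNReal.mul_rpow_of_nonneg _ _ (by norm_num), sq _ _ (norm_nonneg _), ENNReal.rpow_two]
  calc _ ≤ ENNReal.ofReal ((c * A ^ (n / 2 - σ)) ^ 2) ^ (1 / 2 : ℝ) *
        ENNReal.ofReal (N ^ 2) ^ (1 / 2 : ℝ) := mul_le_mul'
          (ENNReal.rpow_le_rpow f1 (by norm_num)) (ENNReal.rpow_le_rpow f2 (by norm_num))
    _ = _ := by
      rw [ENNReal.ofReal_rpow_of_nonneg (by positivity) (by norm_num),
        ENNReal.ofReal_rpow_of_nonneg (by positivity) (by norm_num), ← Real.sqrt_eq_rpow,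
        ← Real.sqrt_eq_rpow, Real.sqrt_sq (by positivity), Real.sqrt_sq hN.le,
        ← ENNReal.ofReal_mul (by positivity)]

theorem lintegral_Ioc_rpow {b B : ℝ} (hb : -1 < b) (hB : 0 ≤ B) :
    ∫⁻ l in Ioc 0 B, ENNReal.ofReal (l ^ b) = ENNReal.ofReal (B ^ (b + 1) / (b + 1)) := by
  have hi : IntegrableOn (fun l : ℝ ↦ l ^ b) (Ioc 0 B) :=
    (intervalIntegrable_iff_integrableOn_Ioc_of_le hB).mp (intervalIntegral.intervalIntegrable_rpow' hb)
  rw [← ofReal_integral_eq_lintegral_ofReal hi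
    ((ae_restrict_mem measurableSet_Ioc).mono fun l hl ↦ Real.rpow_nonneg hl.1.le _),
    ← intervalIntegral.integral_of_le hB, integral_rpow (Or.inl hb),
    Real.zero_rpow (by linarith), sub_zero]

/-- The Tonelli step in the proof of the Sobolev inequality. -/
theorem lintegral_superlevel_eq {F : E n → ℂ} (hF : Measurable F) {K a b : ℝ} (hK : 0 < K)
    (hb : -1 < b) :
    ∫⁻ l in Ioi (0 : ℝ), ENNReal.ofReal (l ^ b) *
        ∫⁻ ξ in {ξ | l ≤ K * ‖ξ‖ ^ a}, ‖F ξ‖ₑ ^ 2 =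
      ∫⁻ ξ, ENNReal.ofReal ((K * ‖ξ‖ ^ a) ^ (b + 1) / (b + 1)) * ‖F ξ‖ₑ ^ 2 := by
  set W : Set (ℝ × E n) := {z | z.1 ≤ K * ‖z.2‖ ^ a} with hW
  have hWm : MeasurableSet W := measurableSet_le (by fun_prop) (by fun_prop)
  set G : ℝ → E n → ℝ≥0∞ := fun l ξ ↦
    W.indicator (fun z ↦ ENNReal.ofReal (z.1 ^ b) * ‖F z.2‖ₑ ^ 2) (l, ξ) with hG
  have hGm : Measurable (Function.uncurry G) := by
    refine Measurable.indicator ?_ hWm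
    have : Measurable fun z : ℝ × E n ↦ F z.2 := hF.comp measurable_snd
    exact (by fun_prop : Measurable fun z : ℝ × E n ↦ ENNReal.ofReal (z.1 ^ b)).mul
      (this.enorm.pow_const 2)
  have h1 : ∀ l, ENNReal.ofReal (l ^ b) * ∫⁻ ξ in {ξ | l ≤ K * ‖ξ‖ ^ a}, ‖F ξ‖ₑ ^ 2 =
      ∫⁻ ξ, G l ξ := by
    intro l
    have hm : MeasurableSet {ξ : E n | l ≤ K * ‖ξ‖ ^ a} :=
      measurableSet_le (by fun_prop) (by fun_prop)
    rw [← lintegral_const_mul _ (hF.enorm.pow_const 2), ← lintegral_indicator hm]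
    rfl
  simp_rw [h1]
  rw [lintegral_lintegral_swap hGm.aemeasurable]
  refine lintegral_congr fun ξ ↦ ?_
  have hB : 0 ≤ K * ‖ξ‖ ^ a := by positivity
  have h2 : ∀ l, G l ξ = (Iic (K * ‖ξ‖ ^ a)).indicator
      (fun l ↦ ENNReal.ofReal (l ^ b) * ‖F ξ‖ₑ ^ 2) l := fun l ↦ rfl
  simp_rw [h2]
  rw [setLIntegral_indicator measurableSet_Iic, inter_comm, Ioi_inter_Iic,
    lintegral_mul_const _ (by fun_prop), lintegral_Ioc_rpow hb hB]

/-- The Sobolev inequality in the subcritical case, for functions given by their Fourier transform. -/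
theorem exists_sobolev_constant (hn : 0 < n) {σ r : ℝ} (hσ0 : 0 < σ) (hσ : 2 * σ < n)
    (hr : r = 2 * n / (n - 2 * σ)) :
    ∃ C : ℝ, 0 < C ∧ ∀ (F : Lp ℂ 2 (volume : Measure (E n))) (N : ℝ), 0 < N →
      ∫⁻ ξ, ENNReal.ofReal (‖ξ‖ ^ (2 * σ)) * ‖F ξ‖ₑ ^ 2 ≤ ENNReal.ofReal (N ^ 2) →
      eLpNorm (𝓕⁻ F : Lp ℂ 2 (volume : Measure (E n))) (ENNReal.ofReal r) volume ≤
        ENNReal.ofReal (C * N) := by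
  obtain ⟨c, hc, hball⟩ := exists_lintegral_ball_rpow_le hn hσ
  have hd : 0 < (n : ℝ) - 2 * σ := by linarith
  have hn0 : (0 : ℝ) < n := by exact_mod_cast hn
  have hr2 : 2 < r := by rw [hr, lt_div_iff₀ hd]; linarith
  -- This identity fixes the exponent r: after Tonelli the weight ‖ξ‖^(a (r - 2)) has to be the
  -- Sobolev weight ‖ξ‖^(2σ).
  have har : ((n : ℝ) / 2 - σ) * (r - 2) = 2 * σ := by rw [hr]; field_simp; ring
  set a := (n : ℝ) / 2 - σ with ha
  have ha0 : 0 < a := by rw [ha]; linarith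
  set C := r * (4 * ((2 * c) ^ (r - 2) / (r - 2))) with hC
  have hr20 : 0 < r - 2 := by linarith
  have hC0 : 0 < C := by positivity
  refine ⟨C ^ (1 / r), by positivity, fun F N hN hFN ↦ ?_⟩
  have hr0 : 0 < r := by linarith
  set f : Lp ℂ 2 (volume : Measure (E n)) := 𝓕⁻ F with hf
  set K := 2 * (c * N) with hK
  have hK0 : 0 < K := by positivity
  have hdist : ∀ l : ℝ, 0 < l → volume {x | l < ‖f x‖} ≤
      ENNReal.ofReal (4 / l ^ 2) * ∫⁻ ξ in {ξ | l ≤ K * ‖ξ‖ ^ a}, ‖F ξ‖ₑ ^ 2 := by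
    intro l hl
    -- The radius solves c A^a N = l / 2, so the low frequencies contribute at most half of the
    -- level; the complement of the ball lies in {l ≤ K ‖ξ‖^a}.
    set A := (l / K) ^ (1 / a) with hA
    have hA0 : 0 < A := by positivity
    have hAa : A ^ a = l / K := by
      rw [hA, ← Real.rpow_mul (by positivity), one_div_mul_cancel ha0.ne', Real.rpow_one]
    have h1 := lintegral_ball_enorm_le hN hA0 hc (hball A hA0) (Lp.aestronglyMeasurable F) hFN hn
    have h2 : c * A ^ a * N = l / 2 := by rw [hAa, hK]; field_simp
    rw [← ha, h2] at h1
    refine (meas_lt_norm_fourierInv_le F Metric.isOpen_ball.measurableSet hl h1).trans ?_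
    gcongr
    intro ξ hξ
    simp only [mem_compl_iff, Metric.mem_ball, dist_zero_right, not_lt] at hξ
    have h3 := Real.rpow_le_rpow hA0.le hξ ha0.le
    rw [hAa, div_le_iff₀ hK0] at h3
    change l ≤ K * ‖ξ‖ ^ a
    linarith
  have hFm : Measurable F := (Lp.stronglyMeasurable F).measurable
  have key : ∫⁻ x, ENNReal.ofReal (‖f x‖ ^ r) ≤ ENNReal.ofReal (C * N ^ r) := by
    rw [lintegral_rpow_eq_lintegral_meas_lt_mul volume
      (Eventually.of_forall fun x ↦ norm_nonneg _) (Lp.aestronglyMeasurable f).norm.aemeasurable hr0]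
    -- The layer cake weight l^(r-1) times the Chebyshev factor 4 / l² is 4 l^(r-3), and r - 3 > -1
    -- makes the inner integral in l finite after Tonelli.
    have h1 : ∫⁻ l in Ioi (0 : ℝ), volume {x | l < ‖f x‖} * ENNReal.ofReal (l ^ (r - 1)) ≤
        4 * ∫⁻ ξ, ENNReal.ofReal ((K * ‖ξ‖ ^ a) ^ (r - 3 + 1) / (r - 3 + 1)) * ‖F ξ‖ₑ ^ 2 := by
      rw [← lintegral_superlevel_eq hFm hK0 (by linarith), ← lintegral_const_mul' _ _ (by norm_num)]
      refine setLIntegral_mono' measurableSet_Ioi fun l hl ↦ ?_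
      have hl0 : 0 < l := hl
      refine (mul_le_mul_left (hdist l hl) _).trans (le_of_eq ?_)
      have h4 : ENNReal.ofReal (4 / l ^ 2) * ENNReal.ofReal (l ^ (r - 1)) =
          4 * ENNReal.ofReal (l ^ (r - 3)) := by
        have : (4 : ℝ≥0∞) = ENNReal.ofReal 4 := by norm_num
        rw [this, ← ENNReal.ofReal_mul (by positivity), ← ENNReal.ofReal_mul (by positivity)]
        congr 1
        have h5 : l ^ (r - 1) = l ^ (r - 3) * l ^ 2 := by
          rw [← Real.rpow_natCast, ← Real.rpow_add hl0]; congr 1; push_cast; ring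
        rw [h5]; field_simp
      rw [mul_right_comm, h4, mul_assoc]
    have h2 : ∀ ξ : E n, ENNReal.ofReal ((K * ‖ξ‖ ^ a) ^ (r - 3 + 1) / (r - 3 + 1)) * ‖F ξ‖ₑ ^ 2 =
        ENNReal.ofReal (K ^ (r - 2) / (r - 2)) *
          (ENNReal.ofReal (‖ξ‖ ^ (2 * σ)) * ‖F ξ‖ₑ ^ 2) := by
      intro ξ
      have e : r - 3 + 1 = r - 2 := by ring
      rw [e, Real.mul_rpow hK0.le (by positivity), ← Real.rpow_mul (norm_nonneg _), har,
        mul_div_right_comm, ENNReal.ofReal_mul (by positivity), mul_assoc]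
    simp_rw [h2] at h1
    rw [lintegral_const_mul' _ _ ENNReal.ofReal_ne_top] at h1
    calc _ ≤ ENNReal.ofReal r * (4 * (ENNReal.ofReal (K ^ (r - 2) / (r - 2)) *
          ENNReal.ofReal (N ^ 2))) := by
            refine mul_le_mul_right (h1.trans ?_) _
            gcongr
      _ = _ := by
        have : (4 : ℝ≥0∞) = ENNReal.ofReal 4 := by norm_num
        rw [this, ← ENNReal.ofReal_mul (by positivity), ← ENNReal.ofReal_mul (by positivity),
          ← ENNReal.ofReal_mul (by positivity)]
        congr 1
        have h5 : N ^ r = N ^ (r - 2) * N ^ 2 := by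
          rw [← Real.rpow_natCast, ← Real.rpow_add hN]; congr 1; push_cast; ring
        rw [hC, hK, h5, ← mul_assoc 2 c N, Real.mul_rpow (by positivity) hN.le]
        ring
  rw [eLpNorm_eq_lintegral_rpow_enorm_toReal (by simpa using hr0) ENNReal.ofReal_ne_top,
    ENNReal.toReal_ofReal hr0.le]
  have h6 : ∀ x, ‖f x‖ₑ ^ r = ENNReal.ofReal (‖f x‖ ^ r) := fun x ↦ by
    rw [← ofReal_norm, ENNReal.ofReal_rpow_of_nonneg (norm_nonneg _) hr0.le]
  simp_rw [h6]
  refine (ENNReal.rpow_le_rpow key (by positivity)).trans (le_of_eq ?_)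
  rw [ENNReal.ofReal_rpow_of_nonneg (by positivity) (by positivity),
    Real.mul_rpow hC0.le (by positivity), ← Real.rpow_mul hN.le, mul_one_div_cancel hr0.ne',
    Real.rpow_one]

end Fourier


/-! ### Sobolev embeddings and multiplication by the potential -/

section Embedding

variable {n : ℕ} {s : ℝ} {Ω : Set (E n)}

/-- The factor 2π of the Fourier convention is at least 1 and only helps. Allowing σ < s serves the
critical case. -/
theorem norm_rpow_le_besselSymbol {σ : ℝ} (hσ0 : 0 ≤ σ) (hσ : σ ≤ s) (ξ : E n) :
    ‖ξ‖ ^ σ ≤ besselSymbol n s ξ := by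
  have hπ : (1 : ℝ) ≤ 2 * π := by linarith [Real.pi_gt_three]
  calc ‖ξ‖ ^ σ = (‖ξ‖ ^ 2) ^ (σ / 2) := by
        rw [← Real.rpow_natCast, ← Real.rpow_mul (norm_nonneg _)]; congr 1; push_cast; ring
    _ ≤ (1 + (2 * π * ‖ξ‖) ^ 2) ^ (σ / 2) := by
        refine Real.rpow_le_rpow (by positivity) ?_ (by positivity)
        rw [mul_pow]
        have : (1 : ℝ) ≤ (2 * π) ^ 2 := one_le_pow₀ hπ
        nlinarith [sq_nonneg ‖ξ‖]
    _ ≤ _ := Real.rpow_le_rpow_of_exponent_le (by linarith [sq_nonneg (2 * π * ‖ξ‖)]) (by linarith)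

theorem lintegral_norm_rpow_mul_fourier_le (hs : 0 ≤ s) {σ : ℝ} (hσ0 : 0 ≤ σ) (hσ : σ ≤ s)
    (u : SobolevSpace n s) :
    ∫⁻ ξ, ENNReal.ofReal (‖ξ‖ ^ (2 * σ)) * ‖𝓕 (SobolevSpace.toL2 n hs u) ξ‖ₑ ^ 2 ≤
      ENNReal.ofReal (‖u‖ ^ 2) := by
  rw [SobolevSpace.norm_eq, ← Lp.norm_fourier_eq (SobolevSpace.besselL2 n s u),
    ENNReal.ofReal_pow (norm_nonneg _), ofReal_norm, ← lintegral_sq_enorm_eq]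
  refine lintegral_mono_ae ?_
  filter_upwards [fourier_besselL2_ae hs u] with ξ h
  rw [h, enorm_mul, mul_pow]
  gcongr
  rw [← ofReal_norm, Complex.norm_real, Real.norm_of_nonneg (besselSymbol_pos n s ξ).le,
    ← ENNReal.ofReal_pow (besselSymbol_pos n s ξ).le]
  apply ENNReal.ofReal_le_ofReal
  rw [mul_comm, Real.rpow_mul (norm_nonneg _), Real.rpow_two]
  gcongr
  exact norm_rpow_le_besselSymbol hσ0 hσ ξ

/-- `exists_sobolev_constant` is stated for a positive bound N, so the zero element is treated
apart. -/
theorem eLpNorm_toL2_le_of_pos (hs : 0 ≤ s) {r : ℝ≥0∞} {C : ℝ}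
    (h : ∀ u : SobolevSpace n s, 0 < ‖u‖ →
      eLpNorm (SobolevSpace.toL2 n hs u) r volume ≤ ENNReal.ofReal (C * ‖u‖))
    (u : SobolevSpace n s) :
    eLpNorm (SobolevSpace.toL2 n hs u) r volume ≤ ENNReal.ofReal (C * ‖u‖) := by
  rcases (norm_nonneg u).eq_or_lt with h0 | h0
  · have hu : u = 0 := norm_eq_zero.mp h0.symm
    rw [hu, map_zero, eLpNorm_congr_ae (Lp.coeFn_zero ℂ 2 (volume : Measure (E n))), eLpNorm_zero]
    exact zero_le
  · exact h u h0

/-- The Sobolev embedding in the subcritical case. -/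
theorem exists_eLpNorm_toL2_le (hn : 0 < n) (hs : 0 ≤ s) {σ : ℝ} (hσ0 : 0 < σ) (hσ : σ ≤ s)
    (hσn : 2 * σ < n) :
    ∃ C : ℝ, 0 ≤ C ∧ ∀ u : SobolevSpace n s,
      eLpNorm (SobolevSpace.toL2 n hs u) (ENNReal.ofReal (2 * n / (n - 2 * σ))) volume ≤
        ENNReal.ofReal (C * ‖u‖) := by
  obtain ⟨C, hC, h⟩ := exists_sobolev_constant hn hσ0 hσn rfl
  refine ⟨C, hC.le, eLpNorm_toL2_le_of_pos hs fun u hu ↦ ?_⟩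
  have h1 := h (𝓕 (SobolevSpace.toL2 n hs u)) ‖u‖ hu
    (lintegral_norm_rpow_mul_fourier_le hs hσ0.le hσ u)
  rwa [fourierInv_fourier_eq (F := Lp ℂ 2 (volume : Measure (E n)))] at h1

theorem memLp_besselSymbol_neg (hs : (n : ℝ) < 2 * s) :
    MemLp (fun ξ : E n ↦ besselSymbol n (-s) ξ) 2 volume := by
  have hs0 : 0 < s := by have : (0 : ℝ) ≤ n := n.cast_nonneg; linarith
  have hmeas : AEStronglyMeasurable (fun ξ : E n ↦ besselSymbol n (-s) ξ) volume := by
    unfold besselSymbol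
    exact (by fun_prop : Measurable fun ξ : E n ↦
      (1 + (2 * π * ‖ξ‖) ^ 2) ^ (-s / 2)).aestronglyMeasurable
  rw [memLp_two_iff_integrable_sq_norm hmeas]
  have h := integrable_rpow_neg_one_add_norm_sq (E := E n) (r := 2 * s) (μ := volume) (by simpa using hs)
  refine h.mono' (hmeas.norm.pow 2) (Eventually.of_forall fun ξ ↦ ?_)
  have hπ : (1 : ℝ) ≤ 2 * π := by linarith [Real.pi_gt_three]
  rw [Real.norm_of_nonneg (sq_nonneg _), Real.norm_of_nonneg (besselSymbol_pos n _ ξ).le, besselSymbol,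
    ← Real.rpow_natCast, ← Real.rpow_mul (by positivity)]
  have e : -s / 2 * ((2 : ℕ) : ℝ) = -(2 * s) / 2 := by push_cast; ring
  rw [e]
  refine Real.rpow_le_rpow_of_nonpos (by positivity) ?_ (by linarith)
  rw [mul_pow]
  have : (1 : ℝ) ≤ (2 * π) ^ 2 := one_le_pow₀ hπ
  nlinarith [sq_nonneg ‖ξ‖]

/-- The Sobolev embedding in the supercritical case. -/
theorem exists_eLpNorm_top_toL2_le (hs : 0 ≤ s) (hsn : (n : ℝ) < 2 * s) :
    ∃ C : ℝ, 0 ≤ C ∧ ∀ u : SobolevSpace n s,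
      eLpNorm (SobolevSpace.toL2 n hs u) ⊤ volume ≤ ENNReal.ofReal (C * ‖u‖) := by
  have hb := memLp_besselSymbol_neg hsn
  refine ⟨(eLpNorm (fun ξ : E n ↦ besselSymbol n (-s) ξ) 2 volume).toReal, ENNReal.toReal_nonneg,
    fun u ↦ ?_⟩
  rw [ENNReal.ofReal_mul ENNReal.toReal_nonneg, ENNReal.ofReal_toReal hb.2.ne]
  -- The function is bounded by the L¹ norm of its Fourier transform, which is the product of two L²
  -- functions: the symbol of order -s, square integrable because 2s > n, and the transform of ⟨D⟩^s
  -- u.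
  have h1 := enorm_fourierInv_le (𝓕 (SobolevSpace.toL2 n hs u))
  rw [fourierInv_fourier_eq (F := Lp ℂ 2 (volume : Measure (E n)))] at h1
  rw [eLpNorm_exponent_top]
  refine (essSup_le_of_ae_le _ h1).trans ?_
  have h2 : ∫⁻ ξ, ‖𝓕 (SobolevSpace.toL2 n hs u) ξ‖ₑ =
      eLpNorm (fun ξ ↦ besselSymbol n (-s) ξ • 𝓕 (SobolevSpace.besselL2 n s u) ξ) 1 volume := by
    rw [eLpNorm_one_eq_lintegral_enorm]
    refine lintegral_congr_ae ?_
    filter_upwards [fourier_toL2_ae hs u] with ξ h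
    rw [h, ← Complex.coe_smul, smul_eq_mul]
  rw [h2]
  refine (eLpNorm_smul_le_mul_eLpNorm (p := 2) (q := 2) (r := 1) (Lp.aestronglyMeasurable _) hb.1).trans ?_
  rw [← Lp.enorm_def, ← ofReal_norm (𝓕 (SobolevSpace.besselL2 n s u)), Lp.norm_fourier_eq,
    SobolevSpace.norm_eq]

theorem holderTriple_sobolev {σ : ℝ} (hσ0 : 0 < σ) (hσn : 2 * σ < n) :
    ENNReal.HolderTriple (ENNReal.ofReal (n / σ)) (ENNReal.ofReal (2 * n / (n - 2 * σ))) 2 := by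
  have hd : 0 < (n : ℝ) - 2 * σ := by linarith
  have hn0 : (0 : ℝ) < n := by linarith
  constructor
  have h2 : (2 : ℝ≥0∞) = ENNReal.ofReal 2 := by norm_num
  rw [h2, ← ENNReal.ofReal_inv_of_pos (by positivity), ← ENNReal.ofReal_inv_of_pos (by positivity),
    ← ENNReal.ofReal_inv_of_pos (by positivity), ← ENNReal.ofReal_add (by positivity) (by positivity)]
  congr 1
  field_simp
  ring

/-- For every admissible exponent of the potential, the Sobolev embedding provides the conjugate
integrability. -/
theorem AdmissibleExponent.exists_embedding {p : ℝ≥0∞} (hp : AdmissibleExponent n s p) (hn : 0 < n)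
    (hs : 0 < s) : ∃ p₀ r : ℝ≥0∞, ENNReal.HolderTriple p₀ r 2 ∧ p₀ ≤ p ∧
      ∃ C : ℝ, 0 ≤ C ∧ ∀ u : SobolevSpace n s,
        eLpNorm (SobolevSpace.toL2 n hs.le u) r volume ≤ ENNReal.ofReal (C * ‖u‖) := by
  rcases lt_trichotomy (2 * s) n with h | h | h
  · exact ⟨_, _, holderTriple_sobolev hs h, hp.subcritical h,
      exists_eLpNorm_toL2_le hn hs.le hs le_rfl h⟩
  -- For 2s = n there is room between 2 and p. A finite y in between gives the order σ = n / y < s,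
  -- which is subcritical and has p₀ = n / σ = y ≤ p.
  · obtain ⟨y, hy2, hyp⟩ := exists_between (hp.critical h)
    have hyt : y ≠ ⊤ := (hyp.trans_le le_top).ne
    have hn0 : (0 : ℝ) < n := by exact_mod_cast hn
    have hy : 2 < y.toReal := by
      have := (ENNReal.toReal_lt_toReal (by norm_num) hyt).mpr hy2
      simpa using this
    have hσ : 2 * (n / y.toReal) < n := by
      rw [mul_div_assoc', div_lt_iff₀ (by linarith)]; nlinarith
    refine ⟨_, _, holderTriple_sobolev (σ := n / y.toReal) (by positivity) hσ, ?_,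
      exists_eLpNorm_toL2_le hn hs.le (by positivity) (by linarith) hσ⟩
    rw [div_div_cancel₀ hn0.ne', ENNReal.ofReal_toReal hyt]
    exact hyp.le
  · exact ⟨2, ⊤, inferInstance, hp.supercritical h, exists_eLpNorm_top_toL2_le hs.le h⟩

theorem eLpNorm_incl_le (hs : 0 ≤ s) (r : ℝ≥0∞) (u : tildeSobolev s Ω) :
    eLpNorm (incl hs Ω u) r (volume.restrict Ω) ≤ eLpNorm (SobolevSpace.toL2 n hs u.1) r volume := by
  refine le_trans (eLpNorm_mono_ae ?_) (eLpNorm_mono_measure _ Measure.restrict_le_self)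
  filter_upwards [incl_ae hs u] with x hx
  rw [hx]
  exact Complex.abs_re_le_norm _

/-- Hölder with the exponents p₀ and r, after lowering p to p₀ on a finite measure space; K is the
resulting power of the total mass. -/
theorem eLpNorm_mul_le_of_le {α : Type*} [MeasurableSpace α] {μ : Measure α} [IsFiniteMeasure μ]
    {p₀ p r : ℝ≥0∞} [ENNReal.HolderTriple p₀ r 2] (hp₀ : p₀ ≤ p) :
    ∃ K : ℝ, 0 ≤ K ∧ ∀ (g f : α → ℝ) (M : ℝ≥0) (B : ℝ), 0 ≤ B → AEStronglyMeasurable g μ →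
      eLpNorm g p μ ≤ M → AEStronglyMeasurable f μ → eLpNorm f r μ ≤ ENNReal.ofReal B →
      eLpNorm (fun x ↦ g x * f x) 2 μ ≤ ENNReal.ofReal (K * M * B) := by
  have hp00 : p₀ ≠ 0 := by
    rintro rfl
    have := ENNReal.HolderTriple.inv_add_inv_eq_inv 0 r 2
    rw [ENNReal.inv_zero, top_add] at this
    exact ENNReal.inv_ne_top.mpr two_ne_zero this.symm
  have he0 : 0 ≤ 1 / p₀.toReal - 1 / p.toReal := by
    rw [sub_nonneg]
    by_cases hpt : p = ⊤
    · simp [hpt]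
    · have hp0t : p₀ ≠ ⊤ := (hp₀.trans_lt (lt_top_iff_ne_top.mpr hpt)).ne
      exact one_div_le_one_div_of_le (ENNReal.toReal_pos hp00 hp0t) (ENNReal.toReal_mono hpt hp₀)
  have hve : μ univ ^ (1 / p₀.toReal - 1 / p.toReal) ≠ ⊤ :=
    ENNReal.rpow_ne_top_of_nonneg he0 (measure_ne_top _ _)
  refine ⟨(μ univ ^ (1 / p₀.toReal - 1 / p.toReal)).toReal, ENNReal.toReal_nonneg,
    fun g f M B hB hg hgM hf hfB ↦ ?_⟩
  have h1 : eLpNorm (fun x ↦ g x * f x) 2 μ ≤ eLpNorm g p₀ μ * eLpNorm f r μ := by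
    have e : (fun x ↦ g x * f x) = g • f := by ext x; rfl
    rw [e]
    exact eLpNorm_smul_le_mul_eLpNorm (p := p₀) (q := r) (r := 2) hf hg
  have h2 := (eLpNorm_le_eLpNorm_mul_rpow_measure_univ hp₀ hg).trans
    (mul_le_mul_left hgM (μ univ ^ (1 / p₀.toReal - 1 / p.toReal)))
  refine h1.trans ((mul_le_mul' h2 hfB).trans (le_of_eq ?_))
  rw [ENNReal.ofReal_mul (by positivity), ENNReal.ofReal_mul ENNReal.toReal_nonneg,
    ENNReal.ofReal_toReal hve, ENNReal.ofReal_coe_nnreal, mul_comm (M : ℝ≥0∞)]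

/-- Multiplication by an admissible potential maps `H̃^s(Ω)` to `L²(Ω)`. -/
theorem exists_potential_bound (hn : 0 < n) (hs : 0 < s) (hΩ : Bornology.IsBounded Ω) {p : ℝ≥0∞}
    (hp : AdmissibleExponent n s p) : ∃ C : ℝ, 0 ≤ C ∧ ∀ (g : E n → ℝ) (M : ℝ≥0),
      MemLp g p (volume.restrict Ω) → eLpNorm g p (volume.restrict Ω) ≤ M → ∀ u : tildeSobolev s Ω,
        MemLp (fun x ↦ g x * incl hs.le Ω u x) 2 (volume.restrict Ω) ∧
          eLpNorm (fun x ↦ g x * incl hs.le Ω u x) 2 (volume.restrict Ω) ≤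
            ENNReal.ofReal (C * M * ‖u‖) := by
  obtain ⟨p₀, r, hH, hp₀, C, hC, h⟩ := hp.exists_embedding hn hs
  have : IsFiniteMeasure ((volume : Measure (E n)).restrict Ω) :=
    ⟨by rw [Measure.restrict_apply_univ]; exact hΩ.measure_lt_top⟩
  obtain ⟨K, hK, hmul⟩ := eLpNorm_mul_le_of_le (μ := (volume : Measure (E n)).restrict Ω)
    (r := r) hp₀
  refine ⟨K * C, by positivity, fun g M hg hgM u ↦ ?_⟩
  have h2 := hmul g (incl hs.le Ω u) M (C * ‖u.1‖) (by positivity) hg.1 hgM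
    (Lp.aestronglyMeasurable _) ((eLpNorm_incl_le hs.le r u).trans (h u.1))
  have h3 : K * M * (C * ‖u.1‖) = K * C * M * ‖u.1‖ := by ring
  rw [h3] at h2
  exact ⟨⟨hg.1.mul (Lp.aestronglyMeasurable _), h2.trans_lt ENNReal.ofReal_lt_top⟩, h2⟩

end Embedding


/-! ### Weak derivatives tested with vectors -/

section WeakForm

theorem IsTimeTestFunction.deriv {T : ℝ} {η : ℝ → ℝ} (h : IsTimeTestFunction T η) :
    IsTimeTestFunction T (deriv η) :=
  ⟨(contDiff_infty_iff_deriv.mp h.1).2, h.2.1.deriv, (tsupport_deriv_subset).trans h.2.2⟩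

variable {V H : Type*} [NormedAddCommGroup V] [InnerProductSpace ℝ V] [CompleteSpace V]
  [NormedAddCommGroup H] [InnerProductSpace ℝ H] [CompleteSpace H]

/-- The weak time derivative of `gram ι (w t)` may be tested with the vectors of `V`. -/
theorem isWeakTimeDeriv_gram_iff (ι : V →L[ℝ] H) {T : ℝ} (w F : Lp V 2 (timeMeasure T)) :
    IsWeakTimeDeriv T (fun t ↦ gram ι (w t)) F ↔
      ∀ v : V, ∀ η : ℝ → ℝ, IsTimeTestFunction T η →
        ∫ t in Ioo 0 T, deriv η t * inner ℝ (ι (w t)) (ι v) =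
          -∫ t in Ioo 0 T, η t * inner ℝ (F t) v := by
  have iF := memLp_time_integrableOn (Lp.memLp F)
  have iw : IntegrableOn (fun t ↦ gram ι (w t)) (Ioo 0 T) :=
    memLp_time_integrableOn ((gram ι).comp_memLp' (Lp.memLp w))
  have e1 : ∀ v : V, ∀ η : ℝ → ℝ, IsTimeTestFunction T η →
      inner ℝ v (∫ t in Ioo 0 T, deriv η t • gram ι (w t)) =
        ∫ t in Ioo 0 T, deriv η t * inner ℝ (ι (w t)) (ι v) := fun v η hη ↦ by
    rw [← integral_inner (hη.deriv.integrableOn_smul iw)]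
    refine integral_congr_ae (Eventually.of_forall fun t ↦ ?_)
    simp only [inner_smul_right]
    rw [real_inner_comm, inner_gram]
  have e2 : ∀ v : V, ∀ η : ℝ → ℝ, IsTimeTestFunction T η →
      inner ℝ v (-∫ t in Ioo 0 T, η t • F t) = -∫ t in Ioo 0 T, η t * inner ℝ (F t) v :=
    fun v η hη ↦ by
    rw [inner_neg_right, ← integral_inner (hη.integrableOn_smul iF)]
    congr 1
    refine integral_congr_ae (Eventually.of_forall fun t ↦ ?_)
    simp only [inner_smul_right]
    rw [real_inner_comm]
  constructor
  · intro h v η hη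
    rw [← e1 v η hη, ← e2 v η hη, h η hη]
  · intro h η hη
    refine ext_inner_left ℝ fun v ↦ ?_
    rw [e1 v η hη, e2 v η hη, h v η hη]

omit [CompleteSpace V] in
theorem IsWeakTimeDeriv.sub_of_integrableOn {T : ℝ} {u w u' w' : ℝ → V} (hu : IsWeakTimeDeriv T u w)
    (hu' : IsWeakTimeDeriv T u' w') (iu : IntegrableOn u (Ioo 0 T)) (iw : IntegrableOn w (Ioo 0 T))
    (iu' : IntegrableOn u' (Ioo 0 T)) (iw' : IntegrableOn w' (Ioo 0 T)) :
    IsWeakTimeDeriv T (fun t ↦ u t - u' t) (fun t ↦ w t - w' t) := by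
  intro η hη
  simp_rw [smul_sub]
  rw [integral_sub (hη.deriv.integrableOn_smul iu) (hη.deriv.integrableOn_smul iu'),
    integral_sub (hη.integrableOn_smul iw) (hη.integrableOn_smul iw'), hu η hη, hu' η hη]
  abel

theorem IsWeakTimeDeriv.congr {X : Type*} [NormedAddCommGroup X] [NormedSpace ℝ X] {T : ℝ}
    {u w u' w' : ℝ → X} (h : IsWeakTimeDeriv T u w)
    (hu : u =ᵐ[timeMeasure T] u') (hw : w =ᵐ[timeMeasure T] w') : IsWeakTimeDeriv T u' w' := by
  intro η hη
  have h1 : ∫ t in Ioo 0 T, deriv η t • u' t = ∫ t in Ioo 0 T, deriv η t • u t :=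
    integral_congr_ae (hu.mono fun t ht ↦ by simp only [ht])
  have h2 : ∫ t in Ioo 0 T, η t • w' t = ∫ t in Ioo 0 T, η t • w t :=
    integral_congr_ae (hw.mono fun t ht ↦ by simp only [ht])
  rw [h1, h2, h η hη]

end WeakForm

/-! ### The potential as a time dependent bilinear form -/

section Potential

variable {n : ℕ} {s : ℝ} {Ω : Set (E n)} {T : ℝ} {q : E n → ℝ → ℝ}

/-- Local integrability of q on Ω × (0,T) enters through joint measurability, which the integral
over x inherits in t. -/
theorem aemeasurable_potentialForm (hs : 0 ≤ s)
    (hq : LocallyIntegrableOn (fun z : E n × ℝ ↦ q z.1 z.2) (Ω ×ˢ Ioo 0 T))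
    (u v : tildeSobolev s Ω) :
    AEMeasurable (fun t ↦ potentialForm hs q t u v) (timeMeasure T) := by
  have h1 := hq.aestronglyMeasurable
  rw [Measure.volume_eq_prod, ← Measure.prod_restrict] at h1
  have h2 := (h1.mul ((Lp.aestronglyMeasurable (incl hs Ω u)).comp_fst)).mul
    ((Lp.aestronglyMeasurable (incl hs Ω v)).comp_fst)
  exact h2.prod_swap.integral_prod_right'.aemeasurable

/-- The product q u is in L²(Ω), so v is needed only in the norm of H. This asymmetry is what lets
the energy control the potential term. -/
theorem potentialForm_props (hs : 0 ≤ s) {t M : ℝ}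
    (hq : ∀ u : tildeSobolev s Ω, MemLp (fun x ↦ q x t * incl hs Ω u x) 2 (volume.restrict Ω) ∧
      eLpNorm (fun x ↦ q x t * incl hs Ω u x) 2 (volume.restrict Ω) ≤ ENNReal.ofReal (M * ‖u‖))
    (hM : 0 ≤ M) (u v : tildeSobolev s Ω) :
    IntegrableOn (fun x ↦ q x t * incl hs Ω u x * incl hs Ω v x) Ω ∧
      |potentialForm hs q t u v| ≤ M * ‖u‖ * ‖incl hs Ω v‖ := by
  obtain ⟨h1, h2⟩ := hq u
  have hi := h1.integrable_mul (Lp.memLp (incl hs Ω v))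
  refine ⟨hi, ?_⟩
  have h3 : potentialForm hs q t u v = inner ℝ (incl hs Ω v) h1.toLp := by
    rw [L2.inner_def]
    refine integral_congr_ae ?_
    filter_upwards [h1.coeFn_toLp] with x hx
    rw [hx]; rfl
  rw [h3, mul_comm]
  refine (abs_real_inner_le_norm _ _).trans ?_
  gcongr
  rw [Lp.norm_toLp]
  exact ENNReal.toReal_le_of_le_ofReal (by positivity) h2

/-- The potential form at almost all times is a bounded bilinear form. -/
theorem exists_potential_bilin (hs : 0 ≤ s) {M : ℝ} (hM : 0 ≤ M)
    (hq : ∀ᵐ t ∂timeMeasure T, ∀ u : tildeSobolev s Ω,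
      MemLp (fun x ↦ q x t * incl hs Ω u x) 2 (volume.restrict Ω) ∧
      eLpNorm (fun x ↦ q x t * incl hs Ω u x) 2 (volume.restrict Ω) ≤ ENNReal.ofReal (M * ‖u‖)) :
    ∃ Q : ℝ → tildeSobolev s Ω →L[ℝ] tildeSobolev s Ω →L[ℝ] ℝ,
      (∀ t u v, |Q t u v| ≤ M * ‖u‖ * ‖incl hs Ω v‖) ∧
      ∀ᵐ t ∂timeMeasure T, ∀ u v, Q t u v = potentialForm hs q t u v := by
  have key : ∀ t, ∃ B : tildeSobolev s Ω →L[ℝ] tildeSobolev s Ω →L[ℝ] ℝ,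
      (∀ u v, |B u v| ≤ M * ‖u‖ * ‖incl hs Ω v‖) ∧
      ((∀ u : tildeSobolev s Ω, MemLp (fun x ↦ q x t * incl hs Ω u x) 2 (volume.restrict Ω) ∧
        eLpNorm (fun x ↦ q x t * incl hs Ω u x) 2 (volume.restrict Ω) ≤
          ENNReal.ofReal (M * ‖u‖)) → ∀ u v, B u v = potentialForm hs q t u v) := by
    intro t
    by_cases ht : ∀ u : tildeSobolev s Ω,
        MemLp (fun x ↦ q x t * incl hs Ω u x) 2 (volume.restrict Ω) ∧
        eLpNorm (fun x ↦ q x t * incl hs Ω u x) 2 (volume.restrict Ω) ≤ ENNReal.ofReal (M * ‖u‖)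
    swap
    -- At the exceptional times the form is set to zero, so that the bound holds at every time.
    · exact ⟨0, fun u v ↦ by simp; positivity, fun h ↦ absurd h ht⟩
    have hp := potentialForm_props hs ht hM
    refine ⟨LinearMap.mkContinuous₂ (LinearMap.mk₂ ℝ (potentialForm hs q t) ?_ ?_ ?_ ?_)
      (M * ‖incl hs Ω‖) ?_, fun u v ↦ (hp u v).2, fun _ u v ↦ rfl⟩
    · intro u u' v
      rw [potentialForm, potentialForm, potentialForm, ← integral_add (hp u v).1 (hp u' v).1]
      refine integral_congr_ae ?_
      rw [map_add]
      filter_upwards [Lp.coeFn_add (incl hs Ω u) (incl hs Ω u')] with x hx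
      rw [hx, Pi.add_apply]; ring
    · intro c u v
      rw [potentialForm, potentialForm, smul_eq_mul, ← integral_const_mul]
      refine integral_congr_ae ?_
      rw [map_smul]
      filter_upwards [Lp.coeFn_smul c (incl hs Ω u)] with x hx
      rw [hx, Pi.smul_apply, smul_eq_mul]; ring
    · intro u v v'
      rw [potentialForm, potentialForm, potentialForm, ← integral_add (hp u v).1 (hp u v').1]
      refine integral_congr_ae ?_
      rw [map_add]
      filter_upwards [Lp.coeFn_add (incl hs Ω v) (incl hs Ω v')] with x hx
      rw [hx, Pi.add_apply]; ring
    · intro c u v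
      rw [potentialForm, potentialForm, smul_eq_mul, ← integral_const_mul]
      refine integral_congr_ae ?_
      rw [map_smul]
      filter_upwards [Lp.coeFn_smul c (incl hs Ω v)] with x hx
      rw [hx, Pi.smul_apply, smul_eq_mul]; ring
    · intro u v
      refine (hp u v).2.trans ?_
      calc M * ‖u‖ * ‖incl hs Ω v‖ ≤ M * ‖u‖ * (‖incl hs Ω‖ * ‖v‖) := by
            gcongr; exact (incl hs Ω).le_opNorm v
        _ = _ := by ring
  choose Q hQ1 hQ2 using key
  exact ⟨Q, hQ1, hq.mono fun t ht ↦ hQ2 t ht⟩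

end Potential


/-! ### Translation between the problem and its Riesz representation -/

section Dual

variable {V H : Type*} [NormedAddCommGroup V] [InnerProductSpace ℝ V] [CompleteSpace V]
  [NormedAddCommGroup H] [InnerProductSpace ℝ H] [CompleteSpace H]

theorem exists_dual_isWeakTimeDeriv (ι : V →L[ℝ] H) {T : ℝ} (w F : Lp V 2 (timeMeasure T))
    (h : IsWeakTimeDeriv T (fun t ↦ gram ι (w t)) F) :
    ∃ z : Lp (StrongDual ℝ V) 2 (timeMeasure T),
      IsWeakTimeDeriv T (fun t ↦ innerSL ℝ (ι (w t)) ∘L ι) z := by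
  -- The Riesz map sends ι†ι x to the functional ⟨ι x, ι ·⟩, so a derivative represented in V
  -- becomes one in V*.
  let J : V →L[ℝ] StrongDual ℝ V := LinearMap.mkContinuous₂ (innerₗ V) 1
    (fun x y ↦ by rw [one_mul]; exact norm_inner_le_norm x y)
  have iw : IntegrableOn (fun t ↦ gram ι (w t)) (Ioo 0 T) :=
    memLp_time_integrableOn ((gram ι).comp_memLp' (Lp.memLp w))
  have hJ : MemLp (fun t ↦ J (F t)) 2 (timeMeasure T) := J.comp_memLp' (Lp.memLp F)
  refine ⟨hJ.toLp, (h.clm_comp J iw (memLp_time_integrableOn (Lp.memLp F))).congr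
    (Eventually.of_forall fun t ↦ ?_) hJ.coeFn_toLp.symm⟩
  ext v
  exact inner_gram ι (w t) v

end Dual

section Solution

variable {n : ℕ} {s : ℝ} {Ω : Set (E n)} {T : ℝ} {q : E n → ℝ → ℝ}

/-- The right hand side `h - (-Δ)^s ∂ₜu - (-Δ)^s u - q u` of the equation, represented in `H̃^s(Ω)`. -/
noncomputable def weakForce (hs : 0 ≤ s)
    (QX : Lp (tildeSobolev s Ω) 2 (timeMeasure T) →L[ℝ] Lp (tildeSobolev s Ω) 2 (timeMeasure T))
    (h : Lp (SobolevOn (-s) Ω) 2 (timeMeasure T)) (u u' : Lp (tildeSobolev s Ω) 2 (timeMeasure T)) :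
    Lp (tildeSobolev s Ω) 2 (timeMeasure T) :=
  (dualityCLM s Ω).compLpL 2 (timeMeasure T) h -
    (gram (halfLapCLM hs Ω)).compLpL 2 (timeMeasure T) u' -
    (gram (halfLapCLM hs Ω)).compLpL 2 (timeMeasure T) u - QX u

/-- `QX` is multiplication by the potential `q`, represented in `H̃^s(Ω)`, and it is dominated by the
bound `M`. -/
structure IsPotentialOperator (hs : 0 ≤ s) (q : E n → ℝ → ℝ) (M : ℝ)
    (QX : Lp (tildeSobolev s Ω) 2 (timeMeasure T) →L[ℝ] Lp (tildeSobolev s Ω) 2 (timeMeasure T)) :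
    Prop where
  inner_ae : ∀ u v : Lp (tildeSobolev s Ω) 2 (timeMeasure T),
    ∀ᵐ t ∂timeMeasure T, inner ℝ (QX u t) (v t) = potentialForm hs q t (u t) (v t)
  abs_le : ∀ u v : Lp (tildeSobolev s Ω) 2 (timeMeasure T),
    ∀ᵐ t ∂timeMeasure T, |inner ℝ (QX u t) (v t)| ≤ M * ‖u t‖ * ‖incl hs Ω (v t)‖

theorem IsPotentialOperator.inner_const_ae {hs : 0 ≤ s} {M : ℝ}
    {QX : Lp (tildeSobolev s Ω) 2 (timeMeasure T) →L[ℝ] Lp (tildeSobolev s Ω) 2 (timeMeasure T)}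
    (hQ : IsPotentialOperator hs q M QX) (u : Lp (tildeSobolev s Ω) 2 (timeMeasure T))
    (v : tildeSobolev s Ω) :
    ∀ᵐ t ∂timeMeasure T, inner ℝ (QX u t) v = potentialForm hs q t (u t) v := by
  have hv : MemLp (fun _ : ℝ ↦ v) 2 (timeMeasure T) := memLp_const v
  filter_upwards [hQ.inner_ae u hv.toLp, hv.coeFn_toLp] with t h1 h2
  rwa [h2] at h1

theorem inner_weakForce_ae {hs : 0 ≤ s} {M : ℝ}
    {QX : Lp (tildeSobolev s Ω) 2 (timeMeasure T) →L[ℝ] Lp (tildeSobolev s Ω) 2 (timeMeasure T)}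
    (hQ : IsPotentialOperator hs q M QX) (h : Lp (SobolevOn (-s) Ω) 2 (timeMeasure T))
    (u u' : Lp (tildeSobolev s Ω) 2 (timeMeasure T)) (v : tildeSobolev s Ω) :
    ∀ᵐ t ∂timeMeasure T, inner ℝ (weakForce hs QX h u u' t) v =
      duality (h t) v - (energyForm hs (u' t) v + energyForm hs (u t) v +
        potentialForm hs q t (u t) v) := by
  have a1 := Lp.coeFn_sub ((dualityCLM s Ω).compLpL 2 (timeMeasure T) h -
    (gram (halfLapCLM hs Ω)).compLpL 2 (timeMeasure T) u' -
    (gram (halfLapCLM hs Ω)).compLpL 2 (timeMeasure T) u) (QX u)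
  have a2 := Lp.coeFn_sub ((dualityCLM s Ω).compLpL 2 (timeMeasure T) h -
    (gram (halfLapCLM hs Ω)).compLpL 2 (timeMeasure T) u')
    ((gram (halfLapCLM hs Ω)).compLpL 2 (timeMeasure T) u)
  have a3 := Lp.coeFn_sub ((dualityCLM s Ω).compLpL 2 (timeMeasure T) h)
    ((gram (halfLapCLM hs Ω)).compLpL 2 (timeMeasure T) u')
  filter_upwards [a1, a2, a3, (dualityCLM s Ω).coeFn_compLpL h,
    (gram (halfLapCLM hs Ω)).coeFn_compLpL u', (gram (halfLapCLM hs Ω)).coeFn_compLpL u,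
    hQ.inner_const_ae u v] with t b1 b2 b3 b4 b5 b6 b7
  have e : ∀ x y : tildeSobolev s Ω, inner ℝ (gram (halfLapCLM hs Ω) x) y = energyForm hs x y :=
    fun x y ↦ inner_gram _ x y
  rw [weakForce, b1, Pi.sub_apply, b2, Pi.sub_apply, b3, Pi.sub_apply, b4, b5, b6, inner_sub_left,
    inner_sub_left, inner_sub_left, b7, e, e, inner_dualityCLM]
  ring

theorem integrableOn_duality (h : Lp (SobolevOn (-s) Ω) 2 (timeMeasure T))
    (v : Lp (tildeSobolev s Ω) 2 (timeMeasure T)) :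
    IntegrableOn (fun t ↦ duality (h t) (v t)) (Ioo 0 T) := by
  have h1 := integrable_inner_of_memLp ((dualityCLM s Ω).comp_memLp' (Lp.memLp h)) (Lp.memLp v)
  refine h1.congr (Eventually.of_forall fun t ↦ ?_)
  exact inner_dualityCLM (h t) (v t)

theorem integrableOn_inner_const (f : Lp (tildeSobolev s Ω) 2 (timeMeasure T))
    (v : tildeSobolev s Ω) : IntegrableOn (fun t ↦ inner ℝ (f t) v) (Ioo 0 T) :=
  integrable_inner_of_memLp (Lp.memLp f) (memLp_const v)

/-- The equation, tested with `v ∈ H̃^s(Ω)`, is an equation between functions with values in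
`H̃^s(Ω)`. -/
theorem isWeakTimeDeriv_weakForce_iff {hs : 0 ≤ s} {M : ℝ}
    {QX : Lp (tildeSobolev s Ω) 2 (timeMeasure T) →L[ℝ] Lp (tildeSobolev s Ω) 2 (timeMeasure T)}
    (hQ : IsPotentialOperator hs q M QX) (h : Lp (SobolevOn (-s) Ω) 2 (timeMeasure T))
    (u u' : Lp (tildeSobolev s Ω) 2 (timeMeasure T)) :
    IsWeakTimeDeriv T (fun t ↦ gram (incl hs Ω) (u' t)) (weakForce hs QX h u u') ↔
      ∀ v : tildeSobolev s Ω, ∀ η : ℝ → ℝ, IsTimeTestFunction T η →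
        -(∫ t in Ioo 0 T, deriv η t * inner ℝ (incl hs Ω (u' t)) (incl hs Ω v)) +
          ∫ t in Ioo 0 T, η t * (energyForm hs (u' t) v + energyForm hs (u t) v +
            potentialForm hs q t (u t) v) =
        ∫ t in Ioo 0 T, η t * duality (h t) v := by
  rw [isWeakTimeDeriv_gram_iff]
  refine forall_congr' fun v ↦ forall_congr' fun η ↦ imp_congr_right fun hη ↦ ?_
  have iF := hη.integrableOn_smul (integrableOn_inner_const (weakForce hs QX h u u') v)
  have id : IntegrableOn (fun t ↦ η t • duality (h t) v) (Ioo 0 T) := by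
    have h1 := integrableOn_inner_const ((dualityCLM s Ω).compLpL 2 (timeMeasure T) h) v
    refine hη.integrableOn_smul (h1.congr ?_)
    filter_upwards [(dualityCLM s Ω).coeFn_compLpL h] with t ht
    rw [ht, inner_dualityCLM]
  have e1 : ∫ t in Ioo 0 T, η t * (energyForm hs (u' t) v + energyForm hs (u t) v +
      potentialForm hs q t (u t) v) = ∫ t in Ioo 0 T, (η t • duality (h t) v -
        η t • inner ℝ (weakForce hs QX h u u' t) v) := by
    refine integral_congr_ae ?_
    filter_upwards [inner_weakForce_ae hQ h u u' v] with t ht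
    rw [ht, smul_eq_mul, smul_eq_mul]; ring
  rw [e1, integral_sub id iF]
  simp only [smul_eq_mul]
  constructor
  · intro h1; rw [h1]; ring
  · intro h1; linarith

theorem memW_of_isWeakTimeDeriv (hs : 0 ≤ s) (u' F : Lp (tildeSobolev s Ω) 2 (timeMeasure T))
    (h : IsWeakTimeDeriv T (fun t ↦ gram (incl hs Ω) (u' t)) F) : MemW hs u' :=
  exists_dual_isWeakTimeDeriv (incl hs Ω) u' F h

theorem exterior_of_tildeSobolev (hs : 0 ≤ s) (hΩ : IsOpen Ω) (u : tildeSobolev s Ω) :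
    ∀ᵐ x ∂volume.restrict (closure Ω)ᶜ, SobolevSpace.toL2 n hs u.1 x = 0 :=
  ae_restrict_of_ae_restrict_of_subset (compl_subset_compl.mpr subset_closure)
    (toL2_eq_zero_ae_compl hs hΩ.measurableSet u)

theorem IsSolution.of_weak {hs : 0 ≤ s} (hΩ : IsOpen Ω) {M : ℝ}
    {QX : Lp (tildeSobolev s Ω) 2 (timeMeasure T) →L[ℝ] Lp (tildeSobolev s Ω) 2 (timeMeasure T)}
    (hQ : IsPotentialOperator hs q M QX) {h : Lp (SobolevOn (-s) Ω) 2 (timeMeasure T)}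
    {u u' : Lp (tildeSobolev s Ω) 2 (timeMeasure T)} {u₀ : tildeSobolev s Ω}
    {u₁ : Lp ℝ 2 (volume.restrict Ω)} (h1 : IsWeakTimeDeriv T u u')
    (h2 : IsWeakTimeDeriv T (fun t ↦ gram (incl hs Ω) (u' t)) (weakForce hs QX h u u'))
    (h3 : ∃ U, IsContinuousRep T u U ∧ U 0 = u₀)
    (h4 : ∃ U₁, IsContinuousRep T (fun t ↦ incl hs Ω (u' t)) U₁ ∧ U₁ 0 = u₁) :
    IsSolution hs q u₀ u₁ h u u' where
  deriv_eq := h1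
  deriv_mem := memW_of_isWeakTimeDeriv hs u' _ h2
  equation := (isWeakTimeDeriv_weakForce_iff hQ h u u').mp h2
  exterior := Eventually.of_forall fun t ↦ exterior_of_tildeSobolev hs hΩ (u t)
  initial := h3
  initial_deriv := h4

theorem IsSolution.weak {hs : 0 ≤ s} {M : ℝ}
    {QX : Lp (tildeSobolev s Ω) 2 (timeMeasure T) →L[ℝ] Lp (tildeSobolev s Ω) 2 (timeMeasure T)}
    (hQ : IsPotentialOperator hs q M QX) {h : Lp (SobolevOn (-s) Ω) 2 (timeMeasure T)}
    {u u' : Lp (tildeSobolev s Ω) 2 (timeMeasure T)} {u₀ : tildeSobolev s Ω}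
    {u₁ : Lp ℝ 2 (volume.restrict Ω)} (h1 : IsSolution hs q u₀ u₁ h u u') :
    IsWeakTimeDeriv T (fun t ↦ gram (incl hs Ω) (u' t)) (weakForce hs QX h u u') :=
  (isWeakTimeDeriv_weakForce_iff hQ h u u').mpr h1.equation

theorem IsSolution.energyIdentity {hs : 0 ≤ s} (hT : 0 < T) {M : ℝ}
    {QX : Lp (tildeSobolev s Ω) 2 (timeMeasure T) →L[ℝ] Lp (tildeSobolev s Ω) 2 (timeMeasure T)}
    (hQ : IsPotentialOperator hs q M QX)
    (hq : ∀ᵐ t ∂timeMeasure T, ∀ u v : tildeSobolev s Ω,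
      IntegrableOn (fun x ↦ q x t * incl hs Ω u x * incl hs Ω v x) Ω)
    {h : Lp (SobolevOn (-s) Ω) 2 (timeMeasure T)}
    {u u' : Lp (tildeSobolev s Ω) 2 (timeMeasure T)} {u₀ : tildeSobolev s Ω}
    {u₁ : Lp ℝ 2 (volume.restrict Ω)} (h1 : IsSolution hs q u₀ u₁ h u u') :
    EnergyIdentity hs q u₀ u₁ h u u' where
  integrable_damping := by
    have hκ := (halfLapCLM hs Ω).comp_memLp' (Lp.memLp u')
    exact (memLp_two_iff_integrable_sq_norm hκ.1).mp hκ
  integrable_source := integrableOn_duality h u'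
  integrable_potential_space := hq.mono fun t ht ↦ ht _ _
  integrable_potential := (integrable_inner_of_memLp (Lp.memLp (QX u)) (Lp.memLp u')).congr
    (hQ.inner_ae u u')
  identity := by
    intro U U₁ hU hU₁ t ht
    have h0 : (0 : ℝ) ∈ Icc 0 T := ⟨le_rfl, hT.le⟩
    have key := weak_energy_identity (incl hs Ω) (halfLapCLM hs Ω) hT h1.deriv_eq (h1.weak hQ)
      hU hU₁ ht
    obtain ⟨W, hW, hW0⟩ := h1.initial
    obtain ⟨W₁, hW₁, hW₁0⟩ := h1.initial_deriv
    rw [hU.eqOn hT hW h0, hW0, hU₁.eqOn hT hW₁ h0, hW₁0, ← integral_Ioo_eq_interval ht.1,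
      ← integral_Ioo_eq_interval ht.1, ← integral_Ioo_eq_interval ht.1] at key
    have hsub : Ioo 0 t ⊆ Ioo 0 T := Ioo_subset_Ioo_right ht.2
    have e1 : ∫ τ in Ioo 0 t, inner ℝ ((dualityCLM s Ω).compLpL 2 (timeMeasure T) h τ) (u' τ) =
        ∫ τ in Ioo 0 t, duality (h τ) (u' τ) := by
      refine integral_congr_ae (ae_restrict_of_ae_restrict_of_subset hsub ?_)
      filter_upwards [(dualityCLM s Ω).coeFn_compLpL h] with τ hτ
      rw [hτ, inner_dualityCLM]
    have e2 : ∫ τ in Ioo 0 t, inner ℝ (QX u τ) (u' τ) =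
        ∫ τ in Ioo 0 t, potentialForm hs q τ (u τ) (u' τ) :=
      integral_congr_ae (ae_restrict_of_ae_restrict_of_subset hsub (hQ.inner_ae u u'))
    rw [e1, e2] at key
    exact key

end Solution


/-! ### Lipschitz dependence on the data and the potential operator -/

section Stability

variable {n : ℕ} {s : ℝ} {Ω : Set (E n)} {T : ℝ} {q : E n → ℝ → ℝ}

/-- Linearity makes the difference of two solutions a weak solution for the difference of the data,
to which the a priori estimate applies. -/
theorem weakForce_sub (hs : 0 ≤ s)
    (QX : Lp (tildeSobolev s Ω) 2 (timeMeasure T) →L[ℝ] Lp (tildeSobolev s Ω) 2 (timeMeasure T))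
    (h k : Lp (SobolevOn (-s) Ω) 2 (timeMeasure T))
    (u u' v v' : Lp (tildeSobolev s Ω) 2 (timeMeasure T)) :
    weakForce hs QX (h - k) (u - v) (u' - v') = weakForce hs QX h u u' - weakForce hs QX k v v' := by
  simp only [weakForce, map_sub]
  abel

theorem IsContinuousRep.sub {X : Type*} [NormedAddCommGroup X] {u v U W : ℝ → X}
    (hu : IsContinuousRep T u U) (hv : IsContinuousRep T v W) :
    IsContinuousRep T (fun t ↦ u t - v t) (fun t ↦ U t - W t) :=
  ⟨hu.1.sub hv.1, hu.2.sub hv.2⟩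

theorem IsContinuousRep.eLpNorm_top_le {X : Type*} [NormedAddCommGroup X] {u U : ℝ → X} {B : ℝ}
    (hu : IsContinuousRep T u U) (hB : ∀ t ∈ Icc 0 T, ‖U t‖ ≤ B) :
    eLpNorm u ⊤ (timeMeasure T) ≤ ENNReal.ofReal B := by
  rw [eLpNorm_exponent_top]
  refine eLpNormEssSup_le_of_ae_bound ?_
  filter_upwards [hu.2, ae_restrict_mem measurableSet_Ioo] with t h1 h2
  rw [h1]
  exact hB t (Ioo_subset_Icc_self h2)

theorem norm_dualityCLM_le (h : SobolevOn (-s) Ω) : ‖dualityCLM s Ω h‖ ≤ ‖h‖ := by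
  rcases (norm_nonneg (dualityCLM s Ω h)).eq_or_lt with h0 | h0
  · rw [← h0]; exact norm_nonneg h
  · have h1 := inner_dualityCLM h (dualityCLM s Ω h)
    rw [real_inner_self_eq_norm_mul_norm] at h1
    have h2 := (le_abs_self _).trans (abs_duality_le h (dualityCLM s Ω h))
    rw [← h1] at h2
    exact le_of_mul_le_mul_right h2 h0

theorem norm_compLpL_dualityCLM_le (h : Lp (SobolevOn (-s) Ω) 2 (timeMeasure T)) :
    ‖(dualityCLM s Ω).compLpL 2 (timeMeasure T) h‖ ≤ ‖h‖ := by
  refine Lp.norm_le_norm_of_ae_le ?_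
  filter_upwards [(dualityCLM s Ω).coeFn_compLpL h] with t ht
  rw [ht]
  exact norm_dualityCLM_le (h t)

/-- The solution depends on the data in a Lipschitz continuous way. -/
theorem exists_lipschitz_constant (hs : 0 ≤ s) (hT : 0 < T) (hΩ : MeasurableSet Ω) {M : ℝ}
    {QX : Lp (tildeSobolev s Ω) 2 (timeMeasure T) →L[ℝ] Lp (tildeSobolev s Ω) 2 (timeMeasure T)}
    (hQ : IsPotentialOperator hs q M QX) :
    ∃ C : ℝ, 0 < C ∧
      ∀ (u₀ v₀ : tildeSobolev s Ω) (u₁ v₁ : Lp ℝ 2 (volume.restrict Ω))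
        (h k : Lp (SobolevOn (-s) Ω) 2 (timeMeasure T))
        (u u' v v' : Lp (tildeSobolev s Ω) 2 (timeMeasure T)),
        IsSolution hs q u₀ u₁ h u u' → IsSolution hs q v₀ v₁ k v v' →
        eLpNorm (fun t ↦ u t - v t) ⊤ (timeMeasure T) +
            eLpNorm (fun t ↦ incl hs Ω (u' t) - incl hs Ω (v' t)) ⊤ (timeMeasure T) +
            eLpNorm (fun t ↦ u' t - v' t) 2 (timeMeasure T) ≤
          ENNReal.ofReal (C * (‖u₀ - v₀‖ + ‖u₁ - v₁‖ + ‖h - k‖)) := by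
  obtain ⟨C, hC, hstab⟩ := exists_stability_constant (incl hs Ω) (halfLapCLM hs Ω) (M := M) hT
    (C₀ := 2 ^ s) (by positivity) (sq_norm_le_halfLap_add_incl hs hΩ)
  -- Each of the three norms is bounded by C times the difference of the data.
  refine ⟨3 * C, by positivity, fun u₀ v₀ u₁ v₁ h k u u' v v' hu hv ↦ ?_⟩
  have h0 : (0 : ℝ) ∈ Icc 0 T := ⟨le_rfl, hT.le⟩
  have i : ∀ f : Lp (tildeSobolev s Ω) 2 (timeMeasure T), IntegrableOn f (Ioo 0 T) := fun f ↦
    memLp_time_integrableOn (Lp.memLp f)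
  have ig : ∀ f : Lp (tildeSobolev s Ω) 2 (timeMeasure T),
      IntegrableOn (fun t ↦ gram (incl hs Ω) (f t)) (Ioo 0 T) := fun f ↦
    memLp_time_integrableOn ((gram (incl hs Ω)).comp_memLp' (Lp.memLp f))
  have c1 := Lp.coeFn_sub u v
  have c2 := Lp.coeFn_sub u' v'
  have w1 : IsWeakTimeDeriv T (u - v : Lp (tildeSobolev s Ω) 2 (timeMeasure T))
      (u' - v' : Lp (tildeSobolev s Ω) 2 (timeMeasure T)) :=
    (hu.deriv_eq.sub_of_integrableOn hv.deriv_eq (i u) (i u') (i v) (i v')).congr c1.symm c2.symm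
  have w2 : IsWeakTimeDeriv T
      (fun t ↦ gram (incl hs Ω) ((u' - v' : Lp (tildeSobolev s Ω) 2 (timeMeasure T)) t))
      (weakForce hs QX (h - k) (u - v) (u' - v')) := by
    rw [weakForce_sub]
    refine ((hu.weak hQ).sub_of_integrableOn (hv.weak hQ) (ig u') (i _) (ig v') (i _)).congr ?_
      (Lp.coeFn_sub _ _).symm
    filter_upwards [c2] with t ht
    rw [ht, Pi.sub_apply, map_sub]
  obtain ⟨U, hU, hU0⟩ := hu.initial
  obtain ⟨U₁, hU₁, hU₁0⟩ := hu.initial_deriv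
  obtain ⟨W, hW, hW0⟩ := hv.initial
  obtain ⟨W₁, hW₁, hW₁0⟩ := hv.initial_deriv
  have r1 := hU.sub hW
  have r2 := hU₁.sub hW₁
  have r1' : IsContinuousRep T (u - v : Lp (tildeSobolev s Ω) 2 (timeMeasure T))
      (fun t ↦ U t - W t) := ⟨r1.1, c1.trans r1.2⟩
  have r2' : IsContinuousRep T
      (fun t ↦ incl hs Ω ((u' - v' : Lp (tildeSobolev s Ω) 2 (timeMeasure T)) t))
      (fun t ↦ U₁ t - W₁ t) := by
    refine ⟨r2.1, EventuallyEq.trans ?_ r2.2⟩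
    filter_upwards [c2] with t ht
    rw [ht, Pi.sub_apply, map_sub]
  obtain ⟨b1, b2, b3⟩ := hstab (u - v) (u' - v')
    ((dualityCLM s Ω).compLpL 2 (timeMeasure T) (h - k)) (QX (u - v)) w1 w2
    (hQ.abs_le (u - v) (u' - v')) _ _ r1' r2'
  simp only [hU0, hW0, hU₁0, hW₁0] at b1 b2 b3
  set N := ‖u₀ - v₀‖ + ‖u₁ - v₁‖ + ‖h - k‖ with hN
  have hle : C * (‖u₀ - v₀‖ + ‖u₁ - v₁‖ + ‖(dualityCLM s Ω).compLpL 2 (timeMeasure T) (h - k)‖) ≤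
      C * N := by
    rw [hN]
    gcongr
    exact norm_compLpL_dualityCLM_le (h - k)
  have e3 : eLpNorm (fun t ↦ u' t - v' t) 2 (timeMeasure T) ≤ ENNReal.ofReal (C * N) := by
    have h1 : eLpNorm (fun t ↦ u' t - v' t) 2 (timeMeasure T) = ENNReal.ofReal ‖u' - v'‖ := by
      rw [Lp.norm_def, ENNReal.ofReal_toReal (Lp.memLp _).2.ne]
      exact (eLpNorm_congr_ae c2).symm
    rw [h1]
    exact ENNReal.ofReal_le_ofReal (b3.trans hle)
  have e1 := r1.eLpNorm_top_le fun t ht ↦ (b1 t ht).trans hle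
  have e2 := r2.eLpNorm_top_le fun t ht ↦ (b2 t ht).trans hle
  have hN0 : 0 ≤ C * N := by positivity
  refine (add_le_add (add_le_add e1 e2) e3).trans (le_of_eq ?_)
  rw [← ENNReal.ofReal_add hN0 hN0, ← ENNReal.ofReal_add (add_nonneg hN0 hN0) hN0]
  congr 1; ring

/-- The operator of multiplication by an admissible potential. -/
theorem exists_potentialOperator {p : ℝ≥0∞} (hn : 0 < n) (hs : 0 < s) (hΩ : Bornology.IsBounded Ω)
    (hq_loc : LocallyIntegrableOn (fun z : E n × ℝ ↦ q z.1 z.2) (Ω ×ˢ Ioo 0 T))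
    (hp : AdmissibleExponent n s p) (hq : MemLinftyLp T Ω p q) :
    ∃ M : ℝ, 0 ≤ M ∧
      (∀ᵐ t ∂timeMeasure T, ∀ u v : tildeSobolev s Ω,
        IntegrableOn (fun x ↦ q x t * incl hs.le Ω u x * incl hs.le Ω v x) Ω) ∧
      ∃ (Q : ℝ → tildeSobolev s Ω →L[ℝ] tildeSobolev s Ω →L[ℝ] ℝ)
        (QX : Lp (tildeSobolev s Ω) 2 (timeMeasure T) →L[ℝ] Lp (tildeSobolev s Ω) 2 (timeMeasure T)),
        (∀ t u v, |Q t u v| ≤ M * ‖u‖ * ‖incl hs.le Ω v‖) ∧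
        (∀ u v, AEMeasurable (fun t ↦ Q t u v) (timeMeasure T)) ∧
        (∀ u v : Lp (tildeSobolev s Ω) 2 (timeMeasure T),
          inner ℝ (QX u) v = ∫ t, Q t (u t) (v t) ∂timeMeasure T) ∧
        IsPotentialOperator hs.le q M QX := by
  obtain ⟨C, hC, hb⟩ := exists_potential_bound hn hs hΩ hp
  obtain ⟨M₀, hM₀⟩ := hq
  have hM : 0 ≤ C * M₀ := by positivity
  have hae := hM₀.mono fun t ht ↦ hb (fun x ↦ q x t) M₀ ht.1 ht.2
  obtain ⟨Q, hQ1, hQ2⟩ := exists_potential_bilin hs.le hM hae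
  have hQm : ∀ u v, AEMeasurable (fun t ↦ Q t u v) (timeMeasure T) := fun u v ↦
    (aemeasurable_potentialForm hs.le hq_loc u v).congr (hQ2.mono fun t ht ↦ (ht u v).symm)
  have hQ3 : ∀ t u v, |Q t u v| ≤ C * M₀ * ‖incl hs.le Ω‖ * ‖u‖ * ‖v‖ := fun t u v ↦
    (hQ1 t u v).trans (by
      calc C * M₀ * ‖u‖ * ‖incl hs.le Ω v‖ ≤ C * M₀ * ‖u‖ * (‖incl hs.le Ω‖ * ‖v‖) := by
            gcongr; exact (incl hs.le Ω).le_opNorm v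
        _ = _ := by ring)
  obtain ⟨QX, hQX⟩ := exists_operator_of_bilin hQ3 hQm
  refine ⟨C * M₀, hM, hae.mono fun t ht u v ↦ (potentialForm_props hs.le ht hM u v).1, Q, QX, hQ1,
    hQm, hQX, fun u v ↦ ?_, fun u v ↦ ?_⟩
  · filter_upwards [operator_ae_eq_bilin hQ3 hQm QX hQX u v, hQ2] with t h1 h2
    rw [h1, h2]
  · filter_upwards [operator_ae_eq_bilin hQ3 hQm QX hQX u v] with t h1
    rw [h1]
    exact hQ1 t _ _

end Stability

end ViscousWave

/-! ### Assembly of the theorem -/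

theorem theorem3p1 (n : ℕ) (hn : 0 < n) (Ω : Set (E n)) (hΩ : IsBoundedLipschitzDomain Ω)
    (T : ℝ) (hT : 0 < T) (s : ℝ) (hs : 0 < s) (q : E n → ℝ → ℝ)
    (hq_loc : LocallyIntegrableOn (fun z : E n × ℝ ↦ q z.1 z.2) (Ω ×ˢ Ioo 0 T))
    (p : ℝ≥0∞) (hp : AdmissibleExponent n s p) (hq : MemLinftyLp T Ω p q)
    (hq_cont : WeaklyContinuousInTime T Ω q) :
    (∀ (u₀ : tildeSobolev s Ω) (u₁ : Lp ℝ 2 (volume.restrict Ω))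
        (h : Lp (SobolevOn (-s) Ω) 2 (timeMeasure T)),
      (∃! u : Lp (tildeSobolev s Ω) 2 (timeMeasure T), ∃ u', IsSolution hs.le q u₀ u₁ h u u') ∧
      ∀ u u', IsSolution hs.le q u₀ u₁ h u u' → EnergyIdentity hs.le q u₀ u₁ h u u') ∧
    ∃ C : ℝ, 0 < C ∧
      ∀ (u₀ v₀ : tildeSobolev s Ω) (u₁ v₁ : Lp ℝ 2 (volume.restrict Ω))
        (h k : Lp (SobolevOn (-s) Ω) 2 (timeMeasure T))
        (u u' v v' : Lp (tildeSobolev s Ω) 2 (timeMeasure T)),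
        IsSolution hs.le q u₀ u₁ h u u' → IsSolution hs.le q v₀ v₁ k v v' →
        eLpNorm (fun t ↦ u t - v t) ∞ (timeMeasure T) +
            eLpNorm (fun t ↦ incl hs.le Ω (u' t) - incl hs.le Ω (v' t)) ∞ (timeMeasure T) +
            eLpNorm (fun t ↦ u' t - v' t) 2 (timeMeasure T) ≤
          ENNReal.ofReal (C * (‖u₀ - v₀‖ + ‖u₁ - v₁‖ + ‖h - k‖)) := by
  obtain ⟨M, hM, hint, Q, QX, hQ, hQm, hQX, hop⟩ :=
    exists_potentialOperator hn hs hΩ.isBounded hq_loc hp hq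
  obtain ⟨C, hC, hlip⟩ := exists_lipschitz_constant hs.le hT hΩ.isOpen.measurableSet hop
  refine ⟨fun u₀ u₁ h ↦ ⟨?_, fun u u' hu ↦ hu.energyIdentity hT hop hint⟩, C, hC, hlip⟩
  obtain ⟨u, u', h1, h2, h3, h4⟩ := exists_weak_solution (incl hs.le Ω) (halfLapCLM hs.le Ω) hT
    (C₀ := 2 ^ s) (by positivity) (sq_norm_le_halfLap_add_incl hs.le hΩ.isOpen.measurableSet) hM
    (eq_zero_of_inner_incl_eq_zero hs.le hΩ.isOpen) hQ hQm QX hQX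
    ((dualityCLM s Ω).compLpL 2 (timeMeasure T) h) u₀ u₁
  have hu : IsSolution hs.le q u₀ u₁ h u u' := IsSolution.of_weak hΩ.isOpen hop h1 h2 h3 h4
  -- Uniqueness is the Lipschitz estimate for equal data: its right side vanishes, and with it the
  -- L^∞ norm of the difference.
  refine ⟨u, ⟨u', hu⟩, fun v ⟨v', hv⟩ ↦ ?_⟩
  have h5 := hlip u₀ u₀ u₁ u₁ h h v v' u u' hv hu
  simp only [sub_self, norm_zero, add_zero, mul_zero, ENNReal.ofReal_zero, nonpos_iff_eq_zero,
    add_eq_zero] at h5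
  have h6 := (eLpNorm_eq_zero_iff ((Lp.aestronglyMeasurable v).sub (Lp.aestronglyMeasurable u))
    (by simp)).mp h5.1.1
  apply Lp.ext
  filter_upwards [h6] with t ht
  exact sub_eq_zero.mp ht
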